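/- Let $M$ be a non-empty compact smooth manifold (Hausdorff, without boundary, not necessarily connected) of dimension $2d$, $d\ge 1$, and let $\omega$ be a symplectic form on $M$ (a smooth, closed, nondegenerate $2$-form). Let $\mathrm{Symp}^1_\omega(M)$ be the group of $C^1$ diffeomorphisms of $M$ that preserve $\omega$, with the $C^1$ topology. A periodic point $x$ of (least) period $n\geq 1$ of $f\in\mathrm{Symp}^1_\omega(M)$ is \emph{totally elliptic} if all the complex eigenvalues of $Df^n(x)$ have modulus $1$. It is \emph{$C^1$-robust} if every $g$ in some $C^1$-neighbourhood $\mathcal U\subset \mathrm{Symp}^1_\omega(M)$ of $f$ has a totally elliptic periodic point $x_g$ of period $n$, where $x_f=x$ and $x_g$ depends continuously on $g\in\mathcal U$. Let $\mathcal O\subset \mathrm{Symp}^1_\omega(M)$ be the set of the symplectomorphisms that have a $C^1$-robust totally elliptic periodic point. Then $\mathcal O$ is open and non-empty, and there is a subset $\mathcal D\subset\mathcal O$, dense in $\mathcal O$, such that every $f\in\mathcal D$ has a non-trivial centralizer: its symplectic centralizer $C_\omega(f)=\{g\in \mathrm{Symp}^1_\omega(M): fg=gf\}$ is different from $\{f^k: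 k\in\mathbb Z\}$. More precisely, for every $f\in\mathcal D$, the group $C_\omega(f)$ contains a subgroup isomorphic to the group $\mathrm{Symp}^1_\omega(\mathbb R^{2d},\mathbb R^{2d}\setminus\mathbb D^{2d})$ of the $C^1$ symplectomorphisms of $\mathbb R^{2d}$ (with its standard symplectic form) that are equal to the identity on the complement of the unit disc $\mathbb D^{2d}$. -/

import Mathlib

open scoped Manifold ContDiff Topology

noncomputable section

namespace SympCentralizer

section Forms

variable {E : Type*} [NormedAddCommGroup E] [NormedSpace ℝ E]
variable {M : Type*} [TopologicalSpace M] [ChartedSpace E M]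

/-- A (not necessarily continuous) field of alternating 2-forms on the tangent spaces of a
manifold `M` modelled on `E`. -/
abbrev TwoForm (E : Type*) [NormedAddCommGroup E] [NormedSpace ℝ E]
    (M : Type*) [TopologicalSpace M] [ChartedSpace E M] :=
  ∀ x : M, TangentSpace 𝓘(ℝ, E) x [⋀^Fin 2]→L[ℝ] ℝ

/-- The expression `(e⁻¹)^* Ω` of a 2-form `Ω` in a chart `e`. -/
def TwoForm.inChart (Ω : TwoForm E M) (e : OpenPartialHomeomorph M E) :
    E → E [⋀^Fin 2]→L[ℝ] ℝ := fun y =>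
  (Ω (e.symm y)).compContinuousLinearMap (mfderiv 𝓘(ℝ, E) 𝓘(ℝ, E) e.symm y)

/-- A symplectic form on `M`: a smooth, closed and nondegenerate 2-form. Smoothness and
closedness are read in the charts of the atlas. -/
structure IsSymplecticForm (Ω : TwoForm E M) : Prop where
  smooth : ∀ e ∈ atlas E M, ContDiffOn ℝ ∞ (Ω.inChart e) e.target
  closed : ∀ e ∈ atlas E M, ∀ y ∈ e.target, extDeriv (Ω.inChart e) y = 0
  nondegenerate : ∀ (x : M) (v : TangentSpace 𝓘(ℝ, E) x),
    (∀ w : TangentSpace 𝓘(ℝ, E) x, Ω x ![v, w] = 0) → v = 0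

/-- The pullback `f^* Ω` of a 2-form `Ω` by a self-map `f` of `M`. -/
def TwoForm.pullback (Ω : TwoForm E M) (f : M → M) : TwoForm E M := fun x =>
  (Ω (f x)).compContinuousLinearMap (mfderiv 𝓘(ℝ, E) 𝓘(ℝ, E) f x)

theorem TwoForm.pullback_id (Ω : TwoForm E M) : Ω.pullback id = Ω := by
  funext x
  simp only [TwoForm.pullback, mfderiv_id]
  rfl

theorem TwoForm.pullback_comp (Ω : TwoForm E M) {f g : M → M}
    (hf : ContMDiff 𝓘(ℝ, E) 𝓘(ℝ, E) 1 f) (hg : ContMDiff 𝓘(ℝ, E) 𝓘(ℝ, E) 1 g) :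
    Ω.pullback (f ∘ g) = (Ω.pullback f).pullback g := by
  funext x
  simp only [TwoForm.pullback]
  rw [mfderiv_comp x (hf.mdifferentiable one_ne_zero (g x)) (hg.mdifferentiable one_ne_zero x)]
  rfl

/-- The group of symplectomorphisms of `(M, Ω)`: the `C^1` diffeomorphisms `f` of `M` (bijections
that are `C^1` together with their inverse) such that `f^* Ω = Ω`. -/
def Symp (Ω : TwoForm E M) : Subgroup (Equiv.Perm M) where
  carrier := {f | ContMDiff 𝓘(ℝ, E) 𝓘(ℝ, E) 1 f ∧ ContMDiff 𝓘(ℝ, E) 𝓘(ℝ, E) 1 f.symm ∧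
    Ω.pullback f = Ω}
  mul_mem' := by
    rintro f g ⟨hf, hf', hfΩ⟩ ⟨hg, hg', hgΩ⟩
    refine ⟨hf.comp hg, hg'.comp hf', ?_⟩
    rw [Equiv.Perm.coe_mul, TwoForm.pullback_comp Ω hf hg, hfΩ, hgΩ]
  one_mem' := ⟨contMDiff_id, contMDiff_id, Ω.pullback_id⟩
  inv_mem' := by
    rintro f ⟨hf, hf', hfΩ⟩
    refine ⟨hf', hf, ?_⟩
    have h := TwoForm.pullback_comp Ω hf hf'
    rw [Equiv.self_comp_symm, TwoForm.pullback_id, hfΩ] at h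
    exact h.symm

/-- The subgroup of the symplectomorphisms that are the identity on the set `S`. -/
def SympRel (Ω : TwoForm E M) (S : Set M) : Subgroup (Equiv.Perm M) where
  carrier := {f | f ∈ Symp Ω ∧ ∀ x ∈ S, f x = x}
  mul_mem' := by
    rintro f g ⟨hf, hfS⟩ ⟨hg, hgS⟩
    refine ⟨mul_mem hf hg, fun x hx => ?_⟩
    rw [Equiv.Perm.mul_apply, hgS x hx, hfS x hx]
  one_mem' := ⟨one_mem _, fun _ _ => rfl⟩
  inv_mem' := by
    rintro f ⟨hf, hfS⟩
    refine ⟨inv_mem hf, fun x hx => ?_⟩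
    rw [Equiv.Perm.inv_eq_iff_eq, hfS x hx]

end Forms

section Dynamics

variable {E : Type*} [NormedAddCommGroup E] [NormedSpace ℝ E]
variable {M : Type*} [TopologicalSpace M] [ChartedSpace E M] [IsManifold 𝓘(ℝ, E) ∞ M]

/-- The tangent map `Tf : TM → TM` of a symplectomorphism, as a continuous map. -/
def Symp.tangent {Ω : TwoForm E M} (f : Symp Ω) :
    C(TangentBundle 𝓘(ℝ, E) M, TangentBundle 𝓘(ℝ, E) M) where
  toFun := tangentMap 𝓘(ℝ, E) 𝓘(ℝ, E) (f : Equiv.Perm M)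
  continuous_toFun := f.2.1.continuous_tangentMap le_rfl

/-- The `C^1` topology on the group of symplectomorphisms (of a compact manifold): uniform
convergence of the tangent maps on the compact subsets of `TM`. -/
instance Symp.c1Topology (Ω : TwoForm E M) : TopologicalSpace (Symp Ω) :=
  TopologicalSpace.induced Symp.tangent inferInstance

/-- `x` is a totally elliptic periodic point of `f`, of period `n`: it is periodic of (least)
period `n`, and all the complex eigenvalues of `Df^n(x)`, an endomorphism of
`T_x M = T_{f^n x} M`, have modulus one. -/
def IsTotallyElliptic [FiniteDimensional ℝ E] {Ω : TwoForm E M} (f : Symp Ω) (n : ℕ) (x : M) :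
    Prop :=
  0 < n ∧ Function.minimalPeriod (f : Equiv.Perm M) x = n ∧
    let A : E →L[ℝ] E := mfderiv 𝓘(ℝ, E) 𝓘(ℝ, E) ((f : Equiv.Perm M) : M → M)^[n] x
    ∀ μ : ℂ, Polynomial.aeval μ (LinearMap.charpoly (A : E →ₗ[ℝ] E)) = 0 → ‖μ‖ = 1

/-- `x` is a `C^1`-robust totally elliptic periodic point of `f`, of period `n`: every
symplectomorphism `g` in some `C^1`-neighbourhood of `f` has a totally elliptic periodic point
`p g` of period `n`, which depends continuously on `g` and satisfies `p f = x`. -/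
def IsRobustTotallyElliptic [FiniteDimensional ℝ E] {Ω : TwoForm E M} (f : Symp Ω) (n : ℕ)
    (x : M) : Prop :=
  ∃ U ∈ 𝓝 f, ∃ p : Symp Ω → M, p f = x ∧ ContinuousOn p U ∧ ∀ g ∈ U, IsTotallyElliptic g n (p g)

/-- The set of the symplectomorphisms that have a `C^1`-robust totally elliptic periodic point. -/
def robustEllipticSet [FiniteDimensional ℝ E] (Ω : TwoForm E M) : Set (Symp Ω) :=
  {f | ∃ (n : ℕ) (x : M), IsRobustTotallyElliptic f n x}

end Dynamics

section Standard

/-- The Euclidean space `ℝ^{2d}`, with coordinates `(p_i, q_i)` indexed by `Fin d ⊕ Fin d`. -/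
abbrev R2 (d : ℕ) := EuclideanSpace ℝ (Fin d ⊕ Fin d)

/-- The alternating form `(v, w) ↦ ∑ i, (p_i(v) q_i(w) - q_i(v) p_i(w))` on `ℝ^{2d}`. -/
def stdAlt (d : ℕ) : R2 d [⋀^Fin 2]→L[ℝ] ℝ where
  toFun v := ∑ i : Fin d, (v 0 (Sum.inl i) * v 1 (Sum.inr i) - v 0 (Sum.inr i) * v 1 (Sum.inl i))
  map_update_add' := by
    intro _ v k x y
    rw [← Finset.sum_add_distrib]
    refine Finset.sum_congr rfl fun i _ => ?_
    fin_cases k <;> simp [Function.update] <;> ring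
  map_update_smul' := by
    intro _ v k c x
    rw [smul_eq_mul, Finset.mul_sum]
    refine Finset.sum_congr rfl fun i _ => ?_
    fin_cases k <;> simp [Function.update] <;> ring
  map_eq_zero_of_eq' := by
    intro v i j hv hij
    have h : v 0 = v 1 := by
      fin_cases i <;> fin_cases j <;> first | exact absurd rfl hij | exact hv | exact hv.symm
    rw [h]
    exact Finset.sum_eq_zero fun i _ => by ring
  cont := by fun_prop

/-- The standard symplectic form `∑ dp_i ∧ dq_i` on the manifold `ℝ^{2d}`. -/
def stdForm (d : ℕ) : TwoForm (R2 d) (R2 d) := fun _ => stdAlt d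

/-- The group of the symplectomorphisms of `ℝ^{2d}` that are the identity on the complement of
the unit disc. -/
abbrev SympDisc (d : ℕ) : Subgroup (Equiv.Perm (R2 d)) :=
  SympRel (stdForm d) (Metric.closedBall (0 : R2 d) 1)ᶜ

end Standard

end SympCentralizer

end

/-!
Openness of the set `𝒪` of symplectomorphisms with a robust totally elliptic periodic point is part
of the definition of robustness. It is not empty: in a Darboux chart (`exists_isDarbouxChart`, by
Moser's method), a map that is the rotation `R = cos t + sin t J` near the origin has a fixed point
whose differential `A` satisfies `Ω(v, A v) > 0` for all `v ≠ 0`. This condition is open, it forces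
the eigenvalues to have modulus one (`norm_eq_one_of_charpoly_root`), and it forces `A - 1` to be
invertible, so that the fixed point persists, continuously, as the fixed point of a contraction
(`isRobustTotallyElliptic_one_of_pos`).

The dense set `𝒟` consists of the maps in `𝒪` some positive power of which is the identity on a
non-empty open set. It is dense because of two facts. Linear algebra: every linear symplectic map
whose eigenvalues have modulus one is a limit of linear symplectic maps of finite order
(`exists_finite_order_near`). Extension of germs: a symplectic germ at the origin of `ℝ^{2d}` with
differential close to the identity is the germ of a symplectic diffeomorphism that is `C¹`-close to
the identity and supported in a small ball (`exists_symplectic_extension`); the midpoint generating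
function `(x + H x) / 2 ↦ H x - x` turns symplectic germs into closed 1-forms, which can be cut off.
If `f` has a totally elliptic point `x` of period `n`, composing `f` with such a diffeomorphism near
`x` makes the return map `f^n` linear of finite order near `x` in a Darboux chart.

If `f` is in `𝒟`, then at the points where its least period is largest, in an open set where a power
of `f` is the identity, that period `p` is locally constant. Hence there is a disc `B` such that
`B, f B, …, f^{p-1} B` are disjoint and `f^p` is the identity on `B`. A symplectic map `φ` supported
in `B` extends to the product of the `f^k φ f^{-k}`, `k < p`, which commutes with `f`
(`exists_commuting_extension`). So the centralizer contains a copy of the group of symplectic maps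
of the disc, which is not commutative, whereas the group of the powers of `f` is.
-/

set_option maxSynthPendingDepth 3


namespace SympCentralizer

/-! ### Totally elliptic endomorphisms and plane rotations -/

section LinearApproximation

open LinearMap (BilinForm)

variable {V : Type*} [NormedAddCommGroup V] [NormedSpace ℝ V]

/-- A linear symplectic form: an alternating and nondegenerate bilinear form. -/
structure IsLinearSymplectic (σ : BilinForm ℝ V) : Prop where
  alt : ∀ x, σ x x = 0
  nondeg : ∀ x, (∀ y, σ x y = 0) → x = 0

theorem IsLinearSymplectic.neg {σ : BilinForm ℝ V} (h : IsLinearSymplectic σ) (x y : V) :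
    σ y x = - σ x y := by
  have h1 := h.alt (x + y)
  simp only [map_add, LinearMap.add_apply, h.alt] at h1
  linarith

/-- The quadratic polynomial `A² - 2cA + 1` in `A`. For `|c| ≤ 1` its roots are the two conjugate
complex numbers of modulus one with real part `c`. -/
def palin (A : Module.End ℝ V) (c : ℝ) : Module.End ℝ V := A * A - (2 * c) • A + 1

theorem palin_apply (A : Module.End ℝ V) (c : ℝ) (x : V) :
    palin A c x = A (A x) - (2 * c) • A x + x := by
  simp [palin]

theorem palin_commute (A : Module.End ℝ V) (c : ℝ) : Commute A (palin A c) := by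
  unfold palin
  refine ((Commute.sub_right ?_ ?_).add_right (Commute.one_right _))
  · exact (Commute.refl A).mul_right (Commute.refl A)
  · exact (Commute.refl A).smul_right _

/-- Total ellipticity of an endomorphism, without reference to complex eigenvalues: it is killed
by a product of polynomials `t² - 2ct + 1` with `|c| ≤ 1`. -/
def IsUnitModulus (A : Module.End ℝ V) : Prop :=
  ∃ l : List ℝ, (∀ c ∈ l, |c| ≤ 1) ∧ (l.map (palin A)).prod = 0

/-- The linear symplectic maps of finite order (as functions) for which no number of
modulus one and real part in `Z` is an eigenvalue. -/
def finiteOrderAvoiding (σ : BilinForm ℝ V) (Z : Set ℝ) : Set (V → V) :=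
  {g | ∃ B : Module.End ℝ V, ⇑B = g ∧ (∀ x y, σ (B x) (B y) = σ x y) ∧
    (∃ N : ℕ, 0 < N ∧ B ^ N = 1) ∧ ∀ c ∈ Z, ∀ x, palin B c x = 0 → x = 0}

theorem palin_intertwine {V' : Type*} [NormedAddCommGroup V'] [NormedSpace ℝ V']
    {A : Module.End ℝ V} {A' : Module.End ℝ V'} (T : V →ₗ[ℝ] V') (h : ∀ x, T (A x) = A' (T x))
    (c : ℝ) (x : V) : T (palin A c x) = palin A' c (T x) := by
  simp [palin_apply, h]

theorem palin_prod_intertwine {V' : Type*} [NormedAddCommGroup V'] [NormedSpace ℝ V']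
    {A : Module.End ℝ V} {A' : Module.End ℝ V'} (T : V →ₗ[ℝ] V') (h : ∀ x, T (A x) = A' (T x))
    (l : List ℝ) (x : V) : T ((l.map (palin A)).prod x) = (l.map (palin A')).prod (T x) := by
  induction l generalizing x with
  | nil => simp
  | cons c l ih => simp [palin_intertwine T h, ih]

theorem IsUnitModulus.of_injective {V' : Type*} [NormedAddCommGroup V'] [NormedSpace ℝ V']
    {A : Module.End ℝ V} {A' : Module.End ℝ V'} (hA : IsUnitModulus A') (T : V →ₗ[ℝ] V')
    (h : ∀ x, T (A x) = A' (T x)) (hT : Function.Injective T) : IsUnitModulus A := by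
  obtain ⟨l, hl, h0⟩ := hA
  refine ⟨l, hl, LinearMap.ext fun x => hT ?_⟩
  rw [palin_prod_intertwine T h, h0]
  simp

theorem IsUnitModulus.of_surjective {V' : Type*} [NormedAddCommGroup V'] [NormedSpace ℝ V']
    {A : Module.End ℝ V} {A' : Module.End ℝ V'} (hA : IsUnitModulus A) (T : V →ₗ[ℝ] V')
    (h : ∀ x, T (A x) = A' (T x)) (hT : Function.Surjective T) : IsUnitModulus A' := by
  obtain ⟨l, hl, h0⟩ := hA
  refine ⟨l, hl, LinearMap.ext fun y => ?_⟩
  obtain ⟨x, rfl⟩ := hT y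
  rw [← palin_prod_intertwine T h, h0]
  simp

theorem IsUnitModulus.exists_palin_eq_zero [Nontrivial V] {A : Module.End ℝ V}
    (hA : IsUnitModulus A) : ∃ c : ℝ, |c| ≤ 1 ∧ ∃ v, v ≠ 0 ∧ palin A c v = 0 := by
  obtain ⟨l, hl, h0⟩ := hA
  by_contra! hcon
  obtain ⟨v, hv⟩ := exists_ne (0 : V)
  have key : ∀ (l : List ℝ), (∀ c ∈ l, |c| ≤ 1) → (l.map (palin A)).prod v ≠ 0 := by
    intro l
    induction l with
    | nil => intro _; simpa using hv
    | cons c l ih =>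
      intro h
      simp only [List.map_cons, List.prod_cons, Module.End.mul_apply]
      exact hcon c (h c (by simp)) _ (ih fun d hd => h d (by simp [hd]))
  exact key l hl (by rw [h0]; rfl)

/-- On a vector killed by `A² - 2 cos t A + 1`, the iterates of `A` are given by a rotation of
angle `t`. -/
theorem sin_smul_pow_apply {A : Module.End ℝ V} {t : ℝ} {x : V}
    (hx : palin A (Real.cos t) x = 0) (n : ℕ) :
    Real.sin t • (A ^ n) x = Real.sin (n * t) • A x - Real.sin (n * t - t) • x := by
  have h2 : A (A x) = (2 * Real.cos t) • A x - x := by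
    rw [palin_apply] at hx
    rw [← sub_eq_zero, ← hx]; abel
  induction n with
  | zero => simp
  | succ n ih =>
    have hc : A ((A ^ n) x) = (A ^ (n + 1)) x := by rw [pow_succ']; rfl
    rw [← hc, ← map_smul, ih, map_sub, map_smul, map_smul, h2, smul_sub, smul_smul]
    have e1 : ((n + 1 : ℕ) : ℝ) * t = n * t + t := by push_cast; ring
    rw [e1, add_sub_cancel_right, Real.sin_add, Real.sin_sub]
    module

theorem pow_apply_eq_self {A : Module.End ℝ V} {t : ℝ} {x : V}
    (hx : palin A (Real.cos t) x = 0) (ht : Real.sin t ≠ 0) {n : ℕ} {k : ℤ}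
    (hn : n * t = k * (2 * Real.pi)) : (A ^ n) x = x := by
  have h := sin_smul_pow_apply hx n
  have e1 : Real.sin (k * (2 * Real.pi)) = 0 := by
    have := Real.sin_int_mul_pi (k * 2)
    push_cast at this; rw [← this]; ring_nf
  have e2 : Real.sin (k * (2 * Real.pi) - t) = - Real.sin t := by
    rw [Real.sin_sub, e1, Real.cos_int_mul_two_pi]; ring
  rw [hn, e1, e2] at h
  simp only [zero_smul, neg_smul, zero_sub, neg_neg] at h
  exact smul_right_injective V ht h

/-- The real parts of the roots of unity, `±1` excepted. -/
def rationalCos : Set ℝ :=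
  {c | ∃ t : ℝ, c = Real.cos t ∧ Real.sin t ≠ 0 ∧ ∃ (n : ℕ) (k : ℤ), 0 < n ∧
    n * t = k * (2 * Real.pi)}

/-- The cosines of the rational multiples of `2π` are dense in `[-1, 1]`, and remain so when
finitely many of them are removed. -/
theorem mem_closure_rationalCos {c : ℝ} (hc : |c| ≤ 1) {Z : Set ℝ} (hZ : Z.Finite) :
    c ∈ closure (rationalCos \ Z) := by
  have hsub : Set.Ioo (-1 : ℝ) 1 \ Z ⊆ closure (rationalCos \ Z) := by
    rintro a ⟨⟨ha1, ha2⟩, haZ⟩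
    rw [mem_closure_iff]
    intro o ho hao
    set O : Set ℝ := (o ∩ Set.Ioo (-1 : ℝ) 1) \ Z with hO
    have hOo : IsOpen O := (ho.inter isOpen_Ioo).sdiff hZ.isClosed
    have hpre : IsOpen ((fun q : ℝ => Real.cos (q * (2 * Real.pi))) ⁻¹' O) :=
      hOo.preimage (by fun_prop)
    obtain ⟨q, hq⟩ := Rat.denseRange_cast (𝕜 := ℝ) |>.exists_mem_open hpre
      ⟨Real.arccos a / (2 * Real.pi), by
        have : Real.arccos a / (2 * Real.pi) * (2 * Real.pi) = Real.arccos a := by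
          field_simp
        simp only [Set.mem_preimage, this, Real.cos_arccos ha1.le ha2.le]
        exact ⟨⟨hao, ha1, ha2⟩, haZ⟩⟩
    refine ⟨Real.cos (q * (2 * Real.pi)), hq.1.1, ⟨_, rfl, ?_, q.den, q.num, q.pos, ?_⟩, hq.2⟩
    · intro h
      have := Real.sin_sq_add_cos_sq (q * (2 * Real.pi))
      have h3 := hq.1.2
      rw [h] at this
      simp only [Set.mem_Ioo] at h3
      nlinarith
    · rw [← mul_assoc]
      congr 1
      exact_mod_cast Rat.den_mul_eq_num q
  have h2 : Set.Icc (-1 : ℝ) 1 ⊆ closure (Set.Ioo (-1 : ℝ) 1 \ Z) := by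
    have hd : Dense (Zᶜ : Set ℝ) := by
      have := (dense_univ (X := ℝ)).sdiff_finite hZ
      rwa [← Set.compl_eq_univ_sdiff] at this
    have := hd.open_subset_closure_inter (isOpen_Ioo (a := (-1 : ℝ)) (b := 1))
    rw [Set.sdiff_eq]
    calc Set.Icc (-1 : ℝ) 1 = closure (Set.Ioo (-1 : ℝ) 1) := by rw [closure_Ioo (by norm_num)]
      _ ⊆ _ := closure_minimal this isClosed_closure
  have h3 := closure_mono hsub
  rw [closure_closure] at h3
  exact h3 (h2 (abs_le.mp hc))

/-- The plane rotations: a symplectic map `B` with `B² - 2cB + 1 = 0` has finite order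
if `c` is the real part of a root of unity. -/
theorem mem_finiteOrderAvoiding_of_palin {σ : BilinForm ℝ V} {B : Module.End ℝ V}
    (hσ : IsLinearSymplectic σ) (hB : ∀ x y, σ (B x) (B y) = σ x y) {Z : Set ℝ} {c : ℝ}
    (hc : c ∈ rationalCos \ Z) (h : ∀ x, palin B c x = 0) : ⇑B ∈ finiteOrderAvoiding σ Z := by
  obtain ⟨⟨t, rfl, ht, n, k, hn, hnt⟩, hcZ⟩ := hc
  refine ⟨B, rfl, hB, ⟨n, hn, LinearMap.ext fun x => pow_apply_eq_self (h x) ht hnt⟩, ?_⟩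
  intro c' hc' x hx
  have h1 := h x
  rw [palin_apply] at h1 hx
  have h2 : (2 * (c' - Real.cos t)) • B x = 0 := by
    rw [← sub_eq_zero.mpr (h1.trans hx.symm)]; module
  have h3 : B x = 0 := by
    refine (smul_eq_zero.mp h2).resolve_left ?_
    have : c' ≠ Real.cos t := fun e => hcZ (e ▸ hc')
    exact mul_ne_zero two_ne_zero (sub_ne_zero.mpr this)
  exact hσ.nondeg x fun y => by rw [← hB, h3]; simp

end LinearApproximation

/-! ### Splitting along symplectic subspaces -/

section LinearApproximation
open LinearMap (BilinForm)

variable {V : Type*} [NormedAddCommGroup V] [NormedSpace ℝ V]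

theorem symplectic_injective {σ : BilinForm ℝ V} (hσ : IsLinearSymplectic σ) {A : Module.End ℝ V}
    (hA : ∀ x y, σ (A x) (A y) = σ x y) : Function.Injective A := by
  rw [← LinearMap.ker_eq_bot, LinearMap.ker_eq_bot']
  intro x hx
  exact hσ.nondeg x fun y => by rw [← hA, hx]; simp

/-- The symplectic orthogonal of a subspace. -/
def symplOrtho (σ : BilinForm ℝ V) (W : Submodule ℝ V) : Submodule ℝ V where
  carrier := {x | ∀ w ∈ W, σ x w = 0}
  add_mem' := fun ha hb w hw => by simp [ha w hw, hb w hw]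
  zero_mem' := fun w _ => by simp
  smul_mem' := fun c x hx w hw => by simp [hx w hw]

theorem mem_symplOrtho {σ : BilinForm ℝ V} {W : Submodule ℝ V} {x : V} :
    x ∈ symplOrtho σ W ↔ ∀ w ∈ W, σ x w = 0 := Iff.rfl

theorem IsLinearSymplectic.domRestrict {σ : BilinForm ℝ V} (hσ : IsLinearSymplectic σ)
    {W : Submodule ℝ V} (hW : ∀ x ∈ W, (∀ y ∈ W, σ x y = 0) → x = 0) :
    IsLinearSymplectic (σ.domRestrict₁₂ W W) where
  alt := fun x => hσ.alt x
  nondeg := fun x hx => Subtype.ext (hW x x.2 fun y hy => hx ⟨y, hy⟩)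

theorem isCompl_symplOrtho [FiniteDimensional ℝ V] {σ : BilinForm ℝ V}
    (hσ : IsLinearSymplectic σ)
    {W : Submodule ℝ V} (hW : ∀ x ∈ W, (∀ y ∈ W, σ x y = 0) → x = 0) :
    IsCompl W (symplOrtho σ W) := by
  have hrefl : σ.IsRefl := by
    intro x y h
    rw [hσ.neg, h, neg_zero]
  have h1 : symplOrtho σ W = BilinForm.orthogonal σ W := by
    ext x
    simp only [mem_symplOrtho, BilinForm.mem_orthogonal_iff]
    exact forall₂_congr fun w _ => ⟨fun h => by rw [hσ.neg, h, neg_zero],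
      fun h => by rw [hσ.neg, h, neg_zero]⟩
  rw [h1]
  apply (BilinForm.isCompl_orthogonal_iff_disjoint hrefl).mpr
  rw [Submodule.disjoint_def]
  intro x hx hx'
  rw [← h1] at hx'
  exact hW x hx hx'

theorem symplOrtho_nondeg [FiniteDimensional ℝ V] {σ : BilinForm ℝ V}
    (hσ : IsLinearSymplectic σ)
    {W : Submodule ℝ V} (hW : ∀ x ∈ W, (∀ y ∈ W, σ x y = 0) → x = 0) :
    ∀ x ∈ symplOrtho σ W, (∀ y ∈ symplOrtho σ W, σ x y = 0) → x = 0 := by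
  intro x hx h
  refine hσ.nondeg x fun y => ?_
  have : y ∈ W ⊔ symplOrtho σ W := by
    rw [(isCompl_symplOrtho hσ hW).sup_eq_top]; trivial
  obtain ⟨a, ha, b, hb, rfl⟩ := Submodule.mem_sup.mp this
  rw [map_add, hx a ha, h b hb, add_zero]

/-- Approximations on a symplectic subspace and on its orthogonal add up. -/
theorem mem_closure_of_splitting [FiniteDimensional ℝ V] {σ : BilinForm ℝ V}
    (hσ : IsLinearSymplectic σ) {A : Module.End ℝ V}
    {W : Submodule ℝ V} (hW : ∀ x ∈ W, (∀ y ∈ W, σ x y = 0) → x = 0) {Z : Set ℝ}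
    (h1 : ∀ x ∈ W, A x ∈ W) (h2 : ∀ x ∈ symplOrtho σ W, A x ∈ symplOrtho σ W)
    (hA1 : ⇑(A.restrict h1) ∈ closure (finiteOrderAvoiding (σ.domRestrict₁₂ W W) Z))
    (hA2 : ⇑(A.restrict h2) ∈ closure (finiteOrderAvoiding
      (σ.domRestrict₁₂ (symplOrtho σ W) (symplOrtho σ W)) Z)) :
    ⇑A ∈ closure (finiteOrderAvoiding σ Z) := by
  set W' := symplOrtho σ W with hW'
  have hc : IsCompl W W' := isCompl_symplOrtho hσ hW
  set p := W.projectionOnto W' hc with hp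
  set p' := W'.projectionOnto W hc.symm with hp'
  have hsum : ∀ x, (p x : V) + p' x = x := fun x => by
    exact Submodule.projection_add_projection_eq_self hc x
  have hpc : Continuous p := LinearMap.continuous_of_finiteDimensional p
  have hpc' : Continuous p' := LinearMap.continuous_of_finiteDimensional p'
  let glue : (W → W) → (W' → W') → (V → V) := fun f f' x => f (p x) + f' (p' x)
  have hgc : Continuous (Function.uncurry glue) := by
    refine continuous_pi fun x => ?_
    simp only [Function.uncurry, glue]
    fun_prop
  have hgA : glue (A.restrict h1) (A.restrict h2) = A := by
    funext x
    simp only [glue, LinearMap.coe_restrict_apply]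
    rw [← map_add, hsum]
  rw [← hgA]
  refine map_mem_closure₂ hgc hA1 hA2 ?_
  rintro _ ⟨B, rfl, hB, ⟨N, hN, hBN⟩, hBZ⟩ _ ⟨B', rfl, hB', ⟨N', hN', hBN'⟩, hBZ'⟩
  have hpW : ∀ x : W, p x = x := fun x => Submodule.projectionOnto_apply_left hc x
  have hpW' : ∀ x : W', p x = 0 := fun x => Submodule.projectionOnto_apply_right hc x
  have hp'W : ∀ x : W, p' x = 0 := fun x => Submodule.projectionOnto_apply_right hc.symm x
  have hp'W' : ∀ x : W', p' x = x := fun x => Submodule.projectionOnto_apply_left hc.symm x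
  let C : Module.End ℝ V := W.subtype ∘ₗ B ∘ₗ p + W'.subtype ∘ₗ B' ∘ₗ p'
  have hC1 : ∀ x, p (C x) = B (p x) := fun x => by simp [C, hpW, hpW']
  have hC2 : ∀ x, p' (C x) = B' (p' x) := fun x => by simp [C, hp'W, hp'W']
  have hsplit : ∀ x y, σ x y = σ (p x) (p y) + σ (p' x) (p' y) := by
    intro x y
    have e1 : σ (p' x) (p y) = 0 := (p' x).2 _ (p y).2
    have e2 : σ (p x) (p' y) = 0 := by rw [hσ.neg]; simp [(p' y).2 _ (p x).2]
    conv_lhs => rw [← hsum x, ← hsum y]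
    simp [e1, e2]
  have hpow1 : ∀ n x, p ((C ^ n) x) = (B ^ n) (p x) := by
    intro n
    induction n with
    | zero => simp
    | succ n ih => intro x; simp only [pow_succ', Module.End.mul_apply, hC1, ih]
  have hpow2 : ∀ n x, p' ((C ^ n) x) = (B' ^ n) (p' x) := by
    intro n
    induction n with
    | zero => simp
    | succ n ih => intro x; simp only [pow_succ', Module.End.mul_apply, hC2, ih]
  refine ⟨C, rfl, ?_, ⟨N * N', Nat.mul_pos hN hN', ?_⟩, ?_⟩
  · intro x y
    rw [hsplit, hC1, hC1, hC2, hC2, hsplit x y]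
    exact congrArg₂ (· + ·) (hB _ _) (hB' _ _)
  · ext x
    rw [← hsum ((C ^ (N * N')) x), hpow1, hpow2, pow_mul, hBN, mul_comm, pow_mul, hBN']
    simp [hsum]
  · intro c hc x hx
    have e1 := hBZ c hc (p x) (by rw [← palin_intertwine p hC1, hx, map_zero])
    have e2 := hBZ' c hc (p' x) (by rw [← palin_intertwine p' hC2, hx, map_zero])
    rw [← hsum x, e1, e2]; simp

end LinearApproximation

/-! ### Invariant planes -/

section LinearApproximation
open LinearMap (BilinForm)

variable {V : Type*} [NormedAddCommGroup V] [NormedSpace ℝ V]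

theorem exists_apply_eq_of_invariant [FiniteDimensional ℝ V] {σ : BilinForm ℝ V}
    (hσ : IsLinearSymplectic σ) {A : Module.End ℝ V} (hA : ∀ x y, σ (A x) (A y) = σ x y)
    {W : Submodule ℝ V} (h : ∀ x ∈ W, A x ∈ W) {w : V} (hw : w ∈ W) : ∃ w' ∈ W, A w' = w := by
  have hinj : Function.Injective (A.restrict h) := fun a b hab =>
    Subtype.ext (symplectic_injective hσ hA (congrArg Subtype.val hab))
  obtain ⟨w', hw'⟩ := LinearMap.surjective_of_injective hinj ⟨w, hw⟩
  exact ⟨w', w'.2, congrArg Subtype.val hw'⟩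

theorem symplOrtho_invariant [FiniteDimensional ℝ V] {σ : BilinForm ℝ V}
    (hσ : IsLinearSymplectic σ) {A : Module.End ℝ V} (hA : ∀ x y, σ (A x) (A y) = σ x y)
    {W : Submodule ℝ V} (h : ∀ x ∈ W, A x ∈ W) : ∀ x ∈ symplOrtho σ W, A x ∈ symplOrtho σ W := by
  intro x hx w hw
  obtain ⟨w', hw', rfl⟩ := exists_apply_eq_of_invariant hσ hA h hw
  rw [hA, hx w' hw']

/-- The polynomial `A² - 2cA + 1` is palindromic, hence self-adjoint up to the factor `A²`. -/
theorem symplectic_palin {σ : BilinForm ℝ V} {A : Module.End ℝ V}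
    (hA : ∀ x y, σ (A x) (A y) = σ x y) (c : ℝ) (x y : V) :
    σ (palin A c x) (A (A y)) = σ x (palin A c y) := by
  simp only [palin_apply, map_add, map_sub, map_smul, LinearMap.add_apply, LinearMap.sub_apply,
    LinearMap.smul_apply, hA]
  ring

/-- The case of a symplectic plane spanned by `v` and `A v`. -/
theorem mem_closure_of_plane {σ : BilinForm ℝ V}
    (hσ : IsLinearSymplectic σ) {A : Module.End ℝ V} {Z : Set ℝ} (hZ : Z.Finite)
    {c : ℝ} (hc : |c| ≤ 1) {v : V} (hv : palin A c v = 0) (hne : σ v (A v) ≠ 0)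
    (hspan : Submodule.span ℝ {v, A v} = ⊤) : ⇑A ∈ closure (finiteOrderAvoiding σ Z) := by
  set u := A v with hu
  set e := σ v u with he
  have huv : σ u v = - e := hσ.neg _ _
  have hAu : A u = (2 * c) • u - v := by
    rw [palin_apply] at hv
    rw [← sub_eq_zero, ← hv]; abel
  -- the coordinates with respect to the basis `(v, u)`, read off with the form
  have hdec : ∀ x, x = (σ x u / e) • v - (σ x v / e) • u := by
    intro x
    have hx : x ∈ Submodule.span ℝ {v, u} := by rw [hspan]; trivial
    obtain ⟨a, b, rfl⟩ := Submodule.mem_span_pair.mp hx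
    simp only [map_add, map_smul, LinearMap.add_apply, LinearMap.smul_apply, hσ.alt, huv, ← he,
      smul_eq_mul]
    match_scalars <;> field_simp <;> ring
  let B : ℝ → Module.End ℝ V := fun a =>
    (LinearMap.toSpanSingleton ℝ V u) ∘ₗ (e⁻¹ • σ.flip u) -
    (LinearMap.toSpanSingleton ℝ V ((2 * a) • u - v)) ∘ₗ (e⁻¹ • σ.flip v)
  have hB : ∀ a x, B a x = (σ x u / e) • u - (σ x v / e) • ((2 * a) • u - v) := by
    intro a x
    simp [B, div_eq_inv_mul]
  have hBv : ∀ a, B a v = u := fun a => by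
    rw [hB, hσ.alt, ← he, div_self hne]; simp
  have hBu : ∀ a, B a u = (2 * a) • u - v := fun a => by
    rw [hB, hσ.alt, huv, neg_div, div_self hne]; simp
  have hcont : Continuous fun a : ℝ => (⇑(B a) : V → V) := by
    refine continuous_pi fun x => ?_
    simp only [hB]
    fun_prop
  have hBc : ⇑(B c) = ⇑A := by
    funext x
    conv_rhs => rw [hdec x]
    rw [map_sub, map_smul, map_smul, hAu, ← hu, hB]
  rw [← hBc]
  refine map_mem_closure (f := fun a => (⇑(B a) : V → V)) hcont (mem_closure_rationalCos hc hZ) fun a ha => ?_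
  refine mem_finiteOrderAvoiding_of_palin hσ ?_ ha ?_
  · intro x y
    conv_rhs => rw [hdec x, hdec y]
    rw [hB, hB]
    simp only [map_sub, map_smul, LinearMap.sub_apply, LinearMap.smul_apply, smul_eq_mul, hσ.alt,
      huv, ← he]
    ring
  · intro x
    rw [hdec x, map_sub, map_smul, map_smul, palin_apply, palin_apply, hBv, hBu, map_sub, map_smul,
      hBu, hBv]
    module

/-- The case of plus or minus the identity on a plane. -/
theorem mem_closure_of_scalar {σ : BilinForm ℝ V}
    (hσ : IsLinearSymplectic σ) {A : Module.End ℝ V} {Z : Set ℝ} (hZ : Z.Finite)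
    {c : ℝ} (hc : c ^ 2 = 1) (hAc : ∀ x, A x = c • x) {v w : V} (hne : σ v w ≠ 0)
    (hspan : Submodule.span ℝ {v, w} = ⊤) : ⇑A ∈ closure (finiteOrderAvoiding σ Z) := by
  set e := σ v w with he
  have hwv : σ w v = - e := hσ.neg _ _
  let J : Module.End ℝ V :=
    (LinearMap.toSpanSingleton ℝ V w) ∘ₗ (e⁻¹ • σ.flip w) +
    (LinearMap.toSpanSingleton ℝ V v) ∘ₗ (e⁻¹ • σ.flip v)
  have hJ : ∀ x, J x = (σ x w / e) • w + (σ x v / e) • v := by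
    intro x
    simp [J, div_eq_inv_mul]
  have hdec : ∀ x, x = (σ x w / e) • v - (σ x v / e) • w := by
    intro x
    have hx : x ∈ Submodule.span ℝ {v, w} := by rw [hspan]; trivial
    obtain ⟨a, b, rfl⟩ := Submodule.mem_span_pair.mp hx
    simp only [map_add, map_smul, LinearMap.add_apply, LinearMap.smul_apply, hσ.alt, hwv, ← he,
      smul_eq_mul]
    match_scalars <;> field_simp <;> ring
  have hJJ : ∀ x, J (J x) = - x := by
    intro x
    conv_rhs => rw [hdec x]
    rw [hJ x, map_add, map_smul, map_smul, hJ, hJ, hσ.alt, hσ.alt, hwv, ← he, neg_div,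
      div_self hne]
    module
  have hJs : ∀ x y, σ (J x) y = - σ x (J y) := by
    intro x y
    rw [hJ, hJ]
    simp only [map_add, map_smul, LinearMap.add_apply, LinearMap.smul_apply, smul_eq_mul]
    rw [hσ.neg y w, hσ.neg y v]
    ring
  let B : ℝ → Module.End ℝ V := fun a => a • 1 + √(1 - a ^ 2) • J
  have hB : ∀ a x, B a x = a • x + √(1 - a ^ 2) • J x := fun a x => by simp [B]
  have hcont : Continuous fun a : ℝ => (⇑(B a) : V → V) := by
    refine continuous_pi fun x => ?_
    simp only [hB]
    fun_prop
  have hBc : ⇑(B c) = ⇑A := by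
    funext x
    rw [hB, hAc, hc]; simp
  have hc1 : |c| ≤ 1 := by rw [← sq_le_one_iff_abs_le_one]; exact hc.le
  rw [← hBc]
  refine map_mem_closure (f := fun a => (⇑(B a) : V → V)) hcont (mem_closure_rationalCos hc1 hZ) fun a ha => ?_
  have hs : √(1 - a ^ 2) * √(1 - a ^ 2) = 1 - a ^ 2 := by
    apply Real.mul_self_sqrt
    obtain ⟨⟨t, rfl, -⟩, -⟩ := ha
    nlinarith [Real.cos_sq_le_one t]
  refine mem_finiteOrderAvoiding_of_palin hσ ?_ ha ?_
  · intro x y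
    rw [hB, hB]
    simp only [map_add, map_smul, LinearMap.add_apply, LinearMap.smul_apply, smul_eq_mul]
    rw [hJs x y, hJs x (J y), hJJ, map_neg]
    linear_combination (σ x y) * hs
  · intro x
    rw [palin_apply, hB, hB, map_add, map_smul, map_smul, hJJ, smul_add, smul_smul, smul_smul,
      smul_add, smul_smul, smul_smul, smul_neg, hs]
    module

end LinearApproximation

/-! ### Nilpotent perturbations -/

section LinearApproximation
open LinearMap (BilinForm)

variable {V : Type*} [NormedAddCommGroup V] [NormedSpace ℝ V]

theorem mem_closure_rationalCos_pair {c : ℝ} (hc : |c| ≤ 1) {Z : Set ℝ} (hZ : Z.Finite) :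
    (c, c) ∈ closure {p : ℝ × ℝ | p.1 ∈ rationalCos \ Z ∧ p.2 ∈ rationalCos \ Z ∧ p.1 ≠ p.2} := by
  rw [mem_closure_iff_nhds]
  intro t ht
  rw [nhds_prod_eq, Filter.mem_prod_iff] at ht
  obtain ⟨s, hs, s', hs', hsub⟩ := ht
  obtain ⟨a, ha, haR⟩ := mem_closure_iff_nhds.mp (mem_closure_rationalCos hc hZ) s hs
  obtain ⟨b, hb, hbR⟩ := mem_closure_iff_nhds.mp
    (mem_closure_rationalCos hc (hZ.insert a)) s' hs'
  exact ⟨(a, b), hsub ⟨ha, hb⟩, haR, ⟨hbR.1, fun h => hbR.2 (Set.mem_insert_of_mem _ h)⟩,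
    fun h => hbR.2 (by simp [show b = a from h.symm])⟩

/-- The elliptic perturbation of a nilpotent map. The complex structure `J` and the map `N`
commute; `f` is an opposite nilpotent for `N`, so that `(N + μ f)² = μ` has two real eigenvalues
for `μ > 0`, on the eigenspaces of which the perturbed map is a rotation. -/
theorem mem_closure_of_opposite_nilpotent {σ : BilinForm ℝ V} (hσ : IsLinearSymplectic σ)
    {A N J f : Module.End ℝ V} {Z : Set ℝ} (hZ : Z.Finite) {c : ℝ} (hc : |c| < 1)
    (hN : ∀ x, N (N x) = 0) (hJ : ∀ x, J (J x) = -x) (hf : ∀ x, f (f x) = 0)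
    (hNf : ∀ x, N (f x) + f (N x) = x) (hJN : ∀ x, J (N x) = N (J x))
    (hJf : ∀ x, J (f x) = f (J x)) (hNs : ∀ x y, σ (N x) y = σ x (N y))
    (hfs : ∀ x y, σ (f x) y = σ x (f y)) (hJs : ∀ x y, σ (J x) y = - σ x (J y))
    (hA : ∀ x, A x = c • x + (1 / 2 : ℝ) • N x +
      J (√(1 - c ^ 2) • x - (c / (2 * √(1 - c ^ 2))) • N x)) :
    ⇑A ∈ closure (finiteOrderAvoiding σ Z) := by
  let M : ℝ × ℝ → Module.End ℝ V := fun p => N + ((p.1 - p.2) ^ 2) • f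
  have hM : ∀ p x, M p x = N x + ((p.1 - p.2) ^ 2) • f x := fun p x => by simp [M]
  let s : ℝ → ℝ := fun a => √(1 - a ^ 2)
  let B : ℝ × ℝ → Module.End ℝ V := fun p => ((p.1 + p.2) / 2) • 1 + (1 / 2 : ℝ) • M p +
    J ∘ₗ (((s p.1 + s p.2) / 2) • 1 - ((p.1 + p.2) / (2 * (s p.1 + s p.2))) • M p)
  have hB : ∀ p x, B p x = ((p.1 + p.2) / 2) • x + (1 / 2 : ℝ) • M p x +
      J (((s p.1 + s p.2) / 2) • x - ((p.1 + p.2) / (2 * (s p.1 + s p.2))) • M p x) :=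
    fun p x => by simp [B]
  have hscc : 0 < s c := by
    apply Real.sqrt_pos.mpr
    have := abs_lt.mp hc
    nlinarith
  have hcont : ContinuousAt (fun p : ℝ × ℝ => (⇑(B p) : V → V)) (c, c) := by
    refine continuousAt_pi.mpr fun x => ?_
    simp only [hB, hM, map_sub, map_smul, map_add]
    have h1 : ContinuousAt (fun p : ℝ × ℝ => (p.1 + p.2) / (2 * (s p.1 + s p.2))) (c, c) := by
      apply ContinuousAt.div
      · fun_prop
      · simp only [s]; fun_prop
      · simp only; positivity
    have h2 : ContinuousAt (fun p : ℝ × ℝ => (s p.1 + s p.2) / 2) (c, c) := by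
      simp only [s]; fun_prop
    fun_prop
  have hBc : ⇑(B (c, c)) = ⇑A := by
    funext x
    rw [hB, hA, hM]
    simp only [sub_self, ne_eq, OfNat.ofNat_ne_zero, not_false_eq_true, zero_pow, zero_smul,
      add_zero]
    have e1 : (c + c) / 2 = c := by ring
    have e2 : (s c + s c) / 2 = √(1 - c ^ 2) := by simp only [s]; ring
    have e3 : (c + c) / (2 * (s c + s c)) = c / (2 * √(1 - c ^ 2)) := by
      have h4 : (0 : ℝ) < √(1 - c ^ 2) := hscc
      simp only [s]
      field_simp
    rw [e1, e2, e3]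
  rw [← hBc]
  refine closure_mono ?_ (hcont.continuousWithinAt.mem_closure_image
    (mem_closure_rationalCos_pair hc.le hZ))
  rintro _ ⟨⟨a, b⟩, ⟨ha, hb, hab⟩, rfl⟩
  simp only at ha hb hab
  obtain ⟨⟨t, hat, hst, n, k, hn, hnt⟩, haZ⟩ := ha
  obtain ⟨⟨t', hbt, hst', n', k', hn', hnt'⟩, hbZ⟩ := hb
  have hspos : ∀ {t : ℝ} {a : ℝ}, a = Real.cos t → Real.sin t ≠ 0 →
      0 < s a ∧ s a * s a = 1 - a ^ 2 := by
    rintro t _ rfl h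
    have h1 : 0 < 1 - Real.cos t ^ 2 := by
      rw [← Real.sin_sq]; positivity
    exact ⟨Real.sqrt_pos.mpr h1, Real.mul_self_sqrt h1.le⟩
  obtain ⟨hsa, hsa2⟩ := hspos hat hst
  obtain ⟨hsb, hsb2⟩ := hspos hbt hst'
  set ν := a - b with hν
  have hν0 : ν ≠ 0 := sub_ne_zero.mpr hab
  have hMM : ∀ x, M (a, b) (M (a, b) x) = (ν ^ 2) • x := by
    intro x
    rw [hM, hM, map_add, map_add, map_smul, map_smul, hN, hf]
    conv_rhs => rw [← hNf x]
    simp [hν]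
  have hMJ : ∀ x, M (a, b) (J x) = J (M (a, b) x) := by
    intro x; rw [hM, hM, map_add, map_smul, hJN, hJf]
  have hMs : ∀ x y, σ (M (a, b) x) y = σ x (M (a, b) y) := by
    intro x y
    rw [hM, hM]
    simp [hNs, hfs]
  -- the difference quotient of `√(1 - a²)`
  have hq : (a + b) / (2 * (s a + s b)) * ν = - (s a - s b) / 2 := by
    field_simp
    rw [hν]; linear_combination hsa2 - hsb2
  set κ := (a + b) / (2 * (s a + s b)) with hκ
  have hBx : ∀ x, B (a, b) x = ((a + b) / 2) • x + (1 / 2 : ℝ) • M (a, b) x +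
      ((s a + s b) / 2) • J x - κ • J (M (a, b) x) := by
    intro x
    rw [hB, map_sub, map_smul, map_smul]; module
  -- the action on the two eigenspaces of `M`
  have heig : ∀ x, M (a, b) x = ν • x → B (a, b) x = a • x + s a • J x := by
    intro x hx
    rw [hBx, hx, map_smul, smul_smul, smul_smul, hq, hν]
    module
  have heig' : ∀ x, M (a, b) x = (-ν) • x → B (a, b) x = b • x + s b • J x := by
    intro x hx
    rw [hBx, hx, map_smul, smul_smul, smul_smul, show κ * -ν = - (κ * ν) by ring, hq, hν]
    module
  have hpal : ∀ x, M (a, b) x = ν • x → palin (B (a, b)) a x = 0 := by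
    intro x hx
    have h1 : M (a, b) (J x) = ν • J x := by rw [hMJ, hx, map_smul]
    rw [palin_apply, heig x hx, map_add, map_smul, map_smul, heig x hx, heig _ h1, hJ]
    match_scalars
    · linear_combination - hsa2
    · ring
  have hpal' : ∀ x, M (a, b) x = (-ν) • x → palin (B (a, b)) b x = 0 := by
    intro x hx
    have h1 : M (a, b) (J x) = (-ν) • J x := by rw [hMJ, hx, map_smul]
    rw [palin_apply, heig' x hx, map_add, map_smul, map_smul, heig' x hx, heig' _ h1, hJ]
    match_scalars
    · linear_combination - hsb2
    · ring
  let P : Module.End ℝ V := (1 / 2 : ℝ) • 1 + (1 / (2 * ν)) • M (a, b)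
  let P' : Module.End ℝ V := (1 / 2 : ℝ) • 1 - (1 / (2 * ν)) • M (a, b)
  have hP : ∀ x, P x = (1 / 2 : ℝ) • x + (1 / (2 * ν)) • M (a, b) x := fun x => by simp [P]
  have hP' : ∀ x, P' x = (1 / 2 : ℝ) • x - (1 / (2 * ν)) • M (a, b) x := fun x => by simp [P']
  have hPP' : ∀ x, P x + P' x = x := fun x => by rw [hP, hP']; module
  have hMP : ∀ x, M (a, b) (P x) = ν • P x := by
    intro x
    rw [hP, map_add, map_smul, map_smul, hMM]
    match_scalars <;> field_simp
  have hMP' : ∀ x, M (a, b) (P' x) = (-ν) • P' x := by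
    intro x
    rw [hP', map_sub, map_smul, map_smul, hMM]
    match_scalars <;> field_simp
  have hBM : ∀ x, B (a, b) (M (a, b) x) = M (a, b) (B (a, b) x) := by
    intro x
    rw [hBx, hBx]
    simp only [map_add, map_sub, map_smul, hMJ]
  have hsym : ∀ x y, σ (B (a, b) x) (B (a, b) y) = σ x y := by
    have hdiag : ∀ {ε a' : ℝ} {x y : V}, M (a, b) x = ε • x → M (a, b) y = ε • y →
        B (a, b) x = a' • x + s a' • J x → B (a, b) y = a' • y + s a' • J y →
        s a' * s a' = 1 - a' ^ 2 → σ (B (a, b) x) (B (a, b) y) = σ x y := by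
      intro ε a' x y hx hy hx' hy' hs
      rw [hx', hy']
      simp only [map_add, map_smul, LinearMap.add_apply, LinearMap.smul_apply, smul_eq_mul]
      rw [hJs x y, hJs x (J y), hJ, map_neg]
      linear_combination (σ x y) * hs
    have hoff : ∀ {x y : V}, M (a, b) x = ν • x → M (a, b) y = (-ν) • y → σ x y = 0 := by
      intro x y hx hy
      have := hMs x y
      rw [hx, hy] at this
      simp only [map_smul, LinearMap.smul_apply, smul_eq_mul] at this
      have h2 : ν * σ x y = 0 := by linarith
      exact (mul_eq_zero.mp h2).resolve_left hν0
    have hoff' : ∀ {x y : V}, M (a, b) x = ν • x → M (a, b) y = (-ν) • y →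
        σ (B (a, b) x) (B (a, b) y) = σ x y := by
      intro x y hx hy
      rw [hoff hx hy]
      refine hoff ?_ ?_
      · rw [← hBM, hx, map_smul]
      · rw [← hBM, hy, map_smul]
    intro x y
    conv_lhs => rw [← hPP' x, ← hPP' y]
    conv_rhs => rw [← hPP' x, ← hPP' y]
    simp only [map_add, LinearMap.add_apply]
    rw [hdiag (hMP x) (hMP y) (heig _ (hMP x)) (heig _ (hMP y)) hsa2,
      hdiag (hMP' x) (hMP' y) (heig' _ (hMP' x)) (heig' _ (hMP' y)) hsb2,
      hoff' (hMP x) (hMP' y), hσ.neg (B (a, b) (P y)) (B (a, b) (P' x)), hoff' (hMP y) (hMP' x),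
      hσ.neg (P y) (P' x)]
  refine ⟨B (a, b), rfl, hsym, ⟨n * n', Nat.mul_pos hn hn', ?_⟩, ?_⟩
  · ext x
    have e1 : (B (a, b) ^ (n * n')) (P x) = P x := by
      refine pow_apply_eq_self (t := t) (k := k * n') (hat ▸ hpal _ (hMP x)) hst ?_
      push_cast; linear_combination (n' : ℝ) * hnt
    have e2 : (B (a, b) ^ (n * n')) (P' x) = P' x := by
      refine pow_apply_eq_self (t := t') (k := k' * n) (hbt ▸ hpal' _ (hMP' x)) hst' ?_
      push_cast; linear_combination (n : ℝ) * hnt'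
    conv_lhs => rw [← hPP' x]
    rw [map_add, e1, e2, hPP', Module.End.one_apply]
  · intro c' hc' x hx
    have hinj := symplectic_injective hσ hsym
    have hBP : ∀ x, B (a, b) (P x) = P (B (a, b) x) := fun x => by
      rw [hP, hP, map_add, map_smul, map_smul, hBM]
    have hBP' : ∀ x, B (a, b) (P' x) = P' (B (a, b) x) := fun x => by
      rw [hP', hP', map_sub, map_smul, map_smul, hBM]
    have haux : ∀ {d : ℝ} {y : V}, d ≠ c' → palin (B (a, b)) d y = 0 →
        palin (B (a, b)) c' y = 0 → y = 0 := by
      intro d y hd h1 h2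
      rw [palin_apply] at h1 h2
      have h3 : (2 * (c' - d)) • B (a, b) y = 0 := by
        rw [← sub_eq_zero.mpr (h1.trans h2.symm)]; module
      have h4 := (smul_eq_zero.mp h3).resolve_left
        (mul_ne_zero two_ne_zero (sub_ne_zero.mpr hd.symm))
      exact hinj (h4.trans (map_zero _).symm)
    have e1 := haux (d := a) (fun e => haZ (e ▸ hc')) (hpal _ (hMP x))
      (by rw [← palin_intertwine P (fun x => (hBP x).symm), hx, map_zero])
    have e2 := haux (d := b) (fun e => hbZ (e ▸ hc')) (hpal' _ (hMP' x))
      (by rw [← palin_intertwine P' (fun x => (hBP' x).symm), hx, map_zero])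
    rw [← hPP' x, e1, e2, add_zero]

end LinearApproximation

/-! ### The elliptic non-semisimple case -/

section LinearApproximation
open LinearMap (BilinForm)

variable {V : Type*} [NormedAddCommGroup V] [NormedSpace ℝ V]

/-- The case of a non-semisimple map with a single pair of complex conjugate eigenvalues and
nilpotency index two. -/
theorem mem_closure_of_palin_sq [FiniteDimensional ℝ V] [Nontrivial V] {σ : BilinForm ℝ V}
    (hσ : IsLinearSymplectic σ) {A : Module.End ℝ V} (hA : ∀ x y, σ (A x) (A y) = σ x y)
    {Z : Set ℝ} (hZ : Z.Finite) {c : ℝ} (hc : |c| < 1)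
    (hQ : ∀ x, palin A c (palin A c x) = 0) (hdeg : ∀ v, palin A c v = 0 → σ v (A v) = 0)
    (hirr : ∀ W : Submodule ℝ V, (∀ x ∈ W, A x ∈ W) →
      (∀ x ∈ W, (∀ y ∈ W, σ x y = 0) → x = 0) → W ≠ ⊥ → W = ⊤) :
    ⇑A ∈ closure (finiteOrderAvoiding σ Z) := by
  have hinj := symplectic_injective hσ hA
  let Ai : Module.End ℝ V := (LinearEquiv.ofInjectiveEndo A hinj).symm.toLinearMap
  have hAAi : ∀ x, A (Ai x) = x := fun x =>
    (LinearEquiv.ofInjectiveEndo A hinj).apply_symm_apply x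
  have hAiA : ∀ x, Ai (A x) = x := fun x => hinj (hAAi _)
  have hAis : ∀ x y, σ (Ai x) y = σ x (A y) := fun x y => by rw [← hA, hAAi]
  have hAs : ∀ x y, σ (A x) y = σ x (Ai y) := fun x y => by
    conv_lhs => rw [← hAAi y]
    rw [hA]
  have hc2 : 0 < 1 - c ^ 2 := by have := abs_lt.mp hc; nlinarith
  set s := √(1 - c ^ 2) with hs
  have hs0 : 0 < s := Real.sqrt_pos.mpr hc2
  have hss : s ^ 2 = 1 - c ^ 2 := Real.sq_sqrt hc2.le
  let N : Module.End ℝ V := A + Ai - (2 * c) • 1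
  have hNx : ∀ x, N x = A x + Ai x - (2 * c) • x := fun x => by simp [N]
  let D : Module.End ℝ V := A - Ai
  have hDx : ∀ x, D x = A x - Ai x := fun x => by simp [D]
  have hAN : ∀ x, A (N x) = palin A c x := fun x => by
    rw [hNx, map_sub, map_add, map_smul, hAAi, palin_apply]; abel
  have hNA : ∀ x, N (A x) = A (N x) := fun x => by
    rw [hNx, hNx, map_sub, map_add, map_smul, hAAi, hAiA]
  have hNAi : ∀ x, N (Ai x) = Ai (N x) := fun x => by
    apply hinj; rw [← hNA, hAAi, hAAi]
  have hN : ∀ x, N (N x) = 0 := fun x => by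
    apply hinj; apply hinj
    rw [← hNA, hAN, hAN, hQ]; simp
  have hND : ∀ x, N (D x) = D (N x) := fun x => by rw [hDx, hDx, map_sub, hNA, hNAi]
  have hNs : ∀ x y, σ (N x) y = σ x (N y) := fun x y => by
    simp only [hNx, map_add, map_sub, map_smul, LinearMap.add_apply, LinearMap.sub_apply,
      LinearMap.smul_apply, hAs, hAis]; ring
  have hDs : ∀ x y, σ (D x) y = - σ x (D y) := fun x y => by
    simp only [hDx, map_sub, LinearMap.sub_apply, hAs, hAis]; ring
  have hDD : ∀ x, D (D x) = (4 * c) • N x - (4 * s ^ 2) • x := fun x => by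
    have h1 := hN x
    rw [hNx (N x), hNx x, map_sub, map_sub, map_add, map_add, map_smul, map_smul, hAAi,
      hAiA] at h1
    rw [hDx, hDx, map_sub, map_sub, hAAi, hAiA, hNx, hss, ← sub_eq_zero, ← h1]
    module
  let J : Module.End ℝ V := (1 / (2 * s)) • D ∘ₗ (1 + (c / (2 * s ^ 2)) • N)
  have hJx : ∀ x, J x = (1 / (2 * s)) • (D x + (c / (2 * s ^ 2)) • D (N x)) := fun x => by simp [J]
  have hJN : ∀ x, J (N x) = N (J x) := fun x => by
    rw [hJx, hJx, map_smul, map_add, map_smul, hND, hND]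
  have hJJ : ∀ x, J (J x) = - x := fun x => by
    rw [hJx (J x), ← hJN, hJx (N x), hN, map_zero, smul_zero, add_zero, map_smul, hDD, hN, hJx,
      map_smul, map_add, map_smul, hDD, hDD, hN]
    match_scalars <;> field_simp <;> ring
  have hJs : ∀ x y, σ (J x) y = - σ x (J y) := fun x y => by
    simp only [hJx, map_add, map_smul, LinearMap.add_apply, LinearMap.smul_apply, hDs, hNs, hND,
      smul_eq_mul]
    ring
  have hAx : ∀ x, A x = c • x + (1 / 2 : ℝ) • N x + J (s • x - (c / (2 * s)) • N x) := by
    intro x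
    rw [map_sub, map_smul, map_smul, hJx, hJx, hN, map_zero, hNx, hDx, hDx]
    match_scalars <;> field_simp <;> ring
  -- the symmetric form `σ (N x) (J y)` is not zero, hence not zero on the diagonal
  obtain ⟨w, hw⟩ : ∃ w, σ (N w) (J w) ≠ 0 := by
    by_contra! hcon
    have hsym : ∀ x y, σ (N x) (J y) = σ (N y) (J x) := fun x y => by
      rw [hσ.neg (J x) (N y), hJs, hJN, neg_neg, hNs]
    have hzero : ∀ x y, σ (N x) (J y) = 0 := fun x y => by
      have h1 := hcon (x + y)
      simp only [map_add, LinearMap.add_apply, hcon] at h1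
      have := hsym x y
      linarith
    have hN0 : ∀ x, N x = 0 := fun x => hσ.nondeg _ fun y => by
      have := hzero x (-(J y))
      rwa [map_neg, hJJ, neg_neg] at this
    have hq : ∀ x, palin A c x = 0 := fun x => by rw [← hAN, hN0, map_zero]
    have h1 : ∀ x y, σ x (A y) = σ (A x) y := fun x y => by
      have h2 := hdeg (x + y) (hq _)
      simp only [map_add, LinearMap.add_apply, hdeg _ (hq _)] at h2
      rw [hσ.neg y (A x)]; linarith
    have h2 : ∀ x, A (A x) = x := fun x => by
      rw [← sub_eq_zero]
      refine hσ.nondeg _ fun y => ?_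
      obtain ⟨z, rfl⟩ : ∃ z, A z = y := ⟨Ai y, hAAi y⟩
      rw [map_sub, LinearMap.sub_apply, hA, h1, sub_self]
    obtain ⟨x, hx⟩ := exists_ne (0 : V)
    have h3 : ∀ x, x = c • A x := fun x => by
      have := hq x
      rw [palin_apply, h2] at this
      have h4 : (2 : ℝ) • (x - c • A x) = 0 := by rw [← this]; module
      exact sub_eq_zero.mp ((smul_eq_zero.mp h4).resolve_left two_ne_zero)
    have h4 : (1 - c ^ 2) • x = 0 := by
      have h5 := h3 x
      rw [h3 (A x), h2] at h5
      rw [sub_smul, one_smul, sub_eq_zero]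
      nth_rw 1 [h5]; module
    exact hx ((smul_eq_zero.mp h4).resolve_left hc2.ne')
  obtain ⟨w, hw, hwJ⟩ : ∃ w, σ (N w) (J w) ≠ 0 ∧ σ w (J w) = 0 := by
    set e := σ (N w) (J w) with he
    set a := - σ w (J w) / (2 * e) with ha
    refine ⟨w + a • N w, ?_, ?_⟩
    · simp only [map_add, map_smul, hN, smul_zero, add_zero, hJN, hNs w (N _), ← he]
      rw [smul_eq_mul, map_zero, mul_zero, add_zero]; exact hw
    · simp only [map_add, map_smul, LinearMap.add_apply, LinearMap.smul_apply, smul_eq_mul, hJN]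
      rw [hNs w (N _), hN, ← hNs, ← he]
      simp only [map_zero]
      rw [ha]; field_simp; ring
  set e := σ (N w) (J w) with he
  have k1 : σ w w = 0 := hσ.alt w
  have k2 : σ (J w) (J w) = 0 := hσ.alt _
  have k3 : σ (J w) w = 0 := by rw [hσ.neg, hwJ, neg_zero]
  have k4 : σ (N w) w = 0 := by
    have := hσ.neg w (N w)
    rw [hNs, this] at *
    have h2 := hNs w w
    linarith [hσ.neg w (N w)]
  have k5 : σ (J (N w)) w = - e := by rw [hJs]
  have k6 : σ (J (N w)) (J w) = 0 := by rw [hJs, hJJ, map_neg, k4]; simp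
  let f : Module.End ℝ V := (LinearMap.toSpanSingleton ℝ V w) ∘ₗ (e⁻¹ • σ.flip (J w)) -
    (LinearMap.toSpanSingleton ℝ V (J w)) ∘ₗ (e⁻¹ • σ.flip w)
  have hf : ∀ x, f x = (σ x (J w) / e) • w - (σ x w / e) • J w := fun x => by
    simp [f, div_eq_inv_mul]
  have f1 : f w = 0 := by rw [hf, hwJ, k1]; simp
  have f2 : f (J w) = 0 := by rw [hf, k2, k3]; simp
  have f3 : f (N w) = w := by rw [hf, k4, ← he, div_self hw]; simp
  have f4 : f (J (N w)) = J w := by rw [hf, k5, k6, neg_div, div_self hw]; simp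
  -- the span of `w, J w, N w, J N w` is symplectic and invariant
  let W : Submodule ℝ V := Submodule.span ℝ {w, J w, N w, J (N w)}
  have hspan : W = ⊤ := by
    have hmem : ∀ y ∈ ({w, J w, N w, J (N w)} : Set V), y ∈ W := fun y hy =>
      Submodule.subset_span hy
    have hNW : ∀ x ∈ W, N x ∈ W := by
      intro x hx
      refine Submodule.span_induction (p := fun x _ => N x ∈ W) ?_ (by simp)
        (fun a b _ _ ha hb => by rw [map_add]; exact W.add_mem ha hb)
        (fun r a _ ha => by rw [map_smul]; exact W.smul_mem r ha) hx
      rintro y (rfl | rfl | rfl | rfl)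
      · exact hmem _ (by simp)
      · rw [← hJN]; exact hmem _ (by simp)
      · rw [hN]; exact W.zero_mem
      · rw [← hJN, hN, map_zero]; exact W.zero_mem
    have hJW : ∀ x ∈ W, J x ∈ W := by
      intro x hx
      refine Submodule.span_induction (p := fun x _ => J x ∈ W) ?_ (by simp)
        (fun a b _ _ ha hb => by rw [map_add]; exact W.add_mem ha hb)
        (fun r a _ ha => by rw [map_smul]; exact W.smul_mem r ha) hx
      rintro y (rfl | rfl | rfl | rfl)
      · exact hmem _ (by simp)
      · rw [hJJ]; exact W.neg_mem (hmem _ (by simp))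
      · exact hmem _ (by simp)
      · rw [hJJ]; exact W.neg_mem (hmem _ (by simp))
    refine hirr W ?_ ?_ ?_
    · intro x hx
      rw [hAx]
      exact W.add_mem (W.add_mem (W.smul_mem _ hx) (W.smul_mem _ (hNW x hx)))
        (hJW _ (W.sub_mem (W.smul_mem _ hx) (W.smul_mem _ (hNW x hx))))
    · intro x hx h
      simp only [W, Submodule.mem_span_insert, Submodule.mem_span_singleton] at hx
      obtain ⟨a, _, ⟨b, _, ⟨c', _, ⟨d, rfl⟩, rfl⟩, rfl⟩, rfl⟩ := hx
      have e1 := h w (hmem _ (by simp))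
      have e2 := h (J w) (hmem _ (by simp))
      simp only [map_add, map_smul, LinearMap.add_apply, LinearMap.smul_apply, smul_eq_mul, k1, k2,
        k3, k4, k5, k6, hwJ, ← he, mul_zero, zero_add, add_zero, mul_neg, neg_eq_zero,
        mul_eq_zero, hw, or_false] at e1 e2
      subst e1 e2
      have e3 := h (N w) (hmem _ (by simp))
      have e4 := h (J (N w)) (hmem _ (by simp))
      have g1 : σ (J w) (N w) = - e := hσ.neg _ _
      have g2 : σ w (N w) = 0 := by rw [← hNs, k4]
      have g3 : σ w (J (N w)) = e := by rw [hσ.neg, k5, neg_neg]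
      have g4 : σ (J w) (J (N w)) = 0 := by rw [hσ.neg, k6, neg_zero]
      simp only [zero_smul, map_add, map_smul, LinearMap.add_apply, LinearMap.smul_apply,
        smul_eq_mul, g1, g2, g3, g4, mul_zero, zero_add, add_zero,
        mul_neg, neg_eq_zero, mul_eq_zero, hw, or_false] at e3 e4
      subst e3 e4
      simp
    · intro hbot
      have hw0 : w = 0 := by
        have := hmem w (by simp)
        rwa [hbot, Submodule.mem_bot] at this
      exact hw (by rw [he, hw0]; simp)
  refine mem_closure_of_opposite_nilpotent hσ hZ hc (f := f) hN hJJ ?_ ?_ hJN ?_ hNs ?_ hJs hAx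
  · intro x
    rw [hf x, map_sub, map_smul, map_smul, f1, f2]; simp
  · intro x
    have hx : x ∈ W := by rw [hspan]; trivial
    refine Submodule.span_induction (p := fun x _ => N (f x) + f (N x) = x) ?_ (by simp)
      (fun a b _ _ ha hb => by
        simp only [map_add]; conv_rhs => rw [← ha, ← hb]
        abel)
      (fun r a _ ha => by
        simp only [map_smul]; conv_rhs => rw [← ha]
        module) hx
    rintro y (rfl | rfl | rfl | rfl)
    · rw [f1, f3]; simp
    · rw [f2, ← hJN, f4]; simp
    · rw [f3, hN]; simp
    · rw [f4, ← hJN, ← hJN, hN]; simp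
  · intro x
    rw [hf, hf, map_sub, map_smul, map_smul, hJJ, hJs x, hJs x, hJJ, map_neg]
    module
  · intro x y
    rw [hf, hf]
    simp only [map_sub, map_smul, LinearMap.sub_apply, LinearMap.smul_apply, smul_eq_mul]
    rw [hσ.neg y w, hσ.neg y (J w)]
    ring

end LinearApproximation

/-! ### The isotropic case -/

section LinearApproximation
open LinearMap (BilinForm)

variable {V : Type*} [NormedAddCommGroup V] [NormedSpace ℝ V]

theorem symplOrtho_symplOrtho [FiniteDimensional ℝ V] {σ : BilinForm ℝ V}
    (hσ : IsLinearSymplectic σ) (W : Submodule ℝ V) : symplOrtho σ (symplOrtho σ W) = W := by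
  have hrefl : σ.IsRefl := fun x y h => by rw [hσ.neg, h, neg_zero]
  have heq : ∀ W : Submodule ℝ V, symplOrtho σ W = BilinForm.orthogonal σ W := by
    intro W
    ext x
    simp only [mem_symplOrtho, BilinForm.mem_orthogonal_iff]
    exact forall₂_congr fun w _ => ⟨fun h => by rw [hσ.neg, h, neg_zero],
      fun h => by rw [hσ.neg, h, neg_zero]⟩
  have hnd : BilinForm.Nondegenerate σ := by
    refine ⟨fun x h => hσ.nondeg x h, fun x h => hσ.nondeg x fun y => ?_⟩
    rw [hσ.neg, h, neg_zero]
  rw [heq, heq, BilinForm.orthogonal_orthogonal hnd hrefl]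

/-- The case of an isotropic invariant subspace `W` on which `A² - 2cA + 1` vanishes and which is
not its own symplectic orthogonal: the induced map on a complement `U` of `W` in the orthogonal is
perturbed first, so that the generalized eigenspace of `W` splits off. -/
theorem mem_closure_of_isotropic [FiniteDimensional ℝ V] {σ : BilinForm ℝ V}
    (hσ : IsLinearSymplectic σ) {A : Module.End ℝ V} (hA : ∀ x y, σ (A x) (A y) = σ x y)
    (hAu : IsUnitModulus A) {Z : Set ℝ} (hZ : Z.Finite) {c : ℝ} (hc : |c| ≤ 1)
    (IH : ∀ U : Submodule ℝ V, U ≠ ⊤ → (∀ x ∈ U, (∀ y ∈ U, σ x y = 0) → x = 0) →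
      ∀ B : Module.End ℝ U, (∀ x y : U, σ (B x) (B y) = σ x y) → IsUnitModulus B →
      ∀ Z : Set ℝ, Z.Finite → ⇑B ∈ closure (finiteOrderAvoiding (σ.domRestrict₁₂ U U) Z))
    {W : Submodule ℝ V} (hW0 : W ≠ ⊥) (hWA : ∀ x ∈ W, A x ∈ W)
    (hiso : ∀ x ∈ W, ∀ y ∈ W, σ x y = 0) (hWc : ∀ x ∈ W, palin A c x = 0)
    (hne : symplOrtho σ W ≠ W) : ⇑A ∈ closure (finiteOrderAvoiding σ Z) := by
  have hWle : W ≤ symplOrtho σ W := fun x hx y hy => hiso x hx y hy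
  obtain ⟨C, hC⟩ := exists_isCompl W
  set U : Submodule ℝ V := C ⊓ symplOrtho σ W with hUdef
  have hUle : U ≤ symplOrtho σ W := inf_le_right
  have hsup : W ⊔ U = symplOrtho σ W := by
    rw [hUdef, ← sup_inf_assoc_of_le C hWle, hC.sup_eq_top, top_inf_eq]
  have hinf : ∀ x ∈ W, x ∈ U → x = 0 := fun x hx hx' =>
    Submodule.disjoint_def.mp hC.disjoint x hx hx'.1
  have hUW : ∀ u ∈ U, ∀ w ∈ W, σ u w = 0 := fun u hu w hw => hUle hu w hw
  have hUnd : ∀ x ∈ U, (∀ y ∈ U, σ x y = 0) → x = 0 := by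
    intro x hx h
    refine hinf x ?_ hx
    rw [← symplOrtho_symplOrtho hσ W]
    intro y hy
    rw [← hsup] at hy
    obtain ⟨a, ha, b, hb, rfl⟩ := Submodule.mem_sup.mp hy
    rw [map_add, hUW x hx a ha, h b hb, add_zero]
  have hUtop : U ≠ ⊤ := by
    intro h
    apply hW0
    rw [eq_bot_iff]
    intro x hx
    exact hinf x hx (by rw [h]; trivial)
  have hU0 : ∃ u : U, u ≠ 0 := by
    by_contra! h
    apply hne
    rw [← hsup]
    have : U = ⊥ := by
      rw [eq_bot_iff]
      exact fun x hx => congrArg Subtype.val (h ⟨x, hx⟩)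
    rw [this, sup_bot_eq]
  have hcU := isCompl_symplOrtho hσ hUnd
  set p := U.projectionOnto (symplOrtho σ U) hcU with hp
  have hpU : ∀ u : U, p u = u := fun u => Submodule.projectionOnto_apply_left hcU u
  have hpW : ∀ w ∈ W, p w = 0 := fun w hw =>
    (Submodule.projectionOnto_apply_eq_zero_iff hcU).mpr fun u hu => by
      rw [hσ.neg, hUW u hu w hw, neg_zero]
  have hpsub : ∀ x, p (x - p x) = 0 := fun x => by rw [map_sub, hpU, sub_self]
  have hpsub' : ∀ x, ∀ u : U, σ (x - p x) u = 0 := fun x u =>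
    (Submodule.projectionOnto_apply_eq_zero_iff hcU).mp (hpsub x) u u.2
  have hres : ∀ y ∈ symplOrtho σ W, y - p y ∈ W := by
    intro y hy
    rw [← hsup] at hy
    obtain ⟨a, ha, b, hb, rfl⟩ := Submodule.mem_sup.mp hy
    rw [map_add, hpW a ha, hpU ⟨b, hb⟩]
    simpa using ha
  have hAO := symplOrtho_invariant hσ hA hWA
  have hsplit : ∀ x y, σ x y = σ (p x) (p y) + σ (x - p x) (y - p y) := by
    intro x y
    have e1 := hpsub' x (p y)
    have e2 := hpsub' y (p x)
    rw [hσ.neg] at e2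
    have e3 : σ x y = σ (p x + (x - p x)) (p y + (y - p y)) := by
      rw [add_sub_cancel, add_sub_cancel]
    rw [e3, map_add, map_add, LinearMap.add_apply, LinearMap.add_apply, e1]
    linarith
  -- the map induced on `U`
  let A' : Module.End ℝ U := p ∘ₗ A ∘ₗ U.subtype
  have hA'x : ∀ u : U, A' u = p (A u) := fun u => rfl
  have hpA : ∀ y ∈ symplOrtho σ W, p (A y) = A' (p y) := by
    intro y hy
    have h1 := hpW _ (hWA _ (hres y hy))
    rw [map_sub, map_sub, sub_eq_zero] at h1
    exact h1
  have hA'σ : ∀ u v : U, σ (A' u) (A' v) = σ u v := by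
    intro u v
    have h1 := hsplit (A u) (A v)
    rw [hA, hiso _ (hres _ (hAO _ (hUle u.2))) _ (hres _ (hAO _ (hUle v.2))), add_zero] at h1
    exact h1.symm
  have hA'u : IsUnitModulus A' := by
    have h1 : IsUnitModulus (A.restrict hAO) :=
      hAu.of_injective (symplOrtho σ W).subtype (fun x => rfl) Subtype.val_injective
    refine h1.of_surjective (p ∘ₗ (symplOrtho σ W).subtype) (fun x => hpA x x.2) fun u =>
      ⟨⟨u, hUle u.2⟩, hpU u⟩
  have hA'inj := symplectic_injective (hσ.domRestrict hUnd) hA'σ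
  let Ai : Module.End ℝ U := (LinearEquiv.ofInjectiveEndo A' hA'inj).symm.toLinearMap
  have hAAi : ∀ x, A' (Ai x) = x := fun x =>
    (LinearEquiv.ofInjectiveEndo A' hA'inj).apply_symm_apply x
  have hAiA : ∀ x, Ai (A' x) = x := fun x => hA'inj (hAAi _)
  let glue : (U → U) → (V → V) := fun g x => A (Ai (g (p x))) + A (x - p x)
  have hglue : Continuous glue := by
    refine continuous_pi fun x => ?_
    have h1 : Continuous Ai := LinearMap.continuous_of_finiteDimensional Ai
    have h2 : Continuous A := LinearMap.continuous_of_finiteDimensional A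
    simp only [glue]
    fun_prop
  have hglueA : glue A' = A := by
    funext x
    simp only [glue, hAiA]
    rw [← map_add, add_sub_cancel]
  rw [← hglueA, ← closure_closure]
  refine map_mem_closure hglue (IH U hUtop hUnd A' hA'σ hA'u (insert c Z) (hZ.insert c)) ?_
  rintro _ ⟨B, rfl, hB, ⟨n, hn, hBn⟩, hBZ⟩
  let A₁ : Module.End ℝ V := A ∘ₗ (U.subtype ∘ₗ Ai ∘ₗ B ∘ₗ p + (1 - U.subtype ∘ₗ p))
  have hA₁x : ∀ x, A₁ x = A (Ai (B (p x))) + A (x - p x) := fun x => by simp [A₁]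
  have hA₁ : ∀ x y, σ (A₁ x) (A₁ y) = σ x y := by
    have hAiσ : ∀ u v : U, σ (Ai u) (Ai v) = σ u v := fun u v => by
      rw [← hA'σ, hAAi, hAAi]
    intro x y
    rw [hA₁x, hA₁x, ← map_add, ← map_add, hA, map_add, map_add, LinearMap.add_apply,
      LinearMap.add_apply, hAiσ, hpsub', hσ.neg (y - p y), hpsub', hsplit x y]
    have := hB (p x) (p y)
    simp only [LinearMap.domRestrict₁₂_apply] at this
    rw [this]; ring
  have hA₁W : ∀ w ∈ W, A₁ w = A w := fun w hw => by rw [hA₁x, hpW w hw]; simp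
  have hA₁O : ∀ y ∈ symplOrtho σ W, A₁ y ∈ symplOrtho σ W := by
    refine symplOrtho_invariant hσ hA₁ fun w hw => ?_
    rw [hA₁W w hw]; exact hWA w hw
  have hpA₁ : ∀ y ∈ symplOrtho σ W, p (A₁ y) = B (p y) := by
    intro y hy
    rw [hA₁x, map_add, hpW _ (hWA _ (hres y hy)), add_zero, ← hA'x, hAAi]
  set Q := palin A₁ c with hQ
  have hQW : ∀ w ∈ W, Q w = 0 := fun w hw => by
    rw [hQ, palin_apply, hA₁W w hw, hA₁W _ (hWA w hw), ← palin_apply]; exact hWc w hw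
  have hQO : ∀ x, Q x ∈ symplOrtho σ W := by
    intro x w hw
    have hA₁W' : ∀ w ∈ W, A₁ w ∈ W := fun w hw => by rw [hA₁W w hw]; exact hWA w hw
    obtain ⟨w', hw', rfl⟩ := exists_apply_eq_of_invariant hσ hA₁ hA₁W' hw
    obtain ⟨w'', hw'', rfl⟩ := exists_apply_eq_of_invariant hσ hA₁ hA₁W' hw'
    rw [symplectic_palin hA₁, ← hQ, hQW w'' hw'', map_zero]
  have hpal : ∀ a, ∀ y ∈ symplOrtho σ W, p (palin A₁ a y) = palin B a (p y) := by
    intro a y hy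
    rw [palin_apply, palin_apply, map_add, map_sub, map_smul, hpA₁ _ (hA₁O y hy), hpA₁ y hy]
  have hpow : ∀ m, ∀ y ∈ symplOrtho σ W, (A₁ ^ m) y ∈ symplOrtho σ W ∧
      p ((A₁ ^ m) y) = (B ^ m) (p y) := by
    intro m y hy
    induction m with
    | zero => exact ⟨hy, rfl⟩
    | succ m ih =>
      rw [pow_succ', pow_succ', Module.End.mul_apply, Module.End.mul_apply]
      exact ⟨hA₁O _ ih.1, by rw [hpA₁ _ ih.1, ih.2]⟩
  have hmem : ∀ y ∈ symplOrtho σ W, p y = 0 → y ∈ W := fun y hy h => by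
    have := hres y hy
    rwa [h, Submodule.coe_zero, sub_zero] at this
  have hQA : ∀ x, Q (A₁ x) = A₁ (Q x) := fun x => by
    have := (palin_commute A₁ c).eq
    exact (congrArg (fun f : Module.End ℝ V => f x) this).symm
  have hcinj : ∀ u, palin B c u = 0 → u = 0 := fun u => hBZ c (by simp) u
  set K : Submodule ℝ V := LinearMap.ker (Q * Q) with hK
  have hKmem : ∀ x, x ∈ K ↔ Q (Q x) = 0 := fun x => by rw [hK, LinearMap.mem_ker]; rfl
  have hdisj : ∀ z, Q (Q (Q (Q z))) = 0 → Q (Q z) = 0 := by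
    intro z hz
    have h1 : p (Q (Q (Q (Q z)))) = 0 := by rw [hz, map_zero]
    rw [hQ, hpal _ _ (hQO _), hpal _ _ (hQO _), hpal _ _ (hQO _)] at h1
    exact hQW _ (hmem _ (hQO z) (hcinj _ (hcinj _ (hcinj _ h1))))
  have hKA : ∀ x ∈ K, A₁ x ∈ K := fun x hx => by
    rw [hKmem] at hx ⊢
    rw [hQA, hQA, hx, map_zero]
  have hKR : ∀ x, ∀ y ∈ K, σ (Q (Q x)) y = 0 := by
    intro x y hy
    obtain ⟨y1, h1, rfl⟩ := exists_apply_eq_of_invariant hσ hA₁ hKA hy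
    obtain ⟨y2, h2, rfl⟩ := exists_apply_eq_of_invariant hσ hA₁ hKA h1
    obtain ⟨y3, h3, rfl⟩ := exists_apply_eq_of_invariant hσ hA₁ hKA h2
    obtain ⟨y4, h4, rfl⟩ := exists_apply_eq_of_invariant hσ hA₁ hKA h3
    rw [symplectic_palin hA₁, ← hQ, hQA, hQA, symplectic_palin hA₁, ← hQ, (hKmem y4).mp h4,
      map_zero]
  have hKsum : ∀ x, ∃ k ∈ K, ∃ z, x = k + Q (Q z) := by
    have hcompl : Disjoint K (LinearMap.range (Q * Q)) := by
      rw [Submodule.disjoint_def]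
      rintro _ hx ⟨z, rfl⟩
      exact hdisj z ((hKmem _).mp hx)
    have htop : K ⊔ LinearMap.range (Q * Q) = ⊤ := by
      apply Submodule.eq_top_of_disjoint _ _ _ hcompl
      rw [add_comm, LinearMap.finrank_range_add_finrank_ker]
    intro x
    have hx : x ∈ K ⊔ LinearMap.range (Q * Q) := by rw [htop]; trivial
    obtain ⟨k, hk, _, ⟨z, rfl⟩, h⟩ := Submodule.mem_sup.mp hx
    exact ⟨k, hk, z, h.symm⟩
  have hKnd : ∀ x ∈ K, (∀ y ∈ K, σ x y = 0) → x = 0 := by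
    intro x hx h
    refine hσ.nondeg x fun y => ?_
    obtain ⟨k, hk, z, rfl⟩ := hKsum y
    rw [map_add, h k hk, hσ.neg, hKR z x hx]; simp
  have hKO : ∀ x ∈ symplOrtho σ K, ∃ z, x = Q (Q z) := by
    intro x hx
    obtain ⟨k, hk, z, rfl⟩ := hKsum x
    have hk0 : k = 0 := by
      refine hKnd k hk fun y hy => ?_
      have := hx y hy
      rwa [map_add, LinearMap.add_apply, hKR z y hy, add_zero] at this
    exact ⟨z, by rw [hk0, zero_add]⟩
  have hKtop : K ≠ ⊤ := by
    intro h
    obtain ⟨u, hu⟩ := hU0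
    have h1 : (u : V) ∈ K := by rw [h]; trivial
    rw [hKmem] at h1
    have h2 : p (Q (Q u)) = 0 := by rw [h1, map_zero]
    rw [hQ, hpal _ _ (hQO _), hpal _ _ (hUle u.2), hpU] at h2
    exact hu (hcinj _ (hcinj _ h2))
  have hglueB : glue B = A₁ := by
    funext x
    rw [hA₁x]
  rw [hglueB]
  refine mem_closure_of_splitting hσ hKnd hKA (symplOrtho_invariant hσ hA₁ hKA) ?_ ?_
  · refine IH K hKtop hKnd (A₁.restrict hKA) (fun x y => hA₁ x y) ⟨[c, c], by simpa using hc, ?_⟩ Z hZ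
    ext x
    have h1 := palin_prod_intertwine (A := A₁.restrict hKA) (A' := A₁) K.subtype (fun x => rfl) [c, c] x
    simp only [Submodule.subtype_apply] at h1
    rw [h1]
    simp
  · refine subset_closure ⟨_, rfl, fun x y => hA₁ x y, ⟨n, hn, ?_⟩, ?_⟩
    · ext x
      have h1 : ∀ (m : ℕ) (x : symplOrtho σ K),
          (((A₁.restrict (symplOrtho_invariant hσ hA₁ hKA)) ^ m) x : V) = (A₁ ^ m) x := by
        intro m x
        induction m with
        | zero => rfl
        | succ m ih =>
          rw [pow_succ', pow_succ', Module.End.mul_apply, Module.End.mul_apply, ← ih]; rfl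
      rw [h1]
      obtain ⟨z, hz⟩ := hKO x x.2
      rw [hz, Module.End.one_apply]
      have h2 : (A₁ ^ n) (Q z) - Q z ∈ W := by
        refine hmem _ (Submodule.sub_mem _ (hpow n _ (hQO z)).1 (hQO z)) ?_
        rw [map_sub, (hpow n _ (hQO z)).2, hBn, Module.End.one_apply, sub_self]
      have h3 := hQW _ h2
      have h4 : ∀ m y, Q ((A₁ ^ m) y) = (A₁ ^ m) (Q y) := by
        intro m y
        have := ((palin_commute A₁ c).pow_left m).eq
        exact (congrArg (fun f : Module.End ℝ V => f y) this).symm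
      rw [map_sub, h4, sub_eq_zero] at h3
      rw [h3, hz]
    · intro a ha x hx
      obtain ⟨z, hz⟩ := hKO x x.2
      have h1 : palin A₁ a (x : V) = 0 := by
        have h2 := palin_intertwine (A := A₁.restrict (symplOrtho_invariant hσ hA₁ hKA)) (A' := A₁)
          (symplOrtho σ K).subtype (fun x => rfl) a x
        rw [hx, map_zero] at h2
        exact h2.symm
      have h2 : p (palin A₁ a (x : V)) = 0 := by rw [h1, map_zero]
      rw [hz, hpal _ _ (hQO _)] at h2
      have h3 := hmem _ (hQO _) (hBZ a (Set.mem_insert_of_mem _ ha) _ h2)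
      have h4 := hdisj z (by rw [hQW _ h3, map_zero])
      exact Subtype.ext (hz.trans h4)

end LinearApproximation

/-! ### Density of the linear symplectic maps of finite order -/

section LinearApproximation
open LinearMap (BilinForm)

/-- Every totally elliptic linear symplectic map is a limit of linear symplectic maps of finite
order, and these can be chosen without eigenvalues in a given finite set. The induction is on the
dimension. -/
theorem IsUnitModulus.mem_closure_finiteOrderAvoiding (n : ℕ) : ∀ {V : Type*}
    [NormedAddCommGroup V] [NormedSpace ℝ V] [FiniteDimensional ℝ V], Module.finrank ℝ V = n →
    ∀ {σ : BilinForm ℝ V}, IsLinearSymplectic σ → ∀ {A : Module.End ℝ V},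
    (∀ x y, σ (A x) (A y) = σ x y) → IsUnitModulus A → ∀ {Z : Set ℝ}, Z.Finite →
    ⇑A ∈ closure (finiteOrderAvoiding σ Z) := by
  induction n using Nat.strong_induction_on with
  | _ n ih =>
  intro V _ _ _ hn σ hσ A hA hAu Z hZ
  have IH : ∀ U : Submodule ℝ V, U ≠ ⊤ → (∀ x ∈ U, (∀ y ∈ U, σ x y = 0) → x = 0) →
      ∀ B : Module.End ℝ U, (∀ x y : U, σ (B x) (B y) = σ x y) → IsUnitModulus B →
      ∀ Z : Set ℝ, Z.Finite → ⇑B ∈ closure (finiteOrderAvoiding (σ.domRestrict₁₂ U U) Z) := by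
    intro U hU hnd B hB hBu Z hZ
    exact ih _ (by rw [← hn]; exact Submodule.finrank_lt hU) rfl
      (hσ.domRestrict hnd) hB hBu hZ
  rcases subsingleton_or_nontrivial V with hV | hV
  · exact subset_closure ⟨A, rfl, hA, ⟨1, one_pos, by ext x; exact Subsingleton.elim _ _⟩,
      fun _ _ _ _ => Subsingleton.elim _ _⟩
  by_cases hirr : ∀ W : Submodule ℝ V, (∀ x ∈ W, A x ∈ W) →
      (∀ x ∈ W, (∀ y ∈ W, σ x y = 0) → x = 0) → W ≠ ⊥ → W = ⊤
  swap
  · -- an invariant symplectic subspace splits off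
    push Not at hirr
    obtain ⟨W, hWA, hWnd, hW0, hW1⟩ := hirr
    have hWO := symplOrtho_invariant hσ hA hWA
    have hOnd := symplOrtho_nondeg hσ hWnd
    refine mem_closure_of_splitting hσ hWnd hWA hWO ?_ ?_
    · exact IH W hW1 hWnd _ (fun x y => hA x y)
        (hAu.of_injective W.subtype (fun _ => rfl) Subtype.val_injective) Z hZ
    · refine IH _ ?_ hOnd _ (fun x y => hA x y)
        (hAu.of_injective (symplOrtho σ W).subtype (fun _ => rfl) Subtype.val_injective) Z hZ
      intro h
      apply hW0
      rw [eq_bot_iff]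
      intro x hx
      exact Submodule.disjoint_def.mp (isCompl_symplOrtho hσ hWnd).disjoint x hx (by rw [h]; trivial)
  by_cases hdeg : ∀ c : ℝ, |c| ≤ 1 → ∀ v, palin A c v = 0 → σ v (A v) = 0
  swap
  · push Not at hdeg
    obtain ⟨c, hc, v, hv, hne⟩ := hdeg
    refine mem_closure_of_plane hσ hZ hc hv hne (hirr _ ?_ ?_ ?_)
    · intro x hx
      obtain ⟨a, b, rfl⟩ := Submodule.mem_span_pair.mp hx
      rw [palin_apply] at hv
      have h2 : A (A v) = (2 * c) • A v - v := by
        rw [← sub_eq_zero, ← hv]; abel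
      refine Submodule.mem_span_pair.mpr ⟨-b, a + b * (2 * c), ?_⟩
      rw [map_add, map_smul, map_smul, h2]; module
    · intro x hx h
      obtain ⟨a, b, rfl⟩ := Submodule.mem_span_pair.mp hx
      have e1 := h v (Submodule.subset_span (by simp))
      have e2 := h (A v) (Submodule.subset_span (by simp))
      simp only [map_add, map_smul, LinearMap.add_apply, LinearMap.smul_apply, smul_eq_mul,
        hσ.alt, mul_zero, zero_add, add_zero, hσ.neg v (A v), mul_neg, neg_eq_zero, mul_eq_zero,
        hne, or_false] at e1 e2
      rw [e1, e2]; simp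
    · intro hbot
      have : v ∈ (⊥ : Submodule ℝ V) := hbot ▸ Submodule.subset_span (by simp)
      rw [Submodule.mem_bot] at this
      exact hne (by rw [this]; simp)
  obtain ⟨c, hc, v, hv0, hv⟩ := hAu.exists_palin_eq_zero
  rcases hc.lt_or_eq with hlt | heq
  · -- an isotropic invariant plane
    set W := Submodule.span ℝ {v, A v} with hWdef
    have h2 : A (A v) = (2 * c) • A v - v := by
      rw [palin_apply] at hv
      rw [← sub_eq_zero, ← hv]; abel
    have hvW : v ∈ W := Submodule.subset_span (by simp)
    have hWA : ∀ x ∈ W, A x ∈ W := by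
      intro x hx
      obtain ⟨a, b, rfl⟩ := Submodule.mem_span_pair.mp hx
      refine Submodule.mem_span_pair.mpr ⟨-b, a + b * (2 * c), ?_⟩
      rw [map_add, map_smul, map_smul, h2]; module
    have hWc : ∀ x ∈ W, palin A c x = 0 := by
      intro x hx
      obtain ⟨a, b, rfl⟩ := Submodule.mem_span_pair.mp hx
      have := palin_intertwine (A := A) (A' := A) A (fun _ => rfl) c v
      rw [map_add, map_smul, map_smul, ← this, hv]; simp
    have hiso : ∀ x ∈ W, ∀ y ∈ W, σ x y = 0 := by
      intro x hx y hy
      obtain ⟨a, b, rfl⟩ := Submodule.mem_span_pair.mp hx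
      obtain ⟨a', b', rfl⟩ := Submodule.mem_span_pair.mp hy
      simp [hσ.alt, hdeg c hc v hv, hσ.neg v (A v)]
    have hW0 : W ≠ ⊥ := fun h => hv0 (by rwa [h, Submodule.mem_bot] at hvW)
    by_cases hne : symplOrtho σ W = W
    · refine mem_closure_of_palin_sq hσ hA hZ hlt ?_ (hdeg c hc) hirr
      intro x
      apply hWc
      rw [← hne]
      intro w hw
      obtain ⟨w', hw', rfl⟩ := exists_apply_eq_of_invariant hσ hA hWA hw
      obtain ⟨w'', hw'', rfl⟩ := exists_apply_eq_of_invariant hσ hA hWA hw'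
      rw [symplectic_palin hA, hWc _ hw'', map_zero]
    · exact mem_closure_of_isotropic hσ hA hAu hZ hc IH hW0 hWA hiso hWc hne
  · -- an eigenline, for the eigenvalue `c = ±1`
    have hc2 : c ^ 2 = 1 := by rw [← sq_abs, heq, one_pow]
    have hpc : ∀ x, palin A c x = A (A x - c • x) - c • (A x - c • x) := by
      intro x
      rw [palin_apply, map_sub, map_smul, smul_sub, smul_smul, ← pow_two, hc2]; module
    obtain ⟨v₁, hv₁, hAv₁⟩ : ∃ v₁, v₁ ≠ 0 ∧ A v₁ = c • v₁ := by
      by_cases h : A v - c • v = 0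
      · exact ⟨v, hv0, sub_eq_zero.mp h⟩
      · exact ⟨_, h, by rw [hpc] at hv; exact sub_eq_zero.mp hv⟩
    set W := Submodule.span ℝ {v₁} with hWdef
    have hvW : v₁ ∈ W := Submodule.mem_span_singleton_self v₁
    have hWA : ∀ x ∈ W, A x ∈ W := by
      intro x hx
      obtain ⟨a, rfl⟩ := Submodule.mem_span_singleton.mp hx
      rw [map_smul, hAv₁]
      exact W.smul_mem _ (W.smul_mem _ hvW)
    have hiso : ∀ x ∈ W, ∀ y ∈ W, σ x y = 0 := by
      intro x hx y hy
      obtain ⟨a, rfl⟩ := Submodule.mem_span_singleton.mp hx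
      obtain ⟨b, rfl⟩ := Submodule.mem_span_singleton.mp hy
      simp [hσ.alt]
    have hWc : ∀ x ∈ W, palin A c x = 0 := by
      intro x hx
      obtain ⟨a, rfl⟩ := Submodule.mem_span_singleton.mp hx
      rw [map_smul, hpc, hAv₁]; simp
    have hW0 : W ≠ ⊥ := fun h => hv₁ (by rwa [h, Submodule.mem_bot] at hvW)
    by_cases hne : symplOrtho σ W = W
    · have hdiff : ∀ x, A x - c • x ∈ W := by
        intro x
        rw [← hne]
        intro w hw
        obtain ⟨a, rfl⟩ := Submodule.mem_span_singleton.mp hw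
        have h1 : a • v₁ = c • A (a • v₁) := by
          rw [map_smul, hAv₁, smul_comm, smul_smul c c, ← pow_two, hc2, one_smul]
        rw [map_sub, LinearMap.sub_apply]
        nth_rw 1 [h1]
        rw [map_smul, hA, map_smul σ c x, LinearMap.smul_apply, sub_self]
      have hAc : ∀ x, A x = c • x := by
        intro x
        obtain ⟨s, hs⟩ := Submodule.mem_span_singleton.mp (hdiff x)
        have h1 : A x = c • x + s • v₁ := by rw [hs]; abel
        have h2 : palin A c x = 0 := by rw [hpc, ← hs, map_smul, hAv₁]; module
        have h3 := hdeg c hc x h2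
        rw [h1, map_add, map_smul, map_smul, hσ.alt, smul_zero, zero_add, smul_eq_mul] at h3
        rcases mul_eq_zero.mp h3 with h4 | h4
        · rw [h1, h4]; simp
        · have hxW : x ∈ W := by
            rw [← hne]
            intro w hw
            obtain ⟨a, rfl⟩ := Submodule.mem_span_singleton.mp hw
            rw [map_smul, h4, smul_zero]
          obtain ⟨a, rfl⟩ := Submodule.mem_span_singleton.mp hxW
          rw [map_smul, hAv₁, smul_comm]
      obtain ⟨w, hw⟩ : ∃ w, σ v₁ w ≠ 0 := by
        by_contra! h
        exact hv₁ (hσ.nondeg _ h)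
      refine mem_closure_of_scalar hσ hZ hc2 hAc hw (hirr _ ?_ ?_ ?_)
      · intro x hx
        rw [hAc]
        exact Submodule.smul_mem _ _ hx
      · intro x hx h
        obtain ⟨a, b, rfl⟩ := Submodule.mem_span_pair.mp hx
        have e1 := h v₁ (Submodule.subset_span (by simp))
        have e2 := h w (Submodule.subset_span (by simp))
        simp only [map_add, map_smul, LinearMap.add_apply, LinearMap.smul_apply, smul_eq_mul,
          hσ.alt, mul_zero, zero_add, add_zero, hσ.neg v₁ w, mul_neg, neg_eq_zero, mul_eq_zero,
          hw, or_false] at e1 e2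
        rw [e1, e2]; simp
      · intro hbot
        have : v₁ ∈ (⊥ : Submodule ℝ V) := hbot ▸ Submodule.subset_span (by simp)
        exact hv₁ ((Submodule.mem_bot ℝ).mp this)
    · exact mem_closure_of_isotropic hσ hA hAu hZ hc IH hW0 hWA hiso hWc hne

variable {V : Type*} [NormedAddCommGroup V] [NormedSpace ℝ V]

/-- The characteristic polynomial `χ` kills the endomorphism, and since it is real, `χ²` is the
product over its complex roots `μ` of `(X - μ) (X - conj μ) = X² - 2 (Re μ) X + 1`. -/
theorem isUnitModulus_of_charpoly [FiniteDimensional ℝ V] {A : Module.End ℝ V}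
    (h : ∀ μ : ℂ, Polynomial.aeval μ (LinearMap.charpoly A) = 0 → ‖μ‖ = 1) :
    IsUnitModulus A := by
  set χ := LinearMap.charpoly A with hχ
  set P := χ.map (algebraMap ℝ ℂ) with hP
  have hPm : P.Monic := (LinearMap.charpoly_monic A).map _
  have hsplit : P.Splits := IsAlgClosed.splits P
  have hroots : P = (P.roots.map fun a => Polynomial.X - Polynomial.C a).prod :=
    hsplit.eq_prod_roots_of_monic hPm
  have hnorm : ∀ a ∈ P.roots, ‖a‖ = 1 := by
    intro a ha
    apply h
    have := Polynomial.isRoot_of_mem_roots ha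
    rwa [Polynomial.IsRoot, hP, Polynomial.eval_map_algebraMap] at this
  set r : List ℂ := P.roots.toList with hr
  have hPr : P = (r.map fun a => Polynomial.X - Polynomial.C a).prod := by
    conv_lhs => rw [hroots]
    rw [hr, ← Multiset.prod_coe, ← Multiset.map_coe, Multiset.coe_toList]
  have hconj : P.map (starRingEnd ℂ) = P := by
    rw [hP, Polynomial.map_map]
    congr 1
    ext x; simp
  let q : ℝ → Polynomial ℝ := fun c => Polynomial.X * Polynomial.X - Polynomial.C (2 * c) *
    Polynomial.X + 1
  have key : ∀ l : List ℂ, (∀ a ∈ l, ‖a‖ = 1) →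
      (l.map fun a => Polynomial.X - Polynomial.C a).prod *
        ((l.map fun a => Polynomial.X - Polynomial.C a).prod).map (starRingEnd ℂ) =
      (((l.map Complex.re).map q).prod).map (algebraMap ℝ ℂ) := by
    intro l
    induction l with
    | nil => simp
    | cons a l ih =>
      intro hl
      have h1 := ih fun b hb => hl b (by simp [hb])
      have h2 : a * (starRingEnd ℂ) a = 1 := by
        rw [Complex.mul_conj, Complex.normSq_eq_norm_sq, hl a (by simp)]; simp
      have h3 : (Polynomial.C a : Polynomial ℂ) * Polynomial.C ((starRingEnd ℂ) a) = 1 := by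
        rw [← Polynomial.C_mul, h2, Polynomial.C_1]
      have h4 : (Polynomial.C a : Polynomial ℂ) + Polynomial.C ((starRingEnd ℂ) a) =
          Polynomial.C ((2 * a.re : ℝ) : ℂ) := by
        rw [← Polynomial.C_add, Complex.add_conj]
      simp only [List.map_cons, List.prod_cons, Polynomial.map_mul, ← h1]
      have h5 : (q a.re).map (algebraMap ℝ ℂ) = (Polynomial.X - Polynomial.C a) *
          (Polynomial.X - Polynomial.C ((starRingEnd ℂ) a)) := by
        simp only [q, Polynomial.map_add, Polynomial.map_sub, Polynomial.map_mul, Polynomial.map_X,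
          Polynomial.map_C, Polynomial.map_one, Complex.coe_algebraMap]
        rw [← h4]
        linear_combination -h3
      rw [h5]
      simp only [Polynomial.map_sub, Polynomial.map_X, Polynomial.map_C]
      ring
  have hmul : χ * χ = ((r.map Complex.re).map q).prod := by
    apply Polynomial.map_injective (algebraMap ℝ ℂ) (algebraMap ℝ ℂ).injective
    rw [Polynomial.map_mul, ← hP]
    nth_rw 2 [← hconj]
    rw [hPr]
    exact key r fun a ha => hnorm a (by rwa [hr, Multiset.mem_toList] at ha)
  refine ⟨r.map Complex.re, ?_, ?_⟩
  · intro c hc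
    obtain ⟨a, ha, rfl⟩ := List.mem_map.mp hc
    rw [← hnorm a (by rwa [hr, Multiset.mem_toList] at ha)]
    exact Complex.abs_re_le_norm a
  · have h1 : Polynomial.aeval A (χ * χ) = 0 := by
      rw [map_mul, hχ, LinearMap.aeval_self_charpoly, zero_mul]
    rw [hmul, map_list_prod, List.map_map] at h1
    rw [← h1]
    congr 2
    funext c
    simp [q, palin, Algebra.smul_def]

/-- Operator-norm version of the approximation of a totally elliptic map by maps of finite order. -/
theorem exists_finite_order_near [FiniteDimensional ℝ V]
    {σ : BilinForm ℝ V} (hσ : IsLinearSymplectic σ) {A : V →L[ℝ] V}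
    (hA : ∀ x y, σ (A x) (A y) = σ x y) (hAu : IsUnitModulus (A : V →ₗ[ℝ] V)) {ε : ℝ}
    (hε : 0 < ε) : ∃ B : V →L[ℝ] V, ‖B - A‖ < ε ∧ (∀ x y, σ (B x) (B y) = σ x y) ∧
      ∃ N : ℕ, 0 < N ∧ ∀ x, (⇑B)^[N] x = x := by
  have hcl := hAu.mem_closure_finiteOrderAvoiding _ rfl hσ hA Set.finite_empty
  let b := Module.finBasis ℝ V
  let Φ : (V → V) → (V →L[ℝ] V) := fun f => LinearMap.toContinuousLinearMap
    (b.constr ℝ (fun i => f (b i)))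
  have hΦ : Continuous Φ := by
    have h1 : Φ = (LinearMap.toContinuousLinearMap.toLinearMap ∘ₗ
      (b.constr ℝ (M' := V)).toLinearMap) ∘ fun f i => f (b i) := rfl
    rw [h1]
    exact (LinearMap.continuous_of_finiteDimensional _).comp (by fun_prop)
  have hΦL : ∀ B : V →ₗ[ℝ] V, Φ B = LinearMap.toContinuousLinearMap B := by
    intro B
    simp only [Φ]
    congr 1
    exact b.ext fun i => by simp
  have h2 : Φ A ∈ closure {B : V →L[ℝ] V | (∀ x y, σ (B x) (B y) = σ x y) ∧
      ∃ N : ℕ, 0 < N ∧ ∀ x, (⇑B)^[N] x = x} := by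
    refine map_mem_closure hΦ hcl ?_
    rintro _ ⟨B, rfl, hB, ⟨N, hN, hBN⟩, -⟩
    rw [hΦL]
    refine ⟨hB, N, hN, fun x => ?_⟩
    have := congrArg (fun f : Module.End ℝ V => f x) hBN
    simp only [Module.End.pow_apply, Module.End.one_apply] at this
    exact this
  have h3 : Φ A = A := by
    have := hΦL (A : V →ₗ[ℝ] V)
    rw [ContinuousLinearMap.coe_coe] at this
    rw [this]; ext; rfl
  rw [h3] at h2
  obtain ⟨B, hB, hd⟩ := Metric.mem_closure_iff.mp h2 ε hε
  exact ⟨B, by rwa [← dist_eq_norm, dist_comm], hB⟩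

end LinearApproximation

/-! ### The linear normal form of a symplectic form -/

section LinearNormalForm

open LinearMap (BilinForm)

variable {V : Type*} [NormedAddCommGroup V] [NormedSpace ℝ V]

/-- An alternating 2-form as a bilinear map, continuously and linearly in the form. -/
noncomputable def altBilin : (V [⋀^Fin 2]→L[ℝ] ℝ) →L[ℝ] V →L[ℝ] V →L[ℝ] ℝ :=
  (ContinuousLinearMap.compL ℝ V _ _
    (continuousMultilinearCurryFin1 ℝ V ℝ).toContinuousLinearEquiv.toContinuousLinearMap) ∘L
  (continuousMultilinearCurryLeftEquiv ℝ (fun _ : Fin 2 => V)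
    ℝ).toContinuousLinearEquiv.toContinuousLinearMap ∘L
  (ContinuousAlternatingMap.toContinuousMultilinearMapCLM ℝ)

@[simp]
theorem altBilin_apply (a : V [⋀^Fin 2]→L[ℝ] ℝ) (x y : V) : altBilin a x y = a ![x, y] := by
  simp only [altBilin, ContinuousLinearMap.comp_apply, ContinuousLinearMap.compL_apply]
  change a (Fin.cons x (Fin.snoc 0 y)) = _
  congr 1
  funext i
  fin_cases i <;> rfl

theorem alt_self (a : V [⋀^Fin 2]→L[ℝ] ℝ) (x : V) : a ![x, x] = 0 :=
  a.map_eq_zero_of_eq ![x, x] (i := 0) (j := 1) rfl (by decide)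

theorem alt_neg (a : V [⋀^Fin 2]→L[ℝ] ℝ) (x y : V) : a ![y, x] = - a ![x, y] := by
  have h := alt_self a (x + y)
  simp only [← altBilin_apply, map_add, add_apply] at h ⊢
  have h1 := alt_self a x
  have h2 := alt_self a y
  simp only [← altBilin_apply] at h1 h2
  linarith

theorem alt_ext {a b : V [⋀^Fin 2]→L[ℝ] ℝ} (h : ∀ x y, a ![x, y] = b ![x, y]) : a = b := by
  ext v
  have : v = ![v 0, v 1] := by
    funext i; fin_cases i <;> rfl
  rw [this, h]

/-- The underlying bilinear form of an alternating 2-form. -/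
noncomputable def altForm (a : V [⋀^Fin 2]→L[ℝ] ℝ) : BilinForm ℝ V :=
  (altBilin a).toLinearMap₁₂

@[simp]
theorem altForm_apply (a : V [⋀^Fin 2]→L[ℝ] ℝ) (x y : V) : altForm a x y = a ![x, y] :=
  altBilin_apply a x y

theorem isLinearSymplectic_altForm {a : V [⋀^Fin 2]→L[ℝ] ℝ}
    (h : ∀ x, (∀ y, a ![x, y] = 0) → x = 0) : IsLinearSymplectic (altForm a) where
  alt := fun x => by rw [altForm_apply, alt_self]
  nondeg := fun x hx => h x fun y => by rw [← altForm_apply, hx]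

theorem stdAlt_apply {d : ℕ} (x y : R2 d) : stdAlt d ![x, y] =
    ∑ i : Fin d, (x (Sum.inl i) * y (Sum.inr i) - x (Sum.inr i) * y (Sum.inl i)) := rfl

theorem stdAlt_nondeg {d : ℕ} (x : R2 d) (h : ∀ y, stdAlt d ![x, y] = 0) : x = 0 := by
  ext j
  rcases j with j | j
  · have := h (EuclideanSpace.single (Sum.inr j) 1)
    simpa [stdAlt_apply] using this
  · have := h (EuclideanSpace.single (Sum.inl j) 1)
    simpa [stdAlt_apply] using this

/-- The standard complex structure `(p, q) ↦ (-q, p)`. -/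
noncomputable def stdJ (d : ℕ) : R2 d →L[ℝ] R2 d :=
  LinearMap.toContinuousLinearMap
    { toFun := fun x => WithLp.toLp 2 (Sum.elim (fun i => - x (Sum.inr i)) fun i => x (Sum.inl i))
      map_add' := fun x y => by ext j; rcases j with j | j <;> simp; ring
      map_smul' := fun c x => by ext j; rcases j with j | j <;> simp }

theorem stdJ_inl {d : ℕ} (x : R2 d) (i : Fin d) : stdJ d x (Sum.inl i) = - x (Sum.inr i) := rfl
theorem stdJ_inr {d : ℕ} (x : R2 d) (i : Fin d) : stdJ d x (Sum.inr i) = x (Sum.inl i) := rfl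

theorem stdJ_stdJ {d : ℕ} (x : R2 d) : stdJ d (stdJ d x) = - x := by
  ext j; rcases j with j | j <;> simp [stdJ_inl, stdJ_inr]

theorem stdAlt_stdJ_right {d : ℕ} (x y : R2 d) :
    stdAlt d ![x, stdJ d y] = ∑ j, x j * y j := by
  simp only [stdAlt_apply, stdJ_inl, stdJ_inr, Fintype.sum_sum_type, ← Finset.sum_add_distrib]
  exact Finset.sum_congr rfl fun i _ => by ring

theorem stdAlt_stdJ_self {d : ℕ} (x : R2 d) : stdAlt d ![x, stdJ d x] = ‖x‖ ^ 2 := by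
  rw [stdAlt_stdJ_right, EuclideanSpace.norm_sq_eq]
  exact Finset.sum_congr rfl fun i _ => by rw [Real.norm_eq_abs, sq_abs]; ring

theorem stdAlt_stdJ_left {d : ℕ} (x y : R2 d) :
    stdAlt d ![stdJ d x, y] = - stdAlt d ![x, stdJ d y] := by
  rw [alt_neg, stdAlt_stdJ_right, stdAlt_stdJ_right]
  exact congrArg _ (Finset.sum_congr rfl fun i _ => mul_comm _ _)

/-- Symplectic Gram–Schmidt: a hyperbolic pair is split off, and its symplectic orthogonal has
dimension two less. -/
theorem exists_symplectic_basis (d : ℕ) : ∀ {V : Type*} [NormedAddCommGroup V] [NormedSpace ℝ V]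
    [FiniteDimensional ℝ V], Module.finrank ℝ V = 2 * d → ∀ {σ : BilinForm ℝ V},
    IsLinearSymplectic σ → ∃ p q : Fin d → V, (∀ i j, σ (p i) (p j) = 0) ∧
      (∀ i j, σ (q i) (q j) = 0) ∧ ∀ i j, σ (p i) (q j) = if i = j then 1 else 0 := by
  induction d with
  | zero => exact fun _ _ _ => ⟨Fin.elim0, Fin.elim0, fun i => i.elim0, fun i => i.elim0,
      fun i => i.elim0⟩
  | succ d ih =>
    intro V _ _ _ hV σ hσ
    have : Nontrivial V := Module.nontrivial_of_finrank_pos (R := ℝ) (by omega)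
    obtain ⟨v, hv⟩ := exists_ne (0 : V)
    obtain ⟨w₀, hw₀⟩ : ∃ w, σ v w ≠ 0 := by
      by_contra! h
      exact hv (hσ.nondeg v h)
    set w := (σ v w₀)⁻¹ • w₀ with hw
    have hvw : σ v w = 1 := by rw [hw, map_smul, smul_eq_mul, inv_mul_cancel₀ hw₀]
    have hwv : σ w v = -1 := by rw [hσ.neg, hvw]
    set W := Submodule.span ℝ {v, w} with hW
    have hvW : v ∈ W := Submodule.subset_span (by simp)
    have hwW : w ∈ W := Submodule.subset_span (by simp)
    have hnd : ∀ x ∈ W, (∀ y ∈ W, σ x y = 0) → x = 0 := by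
      intro x hx h
      obtain ⟨a, b, rfl⟩ := Submodule.mem_span_pair.mp hx
      have e1 := h v hvW
      have e2 := h w hwW
      simp [hσ.alt, hvw, hwv] at e1 e2
      rw [e1, e2]; simp
    have hli : LinearIndependent ℝ ![v, w] := by
      rw [LinearIndependent.pair_iff]
      intro a b hab
      have e1 := congrArg (fun z => σ z v) hab
      have e2 := congrArg (fun z => σ z w) hab
      simp [hσ.alt, hvw, hwv] at e1 e2
      exact ⟨e2, e1⟩
    have hWd : Module.finrank ℝ W = 2 := by
      have := finrank_span_eq_card hli
      rwa [Matrix.range_cons, Matrix.range_cons, Matrix.range_empty, Set.union_empty,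
        Fintype.card_fin, Set.singleton_union] at this
    have hO := Submodule.finrank_add_eq_of_isCompl (isCompl_symplOrtho hσ hnd)
    obtain ⟨p, q, hp, hq, hpq⟩ := ih (V := symplOrtho σ W) (by omega)
      (hσ.domRestrict (symplOrtho_nondeg hσ hnd))
    replace hp : ∀ i j, σ (p i) (p j) = 0 := hp
    replace hq : ∀ i j, σ (q i) (q j) = 0 := hq
    replace hpq : ∀ i j, σ (p i) (q j) = if i = j then 1 else 0 := hpq
    have hl : ∀ (z : symplOrtho σ W), ∀ y ∈ W, σ z y = 0 := fun z y hy => z.2 y hy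
    have hr : ∀ (z : symplOrtho σ W), ∀ y ∈ W, σ y z = 0 := fun z y hy => by
      rw [hσ.neg, hl z y hy, neg_zero]
    refine ⟨Fin.cons v fun i => p i, Fin.cons w fun i => q i, ?_, ?_, ?_⟩
    · intro i j
      refine Fin.cases ?_ (fun i => ?_) i <;> refine Fin.cases ?_ (fun j => ?_) j
      · simp [hσ.alt]
      · simp [hr _ v hvW]
      · simp [hl _ v hvW]
      · simpa using hp i j
    · intro i j
      refine Fin.cases ?_ (fun i => ?_) i <;> refine Fin.cases ?_ (fun j => ?_) j
      · simp [hσ.alt]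
      · simp [hr _ w hwW]
      · simp [hl _ w hwW]
      · simpa using hq i j
    · intro i j
      refine Fin.cases ?_ (fun i => ?_) i <;> refine Fin.cases ?_ (fun j => ?_) j
      · simp [hvw]
      · simp [hr _ v hvW, (Fin.succ_ne_zero _).symm]
      · simp [hl _ w hwW]
      · simpa using hpq i j

/-- All symplectic forms on vector spaces of the same dimension are isomorphic. -/
theorem exists_linear_normal_form [FiniteDimensional ℝ V] {d : ℕ}
    (hV : Module.finrank ℝ V = 2 * d) {a : V [⋀^Fin 2]→L[ℝ] ℝ}
    (ha : ∀ x, (∀ y, a ![x, y] = 0) → x = 0) :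
    ∃ L : R2 d ≃L[ℝ] V, ∀ x y, a ![L x, L y] = stdAlt d ![x, y] := by
  have hσ := isLinearSymplectic_altForm ha
  obtain ⟨p, q, hp, hq, hpq⟩ := exists_symplectic_basis d hV hσ
  have hqp : ∀ i j, altForm a (q i) (p j) = - if j = i then 1 else 0 := fun i j => by
    rw [hσ.neg, hpq]
  let L₀ : R2 d →ₗ[ℝ] V :=
    { toFun := fun x => ∑ i, (x (Sum.inl i) • p i + x (Sum.inr i) • q i)
      map_add' := fun x y => by
        rw [← Finset.sum_add_distrib]
        exact Finset.sum_congr rfl fun i _ => by simp only [PiLp.add_apply]; module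
      map_smul' := fun c x => by
        rw [Finset.smul_sum]
        exact Finset.sum_congr rfl fun i _ => by
          simp only [PiLp.smul_apply, smul_eq_mul, RingHom.id_apply]; module }
  have hL₀ : ∀ x, L₀ x = ∑ i, (x (Sum.inl i) • p i + x (Sum.inr i) • q i) := fun x => rfl
  have hform : ∀ x y, altForm a (L₀ x) (L₀ y) = stdAlt d ![x, y] := by
    intro x y
    rw [hL₀, hL₀, stdAlt_apply, map_sum (altForm a), LinearMap.sum_apply]
    refine Finset.sum_congr rfl fun i _ => ?_
    simp only [map_sum, map_add, map_smul, LinearMap.add_apply, LinearMap.smul_apply, hp, hq, hpq,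
      hqp, smul_eq_mul]
    simp only [mul_zero, zero_add, add_zero, mul_neg, mul_ite, mul_one, Finset.sum_add_distrib,
      Finset.sum_neg_distrib, Finset.sum_ite_eq, Finset.sum_ite_eq', Finset.mem_univ, if_true]
    ring
  have hinj : Function.Injective L₀ := by
    rw [← LinearMap.ker_eq_bot, LinearMap.ker_eq_bot']
    intro x hx
    exact stdAlt_nondeg x fun y => by rw [← hform, hx]; simp
  have hdim : Module.finrank ℝ (R2 d) = Module.finrank ℝ V := by
    rw [hV, finrank_euclideanSpace]; simp; ring
  refine ⟨(LinearEquiv.ofInjectiveOfFinrankEq L₀ hinj hdim).toContinuousLinearEquiv, ?_⟩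
  intro x y
  rw [← hform, altForm_apply]
  rfl

end LinearNormalForm

/-! ### Superposition operators on spaces of curves -/

section Superposition

open unitInterval MeasureTheory

section Topological

variable {E F : Type*} [TopologicalSpace E] [TopologicalSpace F]

/-- The superposition (Nemytskii) operator `γ ↦ (t ↦ X t (γ t))` on continuous curves. -/
def superpose (X : I → E → F) (hX : Continuous (Function.uncurry X)) (γ : C(I, E)) : C(I, F) :=
  ⟨fun t => X t (γ t), hX.comp (continuous_id.prodMk γ.continuous)⟩

@[simp]
theorem superpose_apply (X : I → E → F) (hX : Continuous (Function.uncurry X)) (γ : C(I, E))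
    (t : I) : superpose X hX γ t = X t (γ t) := rfl

theorem continuous_superpose (X : I → E → F) (hX : Continuous (Function.uncurry X)) :
    Continuous (superpose X hX) := by
  refine ContinuousMap.continuous_of_continuous_uncurry _ ?_
  exact hX.comp (f := fun p : C(I, E) × I => (p.2, p.1 p.2)) (by fun_prop)

/-- The extension of a curve to the real line by constants. -/
noncomputable def curveExtend (f : C(I, F)) (s : ℝ) : F := f (Set.projIcc 0 1 zero_le_one s)

theorem continuous_curveExtend (f : C(I, F)) : Continuous (curveExtend f) :=
  f.continuous.comp continuous_projIcc

theorem curveExtend_coe (f : C(I, F)) (t : I) : curveExtend f t = f t := by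
  rw [curveExtend, Set.projIcc_val]

end Topological

variable {E F : Type*} [NormedAddCommGroup E] [NormedSpace ℝ E]
  [NormedAddCommGroup F] [NormedSpace ℝ F]

/-- Pointwise application of a curve of operators to a curve of vectors. -/
noncomputable def curveApply : C(I, E →L[ℝ] F) →L[ℝ] C(I, E) →L[ℝ] C(I, F) :=
  LinearMap.mkContinuous₂
    (LinearMap.mk₂ ℝ (fun (a : C(I, E →L[ℝ] F)) (v : C(I, E)) =>
      (⟨fun t => a t (v t), a.continuous.clm_apply v.continuous⟩ : C(I, F)))
      (fun a b v => by ext t; simp) (fun c a v => by ext t; simp)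
      (fun a v w => by ext t; simp) (fun c a v => by ext t; simp)) 1 (by
    intro a v
    rw [one_mul]
    refine (ContinuousMap.norm_le _ (by positivity)).mpr fun t => ?_
    exact (a t).le_of_opNorm_le_of_le (a.norm_coe_le_norm t) (v.norm_coe_le_norm t))

@[simp]
theorem curveApply_apply (a : C(I, E →L[ℝ] F)) (v : C(I, E)) (t : I) :
    curveApply a v t = a t (v t) := rfl

theorem hasFDerivAt_superpose {X : I → E → F} {X' : I → E → E →L[ℝ] F}
    (hX : Continuous (Function.uncurry X)) (hX' : Continuous (Function.uncurry X'))
    (h : ∀ t x, HasFDerivAt (X t) (X' t x) x) (γ : C(I, E)) :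
    HasFDerivAt (superpose X hX) (curveApply (superpose X' hX' γ)) γ := by
  rw [hasFDerivAt_iff_isLittleO_nhds_zero, Asymptotics.isLittleO_iff]
  intro ε hε
  -- uniform continuity of the derivative along the compact curve
  have hunif : ∀ᶠ w in 𝓝 (0 : E), ∀ t ∈ (Set.univ : Set I),
      ‖X' t (γ t + w) - X' t (γ t)‖ < ε := by
    refine isCompact_univ.eventually_forall_of_forall_eventually fun t _ => ?_
    have hc : Continuous fun p : E × I => ‖X' p.2 (γ p.2 + p.1) - X' p.2 (γ p.2)‖ := by
      have h1 : Continuous fun p : E × I => X' p.2 (γ p.2 + p.1) :=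
        hX'.comp (f := fun p : E × I => (p.2, γ p.2 + p.1)) (by fun_prop)
      have h2 : Continuous fun p : E × I => X' p.2 (γ p.2) :=
        hX'.comp (f := fun p : E × I => (p.2, γ p.2)) (by fun_prop)
      exact (h1.sub h2).norm
    exact hc.continuousAt.eventually_lt continuousAt_const (by simpa using hε)
  obtain ⟨δ, hδ, hball⟩ := Metric.eventually_nhds_iff_ball.mp hunif
  filter_upwards [Metric.ball_mem_nhds (0 : C(I, E)) hδ] with v hv
  rw [mem_ball_zero_iff] at hv
  refine (ContinuousMap.norm_le _ (by positivity)).mpr fun t => ?_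
  have hvt : ‖v t‖ < δ := (v.norm_coe_le_norm t).trans_lt hv
  have key := (convex_ball (γ t) δ).norm_image_sub_le_of_norm_hasFDerivWithin_le'
    (f := X t) (f' := X' t) (φ := X' t (γ t)) (C := ε) (x := γ t) (y := γ t + v t)
    (fun x _ => (h t x).hasFDerivWithinAt) ?_ (Metric.mem_ball_self hδ) ?_
  · rw [add_sub_cancel_left] at key
    exact calc ‖X t (γ t + v t) - X t (γ t) - X' t (γ t) (v t)‖ ≤ ε * ‖v t‖ := key
      _ ≤ ε * ‖v‖ := by gcongr; exact v.norm_coe_le_norm t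
  · intro x hx
    have := hball (x - γ t) (by rwa [mem_ball_zero_iff, ← dist_eq_norm, ← Metric.mem_ball]) t
      (Set.mem_univ t)
    rw [add_sub_cancel] at this
    exact this.le
  · rw [Metric.mem_ball, dist_eq_norm, add_sub_cancel_left]; exact hvt

theorem contDiff_superpose {X : I → E → F} {X' : I → E → E →L[ℝ] F}
    (hX : Continuous (Function.uncurry X)) (hX' : Continuous (Function.uncurry X'))
    (h : ∀ t x, HasFDerivAt (X t) (X' t x) x) : ContDiff ℝ 1 (superpose X hX) := by
  rw [contDiff_one_iff_hasFDerivAt]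
  exact ⟨_, curveApply.continuous.comp (continuous_superpose X' hX'),
    hasFDerivAt_superpose hX hX' h⟩

theorem norm_integral_curveExtend_le (f : C(I, F)) (t : I) :
    ‖∫ s in (0 : ℝ)..t, curveExtend f s‖ ≤ ‖f‖ := by
  have h1 := intervalIntegral.norm_integral_le_of_norm_le_const (a := (0 : ℝ)) (b := t)
    (f := curveExtend f) (C := ‖f‖) fun s _ => f.norm_coe_le_norm _
  refine h1.trans ?_
  rw [sub_zero, abs_of_nonneg t.2.1]
  exact mul_le_of_le_one_right (norm_nonneg _) t.2.2

/-- The primitive of a curve that vanishes at time `0`. -/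
noncomputable def primitive [CompleteSpace F] : C(I, F) →L[ℝ] C(I, F) :=
  LinearMap.mkContinuous
    { toFun := fun f => ⟨fun t => ∫ s in (0 : ℝ)..t, curveExtend f s,
        (intervalIntegral.continuous_primitive
          (fun a b => (continuous_curveExtend f).intervalIntegrable a b) 0).comp
          continuous_subtype_val⟩
      map_add' := fun f g => by
        ext t
        exact intervalIntegral.integral_add ((continuous_curveExtend f).intervalIntegrable _ _)
          ((continuous_curveExtend g).intervalIntegrable _ _)
      map_smul' := fun c f => by
        ext t
        exact intervalIntegral.integral_smul c _ } 1 (by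
    intro f
    rw [one_mul]
    exact (ContinuousMap.norm_le _ (by positivity)).mpr fun t => norm_integral_curveExtend_le f t)

theorem hasDerivAt_integral_curveExtend [CompleteSpace F] (f : C(I, F)) (t : I) :
    HasDerivAt (fun r : ℝ => ∫ s in (0 : ℝ)..r, curveExtend f s) (f t) t := by
  have h := intervalIntegral.integral_hasDerivAt_right
    ((continuous_curveExtend f).intervalIntegrable 0 (t : ℝ))
    ((continuous_curveExtend f).stronglyMeasurableAtFilter _ _) (continuous_curveExtend f).continuousAt
  rwa [curveExtend_coe] at h

/-- Constant curves. -/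
noncomputable def constCurve : E →L[ℝ] C(I, E) :=
  LinearMap.mkContinuous
    { toFun := fun x => ContinuousMap.const I x
      map_add' := fun _ _ => rfl
      map_smul' := fun _ _ => rfl } 1 (by
    intro x
    rw [one_mul]
    exact (ContinuousMap.norm_le _ (by positivity)).mpr fun t => le_rfl)

@[simp]
theorem constCurve_apply (x : E) (t : I) : constCurve x t = x := rfl

/-- The curves `t ↦ t x`. -/
noncomputable def rayCurve : E →L[ℝ] C(I, E) :=
  LinearMap.mkContinuous
    { toFun := fun x => ⟨fun t => (t : ℝ) • x, by fun_prop⟩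
      map_add' := fun _ _ => by ext t; simp
      map_smul' := fun c x => by ext t; exact smul_comm (t : ℝ) c x } 1 (by
    intro x
    rw [one_mul]
    refine (ContinuousMap.norm_le _ (by positivity)).mpr fun t => ?_
    change ‖(t : ℝ) • x‖ ≤ _
    rw [norm_smul, Real.norm_of_nonneg t.2.1]
    exact mul_le_of_le_one_left (norm_nonneg _) t.2.2)

@[simp]
theorem rayCurve_apply (x : E) (t : I) : rayCurve x t = (t : ℝ) • x := rfl

end Superposition

/-! ### The Poincaré lemma for two-forms -/

section Moser

open unitInterval

variable {V : Type*} [NormedAddCommGroup V] [NormedSpace ℝ V]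

/-- Poincaré lemma: a closed 2-form on a ball has a primitive of class `C¹`, given by the radial
homotopy `α(x) v = ∫₀¹ t β(t x)(x, v) dt`. -/
theorem exists_primitive_two_form {β : V → V →L[ℝ] V →L[ℝ] ℝ} (hβ : ContDiff ℝ 1 β)
    (halt : ∀ x u v, β x v u = - β x u v) (hβ0 : β 0 = 0) {r : ℝ}
    (hclosed : ∀ x ∈ Metric.ball (0 : V) r, ∀ u v w,
      fderiv ℝ β x u v w - fderiv ℝ β x v u w + fderiv ℝ β x w u v = 0) :
    ∃ α : V → V →L[ℝ] ℝ, ContDiff ℝ 1 α ∧ α 0 = 0 ∧ (∀ u v, fderiv ℝ α 0 u v = 0) ∧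
      ∀ x ∈ Metric.ball (0 : V) r, ∀ u v, fderiv ℝ α x u v - fderiv ℝ α x v u = β x u v := by
  have hβd : Differentiable ℝ β := hβ.differentiable one_ne_zero
  have hβ'c := hβ.continuous_fderiv one_ne_zero
  let X : I → V → V →L[ℝ] ℝ := fun _ y => β y y
  let X' : I → V → V →L[ℝ] V →L[ℝ] ℝ := fun _ y => (fderiv ℝ β y).flip y + β y
  have hX'x : ∀ t y u, X' t y u = fderiv ℝ β y u y + β y u := fun t y u => rfl
  have hX : Continuous (Function.uncurry X) := by
    have := hβ.continuous
    simp only [X, Function.uncurry_def]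
    fun_prop
  have hX' : Continuous (Function.uncurry X') := by
    have h1 := hβ.continuous
    have h2 : Continuous fun y => (fderiv ℝ β y).flip :=
      (ContinuousLinearMap.flipₗᵢ ℝ V V (V →L[ℝ] ℝ)).continuous.comp hβ'c
    exact ((h2.comp continuous_snd).clm_apply continuous_snd).add (h1.comp continuous_snd)
  have hXX' : ∀ t x, HasFDerivAt (X t) (X' t x) x := by
    intro t x
    have h1 := (hβd x).hasFDerivAt.clm_apply (hasFDerivAt_id x)
    refine h1.congr_fderiv ?_
    ext u v
    simp [hX'x, add_comm]
  let ev : C(I, V →L[ℝ] ℝ) →L[ℝ] V →L[ℝ] ℝ := ContinuousMap.evalCLM ℝ (1 : I) ∘L primitive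
  let α : V → V →L[ℝ] ℝ := fun x => ev (superpose X hX (rayCurve x))
  have hev : ∀ f : C(I, V →L[ℝ] ℝ), ev f = ∫ s in (0 : ℝ)..1, curveExtend f s := fun f => rfl
  have hα' : ∀ x, HasFDerivAt α
      (ev ∘L curveApply (superpose X' hX' (rayCurve x)) ∘L rayCurve) x := fun x => by
    have hray : HasFDerivAt (rayCurve (E := V)) rayCurve x := ContinuousLinearMap.hasFDerivAt _
    exact ev.hasFDerivAt.comp x ((hasFDerivAt_superpose hX hX' hXX' (rayCurve x)).comp x hray)
  have hfα : ∀ x u v, fderiv ℝ α x u v = ∫ s in (0 : ℝ)..1,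
      curveExtend (curveApply (superpose X' hX' (rayCurve x)) (rayCurve u)) s v := by
    intro x u v
    rw [(hα' x).fderiv]
    simp only [ContinuousLinearMap.comp_apply, hev]
    exact (ContinuousLinearMap.intervalIntegral_apply
      ((continuous_curveExtend _).intervalIntegrable _ _) v)
  refine ⟨α, ?_, ?_, ?_, ?_⟩
  · exact ev.contDiff.comp ((contDiff_superpose hX hX' hXX').comp
      (ContinuousLinearMap.contDiff (rayCurve (E := V))))
  · have : superpose X hX (rayCurve 0) = 0 := by ext t; simp [X]
    change ev (superpose X hX (rayCurve 0)) = 0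
    rw [this, map_zero]
  · intro u v
    rw [hfα]
    have h0 : curveApply (superpose X' hX' (rayCurve 0)) (rayCurve u) = 0 := by
      ext t; simp [hX'x, hβ0]
    rw [h0]
    simp [curveExtend]
  · intro x hx u v
    rw [hfα, hfα, ← intervalIntegral.integral_sub]
    rotate_left
    · exact ((continuous_curveExtend _).clm_apply continuous_const).intervalIntegrable _ _
    · exact ((continuous_curveExtend _).clm_apply continuous_const).intervalIntegrable _ _
    -- by closedness, the integrand is the derivative of `t² β(t x)(u, v)`
    have hderiv : ∀ t ∈ Set.uIcc (0 : ℝ) 1, HasDerivAt (fun t : ℝ => t ^ 2 * β (t • x) u v)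
        (curveExtend (curveApply (superpose X' hX' (rayCurve x)) (rayCurve u)) t v -
          curveExtend (curveApply (superpose X' hX' (rayCurve x)) (rayCurve v)) t u) t := by
      intro t ht
      rw [Set.uIcc_of_le zero_le_one] at ht
      have hmem : t • x ∈ Metric.ball (0 : V) r := by
        rw [mem_ball_zero_iff] at hx ⊢
        rw [norm_smul, Real.norm_of_nonneg ht.1]
        exact (mul_le_of_le_one_left (norm_nonneg _) ht.2).trans_lt hx
      have h1 : HasDerivAt (fun t : ℝ => β (t • x)) (fderiv ℝ β (t • x) x) t := by
        have h2 : HasDerivAt (fun t : ℝ => t • x) x t := by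
          simpa using (hasDerivAt_id t).smul_const x
        exact (hβd (t • x)).hasFDerivAt.comp_hasDerivAt t h2
      have h3 : HasDerivAt (fun t : ℝ => β (t • x) u v) (fderiv ℝ β (t • x) x u v) t := by
        have h4 := (h1.clm_apply (hasDerivAt_const t u)).clm_apply (hasDerivAt_const t v)
        simpa using h4
      have h5 := (hasDerivAt_pow 2 t).mul h3
      refine h5.congr_deriv ?_
      have e1 : ∀ w z : V, curveExtend (curveApply (superpose X' hX' (rayCurve x)) (rayCurve w)) t z
          = fderiv ℝ β (t • x) (t • w) (t • x) z + β (t • x) (t • w) z := by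
        intro w z
        have := curveExtend_coe (curveApply (superpose X' hX' (rayCurve x)) (rayCurve w)) ⟨t, ht⟩
        rw [this]
        simp [hX'x]
      rw [e1, e1]
      have e2 := hclosed _ hmem x u v
      simp only [map_smul, smul_apply, smul_eq_mul, halt (t • x) u v]
      have e3 : fderiv ℝ β (t • x) v u x = - fderiv ℝ β (t • x) v x u := by
        have h6 : (fun y => β y u x) = fun y => - β y x u := funext fun y => halt y x u
        have h7 : ∀ a b : V, HasFDerivAt (fun y => β y a b)
            (((ContinuousLinearMap.apply ℝ ℝ b).comp (ContinuousLinearMap.apply ℝ _ a)).comp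
              (fderiv ℝ β (t • x))) (t • x) := fun a b =>
          ((ContinuousLinearMap.apply ℝ ℝ b).comp (ContinuousLinearMap.apply ℝ _ a)).hasFDerivAt.comp
            (t • x) (hβd (t • x)).hasFDerivAt
        have h8 := h7 u x
        rw [h6] at h8
        exact congrArg (fun f : V →L[ℝ] ℝ => f v) (h8.unique (h7 x u).neg)
      push_cast
      linear_combination t ^ 2 * e2
    rw [intervalIntegral.integral_eq_sub_of_hasDerivAt hderiv]
    · simp
    · exact (((continuous_curveExtend _).clm_apply continuous_const).sub
        ((continuous_curveExtend _).clm_apply continuous_const)).intervalIntegrable _ _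

end Moser

/-! ### The isotopy of Moser's argument -/

section Moser

open unitInterval

variable {V : Type*} [NormedAddCommGroup V] [NormedSpace ℝ V]

/-- Moser's argument for a small closed perturbation `β` of a constant symplectic form `Ω₀`. The
vector field `X` with `(Ω₀ + t β)(X, ·) = -α`, `dα = β`, vanishes to second order at the origin, so
that its flow up to time one is given by the inverse function theorem on the space of curves. -/
theorem exists_moser_flow [CompleteSpace V] {Ω₀ : V →L[ℝ] V →L[ℝ] ℝ}
    {β : V → V →L[ℝ] V →L[ℝ] ℝ} (hΩ₀ : ∀ u v, Ω₀ v u = - Ω₀ u v) (hβ : ContDiff ℝ 1 β)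
    (halt : ∀ x u v, β x v u = - β x u v) (hβ0 : β 0 = 0) {r : ℝ} (hr : 0 < r)
    (hclosed : ∀ x ∈ Metric.ball (0 : V) r, ∀ u v w,
      fderiv ℝ β x u v w - fderiv ℝ β x v u w + fderiv ℝ β x w u v = 0)
    (hinv : ∀ t ∈ Set.Icc (0 : ℝ) 1, ∀ x, (Ω₀ + t • β x).IsInvertible) :
    ∃ φ : V → V, ContDiffAt ℝ 1 φ 0 ∧ φ 0 = 0 ∧ fderiv ℝ φ 0 = ContinuousLinearMap.id ℝ V ∧
      ∀ᶠ x in 𝓝 (0 : V), ∀ u v, (Ω₀ + β (φ x)) (fderiv ℝ φ x u) (fderiv ℝ φ x v) = Ω₀ u v := by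
  obtain ⟨α, hα, hα0, hα'0, hdα⟩ := exists_primitive_two_form hβ halt hβ0 hclosed
  have hβd : Differentiable ℝ β := hβ.differentiable one_ne_zero
  have hαd : Differentiable ℝ α := hα.differentiable one_ne_zero
  -- the vector field
  let Y : ℝ × V → V := fun p => - (Ω₀ + p.1 • β p.2).inverse (α p.2)
  have hY : ∀ (t : I) (x : V), ContDiffAt ℝ 1 Y (t, x) := by
    intro t x
    have h1 : ContDiffAt ℝ 1 (fun p : ℝ × V => (Ω₀ + p.1 • β p.2).inverse) (t, x) := by
      exact ContDiffAt.comp (g := ContinuousLinearMap.inverse) (f := fun p : ℝ × V =>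
        Ω₀ + p.1 • β p.2) _ (hinv t t.2 x).contDiffAt_map_inverse (by fun_prop)
    exact (h1.clm_apply (hα.comp contDiff_snd).contDiffAt).neg
  let X : I → V → V := fun t x => Y (t, x)
  let X' : I → V → V →L[ℝ] V := fun t x => fderiv ℝ Y (t, x) ∘L ContinuousLinearMap.inr ℝ ℝ V
  have hX : Continuous (Function.uncurry X) := by
    rw [continuous_iff_continuousAt]
    rintro ⟨t, x⟩
    exact ContinuousAt.comp (x := ((t, x) : I × V)) (f := fun p : I × V => ((p.1 : ℝ), p.2))
      (hY t x).continuousAt (by fun_prop)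
  have hX' : Continuous (Function.uncurry X') := by
    rw [continuous_iff_continuousAt]
    rintro ⟨t, x⟩
    have h1 : ContinuousAt (fderiv ℝ Y) (t, x) :=
      ((hY t x).fderiv_right (m := 0) le_rfl).continuousAt
    have h2 : ContinuousAt (fun p : I × V => fderiv ℝ Y ((p.1 : ℝ), p.2)) (t, x) :=
      ContinuousAt.comp (x := ((t, x) : I × V)) (f := fun p : I × V => ((p.1 : ℝ), p.2)) h1 (by fun_prop)
    exact h2.clm_comp continuousAt_const
  have hXX' : ∀ t x, HasFDerivAt (X t) (X' t x) x := by
    intro t x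
    exact ((hY t x).differentiableAt one_ne_zero).hasFDerivAt.comp x (hasFDerivAt_prodMk_right _ _)
  have hXeq : ∀ (t : I) x, (Ω₀ + (t : ℝ) • β x) (X t x) = - α x := by
    intro t x
    simp only [X, Y, map_neg]
    rw [(hinv t t.2 x).self_apply_inverse]
  have hX'eq : ∀ (t : I) x u v, (t : ℝ) * fderiv ℝ β x u (X t x) v +
      (Ω₀ + (t : ℝ) • β x) (X' t x u) v = - fderiv ℝ α x u v := by
    intro t x u v
    have h1 : HasFDerivAt (fun x => (Ω₀ + (t : ℝ) • β x) (X t x)) _ x :=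
      (((hβd x).hasFDerivAt.const_smul (t : ℝ)).const_add Ω₀).clm_apply (hXX' t x)
    simp_rw [hXeq] at h1
    have h2 := congrArg (fun f => f u v) (h1.unique (hαd x).hasFDerivAt.neg)
    simp only [add_apply, ContinuousLinearMap.comp_apply, ContinuousLinearMap.flip_apply,
      Pi.smul_apply, smul_apply, neg_apply, smul_eq_mul] at h2 ⊢
    linarith
  have hX0 : ∀ t, X t 0 = 0 := fun t => by simp [X, Y, hα0]
  have hX'0 : ∀ t, X' t 0 = 0 := by
    intro t
    ext u
    have h1 : (Ω₀ + (t : ℝ) • β 0) (X' t 0 u) = 0 := by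
      ext v
      have := hX'eq t 0 u v
      rw [hX0, hα'0] at this
      simpa using this
    have h2 := (hinv t t.2 0).inverse_apply_self (X' t 0 u)
    rw [h1, map_zero] at h2
    exact h2.symm
  -- the integral equation
  let G : C(I, V) → C(I, V) := fun γ => γ - primitive (superpose X hX γ)
  have hG : ContDiff ℝ 1 G := contDiff_id.sub
    ((ContinuousLinearMap.contDiff _).comp (contDiff_superpose hX hX' hXX'))
  have hG' : ∀ γ, HasFDerivAt G (ContinuousLinearMap.id ℝ _ -
      primitive ∘L curveApply (superpose X' hX' γ)) γ := fun γ =>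
    (hasFDerivAt_id γ).sub ((ContinuousLinearMap.hasFDerivAt _).comp γ
      (hasFDerivAt_superpose hX hX' hXX' γ))
  have hG0 : G 0 = 0 := by
    have : superpose X hX 0 = 0 := by ext t; simp [hX0]
    simp only [G, this, map_zero, sub_zero]
  have hG'0 : HasFDerivAt G ((ContinuousLinearEquiv.refl ℝ C(I, V) : C(I, V) →L[ℝ] C(I, V))) 0 := by
    have h1 := hG' 0
    have h2 : superpose X' hX' 0 = 0 := by ext t : 1; simp [hX'0]
    rw [h2] at h1
    simpa using! h1
  let Γ := hG.contDiffAt.localInverse hG'0 one_ne_zero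
  have hΓ : ContDiffAt ℝ 1 Γ 0 := by
    have := hG.contDiffAt.to_localInverse hG'0 one_ne_zero
    rwa [hG0] at this
  have hΓ0 : Γ 0 = 0 := by
    have := hG.contDiffAt.localInverse_apply_image hG'0 one_ne_zero
    rwa [hG0] at this
  have hGΓ : ∀ᶠ η in 𝓝 0, G (Γ η) = η := by
    have := (hG.contDiffAt.hasStrictFDerivAt' hG'0 one_ne_zero).eventually_right_inverse
    rwa [hG0] at this
  have hc0 : (constCurve (0 : V)) = 0 := map_zero _
  let Fl : V → C(I, V) := fun x => Γ (constCurve x)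
  have hFl : ContDiffAt ℝ 1 Fl 0 := by
    refine ContDiffAt.comp (0 : V) ?_ (ContinuousLinearMap.contDiff (constCurve (E := V))).contDiffAt
    rw [hc0]; exact hΓ
  have hFl0 : Fl 0 = 0 := by simp only [Fl, hc0, hΓ0]
  let ev : C(I, V) →L[ℝ] V := ContinuousMap.evalCLM ℝ (1 : I)
  have hev : ∀ f, ev f = f 1 := fun f => rfl
  -- the derivative of the flow solves the linearized integral equation
  have hlin : ∀ᶠ x in 𝓝 (0 : V), DifferentiableAt ℝ Fl x ∧ G (Fl x) = constCurve x ∧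
      (∀ t, Fl x t ∈ Metric.ball (0 : V) r) ∧ ∀ u, fderiv ℝ Fl x u -
        primitive (curveApply (superpose X' hX' (Fl x)) (fderiv ℝ Fl x u)) = constCurve u := by
    have e1 : ∀ᶠ x in 𝓝 (0 : V), DifferentiableAt ℝ Fl x :=
      (hFl.eventually (by simp)).mono fun x hx => hx.differentiableAt one_ne_zero
    have e2 : ∀ᶠ x in 𝓝 (0 : V), G (Fl x) = constCurve x := by
      have : Filter.Tendsto (constCurve (E := V)) (𝓝 0) (𝓝 0) := by
        have := (constCurve (E := V)).continuous.tendsto 0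
        rwa [hc0] at this
      exact this.eventually hGΓ
    have e3 : ∀ᶠ x in 𝓝 (0 : V), ∀ t, Fl x t ∈ Metric.ball (0 : V) r := by
      have := hFl.continuousAt.eventually (Metric.ball_mem_nhds _ hr)
      filter_upwards [this] with x hx t
      have hx' : ‖Fl x‖ < r := by simpa [hFl0] using hx
      rw [mem_ball_zero_iff]
      exact ((Fl x).norm_coe_le_norm t).trans_lt hx'
    filter_upwards [e1, e2.eventually_nhds, e3] with x h1 h2 h3
    refine ⟨h1, h2.self_of_nhds, h3, fun u => ?_⟩
    have h4 := (hG' (Fl x)).comp x h1.hasFDerivAt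
    have h5 : HasFDerivAt (constCurve (E := V)) constCurve x := ContinuousLinearMap.hasFDerivAt _
    exact congrArg (fun f => f u) (h4.unique (h5.congr_of_eventuallyEq h2))
  have hfl' : ∀ x, DifferentiableAt ℝ Fl x → fderiv ℝ (fun x => Fl x 1) x = ev ∘L fderiv ℝ Fl x :=
    fun x hx => (ev.hasFDerivAt.comp x hx.hasFDerivAt).fderiv
  refine ⟨fun x => Fl x 1, ev.contDiff.contDiffAt.comp (0 : V) hFl, by simp [hFl0], ?_, ?_⟩
  · obtain ⟨h1, -, -, h2⟩ := hlin.self_of_nhds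
    ext u
    have h3 := h2 u
    have h4 : superpose X' hX' (Fl 0) = 0 := by rw [hFl0]; ext t : 1; simp [hX'0]
    rw [h4] at h3
    simp only [map_zero, zero_apply, sub_zero] at h3
    rw [hfl' 0 h1]
    change (fderiv ℝ Fl 0 u) 1 = u
    rw [h3]; rfl
  · filter_upwards [hlin] with x hx u v
    obtain ⟨h1, h2, h3, h4⟩ := hx
    rw [hfl' x h1]
    set γ := Fl x with hγ
    set U := fderiv ℝ Fl x u with hU
    set W := fderiv ℝ Fl x v with hW
    change (Ω₀ + β (γ 1)) (U 1) (W 1) = Ω₀ u v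
    let γe : ℝ → V := fun t => x + ∫ s in (0 : ℝ)..t, curveExtend (superpose X hX γ) s
    let Ue : V → ℝ → V := fun u t => u + ∫ s in (0 : ℝ)..t,
      curveExtend (curveApply (superpose X' hX' γ) (fderiv ℝ Fl x u)) s
    have hγe : ∀ t : I, γe t = γ t := by
      intro t
      have := congrArg (fun f : C(I, V) => f t) (sub_eq_iff_eq_add.mp h2)
      exact this.symm
    have hUe : ∀ u (t : I), Ue u t = fderiv ℝ Fl x u t := by
      intro u t
      have := congrArg (fun f : C(I, V) => f t) (sub_eq_iff_eq_add.mp (h4 u))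
      exact this.symm
    have hγd : ∀ t : I, HasDerivAt γe (X t (γ t)) t := fun t =>
      (hasDerivAt_integral_curveExtend (superpose X hX γ) t).const_add x
    have hUd : ∀ u (t : I), HasDerivAt (Ue u) (X' t (γ t) (fderiv ℝ Fl x u t)) t := fun u t =>
      (hasDerivAt_integral_curveExtend _ t).const_add u
    -- the pulled back forms do not depend on time
    have hder : ∀ t : I, HasDerivAt (fun t : ℝ => (Ω₀ + t • β (γe t)) (Ue u t) (Ue v t)) 0 t := by
      intro t
      have d1 : HasDerivAt (fun t : ℝ => β (γe t)) (fderiv ℝ β (γ t) (X t (γ t))) t := by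
        have := (hβd (γe t)).hasFDerivAt.comp_hasDerivAt (t : ℝ) (hγd t)
        rwa [hγe] at this
      have d2 := (((hasDerivAt_id (t : ℝ)).smul d1).const_add Ω₀)
      have d3 := (d2.clm_apply (hUd u t)).clm_apply (hUd v t)
      refine d3.congr_deriv ?_
      simp only [id, Pi.smul_apply', hγe, hUe, one_smul, ← hU, ← hW]
      have c1 := hclosed _ (h3 t) (X t (γ t)) (U t) (W t)
      have c2 := hdα _ (h3 t) (U t) (W t)
      have c3 := hX'eq t (γ t) (U t) (W t)
      have c4 := hX'eq t (γ t) (W t) (U t)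
      have c5 : (Ω₀ + (t : ℝ) • β (γ t)) (U t) (X' t (γ t) (W t)) =
          - (Ω₀ + (t : ℝ) • β (γ t)) (X' t (γ t) (W t)) (U t) := by
        simp only [add_apply, smul_apply, smul_eq_mul]
        rw [hΩ₀ (U t), halt _ (U t)]; ring
      simp only [add_apply, smul_apply, smul_eq_mul] at *
      linear_combination (t : ℝ) * c1 - c2 + c3 - c4 + c5
    have hconst := constant_of_has_deriv_right_zero (a := (0 : ℝ)) (b := 1)
      (f := fun t : ℝ => (Ω₀ + t • β (γe t)) (Ue u t) (Ue v t))
      (fun t ht => (hder ⟨t, ht⟩).continuousAt.continuousWithinAt)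
      (fun t ht => (hder ⟨t, ht.1, ht.2.le⟩).hasDerivWithinAt) 1 ⟨zero_le_one, le_rfl⟩
    have g1 := hγe 1
    have g2 := hUe u 1
    have g3 := hUe v 1
    simp only [Set.Icc.coe_one] at g1 g2 g3
    simp only [g1, g2, g3, one_smul, zero_smul, add_zero] at hconst
    rw [hU, hW, hconst]
    simp [Ue]

end Moser

/-! ### Darboux's theorem in a vector space -/

section Moser

variable {V : Type*} [NormedAddCommGroup V] [NormedSpace ℝ V]

/-- Cut-off of a field of bilinear forms that vanishes at the origin: it becomes globally defined
and arbitrarily small, and is unchanged near the origin. -/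
theorem exists_small_cutoff [FiniteDimensional ℝ V] {W : Type*} [NormedAddCommGroup W]
    [NormedSpace ℝ W] {f : V → W} {R : ℝ} (hR : 0 < R) (hf : ContDiffOn ℝ 1 f (Metric.ball 0 R))
    (hf0 : f 0 = 0) {ε : ℝ} (hε : 0 < ε) : ∃ (g : V → W) (c : V → ℝ) (r : ℝ), 0 < r ∧ r ≤ R ∧
      ContDiff ℝ 1 g ∧ (∀ x, ‖g x‖ < ε) ∧ (∀ x, g x = c x • f x) ∧ (∀ x ∉ Metric.ball 0 R, c x = 0) ∧
      ∀ x ∈ Metric.ball (0 : V) r, g x = f x := by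
  have hcont : ContinuousAt f 0 :=
    (hf.continuousOn.continuousAt (Metric.ball_mem_nhds _ hR))
  obtain ⟨δ, hδ, hball⟩ := Metric.continuousAt_iff.mp hcont ε hε
  set ρ := min δ R / 2 with hρ
  have hρ0 : 0 < ρ := by positivity
  have hρδ : ρ < δ := by have := min_le_left δ R; have := lt_min hδ hR; linarith
  have hρR : ρ < R := by have := min_le_right δ R; have := lt_min hδ hR; linarith
  let χ : ContDiffBump (0 : V) := ⟨ρ / 2, ρ, by positivity, by linarith⟩
  have hχ0 : ∀ x ∉ Metric.ball (0 : V) ρ, χ x = 0 := fun x hx => by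
    rw [← Function.notMem_support, χ.support_eq]; exact hx
  refine ⟨fun x => χ x • f x, χ, ρ / 2, by positivity, by linarith, ?_, ?_, fun x => rfl, ?_, ?_⟩
  · rw [contDiff_iff_contDiffAt]
    intro x
    by_cases hx : x ∈ Metric.ball (0 : V) R
    · exact χ.contDiffAt.smul (hf.contDiffAt (Metric.isOpen_ball.mem_nhds hx))
    · have : (fun x => χ x • f x) =ᶠ[𝓝 x] fun _ => 0 := by
        have hx' : x ∈ (Metric.closedBall (0 : V) ρ)ᶜ := fun h =>
          hx (Metric.closedBall_subset_ball hρR h)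
        filter_upwards [Metric.isClosed_closedBall.isOpen_compl.mem_nhds hx'] with y hy
        rw [hχ0 y fun h => hy (Metric.ball_subset_closedBall h), zero_smul]
      exact contDiffAt_const.congr_of_eventuallyEq this
  · intro x
    by_cases hx : x ∈ Metric.ball (0 : V) ρ
    · have h1 : ‖f x‖ < ε := by
        have := hball (x := x) ((Metric.mem_ball.mp hx).trans hρδ)
        rwa [hf0, dist_zero_right] at this
      simp only
      rw [norm_smul, Real.norm_of_nonneg χ.nonneg]
      exact (mul_le_of_le_one_left (norm_nonneg _) χ.le_one).trans_lt h1
    · simp only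
      rw [hχ0 x hx, zero_smul, norm_zero]; exact hε
  · intro x hx
    exact hχ0 x fun h => hx (Metric.ball_subset_ball hρR.le h)
  · intro x hx
    simp only
    rw [χ.one_of_mem_closedBall (Metric.ball_subset_closedBall hx), one_smul]

/-- A local diffeomorphism of class `C¹` given by the inverse function theorem, with a prescribed
open condition on its source. -/
theorem exists_local_diffeo [CompleteSpace V] {φ : V → V} {x₀ : V} (hφ : ContDiffAt ℝ 1 φ x₀)
    {φ' : V ≃L[ℝ] V} (hφ' : fderiv ℝ φ x₀ = φ') {P : V → Prop} (hP : ∀ᶠ x in 𝓝 x₀, P x) :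
    ∃ e : OpenPartialHomeomorph V V, ⇑e = φ ∧ x₀ ∈ e.source ∧ (∀ x ∈ e.source, P x) ∧
      (∀ x ∈ e.source, ContDiffAt ℝ 1 e x) ∧ ∀ y ∈ e.target, ContDiffAt ℝ 1 e.symm y := by
  have hd : HasFDerivAt φ (φ' : V →L[ℝ] V) x₀ := by
    rw [← hφ']; exact (hφ.differentiableAt one_ne_zero).hasFDerivAt
  let e₀ := hφ.toOpenPartialHomeomorph φ hd one_ne_zero
  have he₀ : ⇑e₀ = φ := rfl
  have hinv : ∀ᶠ x in 𝓝 x₀, ∃ A : V ≃L[ℝ] V, (A : V →L[ℝ] V) = fderiv ℝ φ x := by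
    have h1 : ContinuousAt (fderiv ℝ φ) x₀ := (hφ.fderiv_right (m := 0) le_rfl).continuousAt
    have h2 := φ'.nhds
    rw [← hφ'] at h2
    exact h1.eventually h2
  have hall := (hP.and ((hφ.eventually (by simp)).and hinv))
  obtain ⟨O, hO, hOo, hxO⟩ := mem_nhds_iff.mp hall
  refine ⟨e₀.restrOpen O hOo, rfl, ⟨hφ.mem_toOpenPartialHomeomorph_source hd one_ne_zero, hxO⟩,
    fun x hx => (hO hx.2).1, fun x hx => (hO hx.2).2.1, ?_⟩
  intro y hy
  have hy' := (e₀.restrOpen O hOo).map_target hy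
  obtain ⟨A, hA⟩ := (hO hy'.2).2.2
  refine (e₀.restrOpen O hOo).contDiffAt_symm (f₀' := A) hy ?_ (hO hy'.2).2.1
  rw [hA]
  exact ((hO hy'.2).2.1.differentiableAt one_ne_zero).hasFDerivAt

theorem extDeriv_two_form_apply {a : V → V [⋀^Fin 2]→L[ℝ] ℝ} {x : V}
    (ha : DifferentiableAt ℝ a x) (u v w : V) :
    fderiv ℝ (fun y => altBilin (a y)) x u v w - fderiv ℝ (fun y => altBilin (a y)) x v u w +
      fderiv ℝ (fun y => altBilin (a y)) x w u v = extDeriv a x ![u, v, w] := by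
  have h1 : fderiv ℝ (fun y => altBilin (a y)) x = altBilin ∘L fderiv ℝ a x :=
    (altBilin.hasFDerivAt.comp x ha.hasFDerivAt).fderiv
  rw [h1, extDeriv, ContinuousAlternatingMap.alternatizeUncurryFin_apply, Fin.sum_univ_three]
  simp only [ContinuousLinearMap.comp_apply, altBilin_apply]
  have e0 : Fin.removeNth 0 ![u, v, w] = ![v, w] := by
    funext i; fin_cases i <;> rfl
  have e1 : Fin.removeNth 1 ![u, v, w] = ![u, w] := by
    funext i; fin_cases i <;> rfl
  have e2 : Fin.removeNth 2 ![u, v, w] = ![u, v] := by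
    funext i; fin_cases i <;> rfl
  rw [e0, e1, e2]
  simp
  ring

theorem contDiffOn_altBilin {a : V → V [⋀^Fin 2]→L[ℝ] ℝ} {s : Set V} (ha : ContDiffOn ℝ 1 a s) :
    ContDiffOn ℝ 1 (fun x => altBilin (a x)) s :=
  ha.continuousLinearMap_comp (altBilin (V := V))

theorem contDiffOn_sub_const {W : Type*} [NormedAddCommGroup W] [NormedSpace ℝ W] {f : V → W}
    {s : Set V} (hf : ContDiffOn ℝ 1 f s) (c : W) : ContDiffOn ℝ 1 (fun x => f x - c) s :=
  hf.sub contDiffOn_const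

/-- A nondegenerate form, as an isomorphism onto the dual space. -/
theorem exists_musical_equiv [FiniteDimensional ℝ V] {a : V [⋀^Fin 2]→L[ℝ] ℝ}
    (hnd : ∀ u, (∀ v, a ![u, v] = 0) → u = 0) :
    ∃ A : V ≃L[ℝ] (V →L[ℝ] ℝ), (A : V →L[ℝ] V →L[ℝ] ℝ) = altBilin a := by
  have hinj : Function.Injective (altBilin a : V →ₗ[ℝ] V →L[ℝ] ℝ) := by
    rw [injective_iff_map_eq_zero]
    intro u hu
    exact hnd u fun v => by
      rw [← altBilin_apply]
      exact congrArg (fun l : V →L[ℝ] ℝ => l v) hu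
  have hdim : Module.finrank ℝ V = Module.finrank ℝ (V →L[ℝ] ℝ) := by
    rw [← LinearEquiv.finrank_eq (LinearMap.toContinuousLinearMap (𝕜 := ℝ) (E := V) (F' := ℝ))]
    exact Subspace.dual_finrank_eq.symm
  let e := LinearEquiv.ofInjectiveOfFinrankEq (altBilin a : V →ₗ[ℝ] V →L[ℝ] ℝ) hinj hdim
  have he : ∀ u, e u = altBilin a u := fun u =>
    LinearMap.congr_fun (LinearEquiv.coe_ofInjectiveOfFinrankEq _ hinj hdim) u
  exact ⟨e.toContinuousLinearEquiv, ContinuousLinearMap.ext he⟩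

/-- Darboux's theorem in a vector space: near the origin, a symplectic form is the pull-back of its
value at the origin. -/
theorem exists_darboux [FiniteDimensional ℝ V] {a : V → V [⋀^Fin 2]→L[ℝ] ℝ} {R : ℝ} (hR : 0 < R)
    (ha : ContDiffOn ℝ 1 a (Metric.ball 0 R))
    (hclosed : ∀ x ∈ Metric.ball (0 : V) R, extDeriv a x = 0)
    (hnd : ∀ u, (∀ v, a 0 ![u, v] = 0) → u = 0) :
    ∃ e : OpenPartialHomeomorph V V, (0 : V) ∈ e.source ∧ e 0 = 0 ∧
      (∀ x ∈ e.source, e x ∈ Metric.ball (0 : V) R) ∧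
      (∀ x ∈ e.source, ContDiffAt ℝ 1 e x) ∧ (∀ y ∈ e.target, ContDiffAt ℝ 1 e.symm y) ∧
      ∀ x ∈ e.source, ∀ u v, a (e x) ![fderiv ℝ e x u, fderiv ℝ e x v] = a 0 ![u, v] := by
  obtain ⟨Ω₀, hΩ₀⟩ : ∃ Ω₀, Ω₀ = altBilin (a 0) := ⟨_, rfl⟩
  obtain ⟨Ωe, hΩe⟩ := exists_musical_equiv hnd
  obtain ⟨ε, hε, hεinv⟩ := Metric.mem_nhds_iff.mp Ωe.nhds
  rw [hΩe, ← hΩ₀] at hεinv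
  have hb : ContDiffOn ℝ 1 (fun x => altBilin (a x) - Ω₀) (Metric.ball 0 R) :=
    contDiffOn_sub_const (contDiffOn_altBilin ha) Ω₀
  obtain ⟨β, c, r, hr, hrR, hβ, hβε, hβc, hc0, hβeq⟩ :=
    exists_small_cutoff hR hb (by rw [hΩ₀, sub_self]) hε
  have hβ0 : β 0 = 0 := by rw [hβeq 0 (Metric.mem_ball_self hr), hΩ₀, sub_self]
  have hsk : ∀ (b : V [⋀^Fin 2]→L[ℝ] ℝ) u v, altBilin b v u = - altBilin b u v := fun b u v => by
    rw [altBilin_apply, altBilin_apply, alt_neg]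
  have halt : ∀ x u v, β x v u = - β x u v := fun x u v => by
    have e : ∀ u v, β x u v = c x * (altBilin (a x) u v - altBilin (a 0) u v) := fun u v => by
      rw [hβc x, hΩ₀]; rfl
    rw [e, e, hsk (a x), hsk (a 0)]; ring
  have hcl : ∀ x ∈ Metric.ball (0 : V) r, ∀ u v w,
      fderiv ℝ β x u v w - fderiv ℝ β x v u w + fderiv ℝ β x w u v = 0 := fun x hx u v w => by
    have hxR : x ∈ Metric.ball (0 : V) R := Metric.ball_subset_ball hrR hx
    have had : DifferentiableAt ℝ a x :=
      (ha.contDiffAt (Metric.isOpen_ball.mem_nhds hxR)).differentiableAt one_ne_zero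
    have h1 : fderiv ℝ β x = fderiv ℝ (fun y => altBilin (a y)) x := by
      have h2 : β =ᶠ[𝓝 x] fun y => altBilin (a y) - Ω₀ := by
        filter_upwards [Metric.isOpen_ball.mem_nhds hx] with y hy using hβeq y hy
      rw [h2.fderiv_eq, fderiv_sub_const]
    rw [h1, extDeriv_two_form_apply had, hclosed x hxR]; rfl
  have hin : ∀ t ∈ Set.Icc (0 : ℝ) 1, ∀ x, (Ω₀ + t • β x).IsInvertible := fun t ht x => by
    have : Ω₀ + t • β x ∈ Metric.ball Ω₀ ε := by
      rw [Metric.mem_ball, dist_eq_norm, add_sub_cancel_left, norm_smul, Real.norm_of_nonneg ht.1]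
      exact (mul_le_of_le_one_left (norm_nonneg _) ht.2).trans_lt (hβε x)
    obtain ⟨A, hA⟩ := hεinv this
    exact ⟨A, hA⟩
  obtain ⟨φ, hφ, hφ0, hφ', hφΩ⟩ :=
    exists_moser_flow (Ω₀ := Ω₀) (β := β) (hΩ₀ ▸ hsk (a 0)) hβ halt hβ0 hr hcl hin
  have hev : ∀ᶠ x in 𝓝 (0 : V), φ x ∈ Metric.ball (0 : V) r ∧
      ∀ u v, a (φ x) ![fderiv ℝ φ x u, fderiv ℝ φ x v] = a 0 ![u, v] := by
    have h1 := hφ.continuousAt.eventually (Metric.ball_mem_nhds (φ 0) hr)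
    rw [hφ0] at h1
    filter_upwards [h1, hφΩ] with x hx hx'
    refine ⟨hx, fun u v => ?_⟩
    rw [← altBilin_apply, ← altBilin_apply, ← hΩ₀, ← hx' u v, hβeq _ hx]
    simp
  obtain ⟨e, he, h0, hP, h1, h2⟩ := exists_local_diffeo hφ
    (φ' := ContinuousLinearEquiv.refl ℝ V) hφ' hev
  refine ⟨e, h0, by rw [he, hφ0], fun x hx => ?_, h1, h2, fun x hx u v => ?_⟩
  · rw [he]; exact Metric.ball_subset_ball hrR (hP x hx).1
  · rw [he]; exact (hP x hx).2 u v

end Moser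

/-! ### Darboux charts -/

section DarbouxChart

variable {E : Type*} [NormedAddCommGroup E] [NormedSpace ℝ E]
variable {M : Type*} [TopologicalSpace M] [ChartedSpace E M]

/-- A Darboux chart: a `C¹` chart with values in `ℝ^{2d}` in which the symplectic form is the
standard one. -/
structure IsDarbouxChart {d : ℕ} (Ω : TwoForm E M) (e : OpenPartialHomeomorph M (R2 d)) :
    Prop where
  contMDiffOn : ContMDiffOn 𝓘(ℝ, E) 𝓘(ℝ, R2 d) 1 e e.source
  contMDiffOn_symm : ContMDiffOn 𝓘(ℝ, R2 d) 𝓘(ℝ, E) 1 e.symm e.target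
  form : ∀ y ∈ e.target, ∀ u v : R2 d, Ω (e.symm y) ![mfderiv 𝓘(ℝ, R2 d) 𝓘(ℝ, E) e.symm y u,
    mfderiv 𝓘(ℝ, R2 d) 𝓘(ℝ, E) e.symm y v] = stdAlt d ![u, v]

theorem compCLM_pair {V W : Type*} [NormedAddCommGroup V] [NormedSpace ℝ V]
    [NormedAddCommGroup W] [NormedSpace ℝ W] (a : W [⋀^Fin 2]→L[ℝ] ℝ) (L : V →L[ℝ] W) (u v : V) :
    a.compContinuousLinearMap L ![u, v] = a ![L u, L v] := by
  rw [ContinuousAlternatingMap.compContinuousLinearMap_apply]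
  congr 1
  funext i
  fin_cases i <;> rfl

variable [FiniteDimensional ℝ E] [IsManifold 𝓘(ℝ, E) ∞ M]

/-- Darboux's theorem. -/
theorem exists_isDarbouxChart {d : ℕ} (hE : Module.finrank ℝ E = 2 * d) {Ω : TwoForm E M}
    (hΩ : IsSymplecticForm Ω) (x : M) :
    ∃ e : OpenPartialHomeomorph M (R2 d), IsDarbouxChart Ω e ∧ x ∈ e.source ∧ e x = 0 := by
  set c := chartAt E x with hc
  have hxc : x ∈ c.source := mem_chart_source E x
  have hcd := mdifferentiable_chart (I := 𝓘(ℝ, E)) x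
  set y₀ := c x with hy₀
  have hy₀t : y₀ ∈ c.target := c.map_source hxc
  obtain ⟨a, ha⟩ : ∃ a, a = Ω.inChart c := ⟨_, rfl⟩
  have haΩ : ∀ y u v, a y ![u, v] = Ω (c.symm y) ![mfderiv 𝓘(ℝ, E) 𝓘(ℝ, E) c.symm y u,
      mfderiv 𝓘(ℝ, E) 𝓘(ℝ, E) c.symm y v] := fun y u v => by
    rw [ha]
    exact compCLM_pair (V := E) (W := E) (Ω (c.symm y)) (mfderiv 𝓘(ℝ, E) 𝓘(ℝ, E) c.symm y) u v
  have has : ContDiffOn ℝ ∞ a c.target := by rw [ha]; exact hΩ.smooth c (chart_mem_atlas E x)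
  have hac : ∀ y ∈ c.target, extDeriv a y = 0 := by
    rw [ha]; exact hΩ.closed c (chart_mem_atlas E x)
  have hand : ∀ u, (∀ v, a y₀ ![u, v] = 0) → u = 0 := by
    intro u hu
    have h1 : mfderiv 𝓘(ℝ, E) 𝓘(ℝ, E) c.symm y₀ u = 0 := by
      refine hΩ.nondegenerate _ _ fun w => ?_
      have h2 := hcd.symm.comp_symm_deriv (x := c.symm y₀) (by
        rw [OpenPartialHomeomorph.symm_target]; exact c.map_target hy₀t)
      have h3 := hu (mfderiv 𝓘(ℝ, E) 𝓘(ℝ, E) c (c.symm y₀) w)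
      rw [OpenPartialHomeomorph.symm_symm, c.right_inv hy₀t] at h2
      have h4 := DFunLike.congr_fun h2 w
      refine Eq.trans ?_ ((haΩ y₀ u _).symm.trans h3)
      exact congrArg (fun z : E => Ω (c.symm y₀) ![mfderiv 𝓘(ℝ, E) 𝓘(ℝ, E) c.symm y₀ u, z]) h4.symm
    have h2 := hcd.symm.symm_comp_deriv (x := y₀) hy₀t
    have h4 := DFunLike.congr_fun h2 u
    rw [OpenPartialHomeomorph.symm_symm] at h4
    refine Eq.trans h4.symm ?_
    refine Eq.trans (congrArg (mfderiv 𝓘(ℝ, E) 𝓘(ℝ, E) c (c.symm y₀)) h1) (map_zero _)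
  obtain ⟨L, hL⟩ := exists_linear_normal_form hE hand
  -- the form in linear coordinates centred at `x`
  let τ : R2 d → E := fun y => y₀ + L y
  have hτd : ∀ y, HasFDerivAt τ (L : R2 d →L[ℝ] E) y := fun y => by
    simpa [τ] using (L.hasFDerivAt (x := y)).const_add y₀
  have hτf : ∀ y, fderiv ℝ τ y = (L : R2 d →L[ℝ] E) := fun y => (hτd y).fderiv
  have hτs : ∀ {n : WithTop ℕ∞}, ContDiff ℝ n τ := contDiff_const.add L.contDiff
  obtain ⟨R, hR, hball⟩ : ∃ R > 0, Metric.ball (0 : R2 d) R ⊆ τ ⁻¹' c.target :=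
    Metric.mem_nhds_iff.mp (hτs (n := 0) |>.continuous.continuousAt.preimage_mem_nhds
      (c.open_target.mem_nhds (by simpa [τ] using hy₀t)))
  let b : R2 d → R2 d [⋀^Fin 2]→L[ℝ] ℝ := fun y =>
    (a (τ y)).compContinuousLinearMap (L : R2 d →L[ℝ] E)
  have hbs : ContDiffOn ℝ 1 b (Metric.ball 0 R) := by
    have h1 : ContDiffOn ℝ 1 (fun y => a (τ y)) (Metric.ball 0 R) :=
      (has.of_le (by simp)).comp hτs.contDiffOn hball
    exact h1.continuousLinearMap_comp
      (ContinuousAlternatingMap.compContinuousLinearMapCLM (L : R2 d →L[ℝ] E))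
  have hbc : ∀ y ∈ Metric.ball (0 : R2 d) R, extDeriv b y = 0 := by
    intro y hy
    have h1 := extDeriv_pullback (r := 2) (f := τ) (x := y)
      ((has.contDiffAt (c.open_target.mem_nhds (hball hy))).differentiableAt (by simp))
      hτs.contDiffAt (by simp)
    simp only [hτf] at h1
    rw [h1, hac _ (hball hy)]
    ext; simp
  have hb0 : ∀ u v, b 0 ![u, v] = stdAlt d ![u, v] := fun u v => by
    rw [← hL u v, compCLM_pair]; simp [τ]
  obtain ⟨e₁, h0s, he0, heR, hed, hed', hform⟩ := exists_darboux hR hbs hbc fun u hu =>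
    stdAlt_nondeg u fun v => by rw [← hb0, hu]
  let T : OpenPartialHomeomorph (R2 d) E :=
    (L.toHomeomorph.trans (Homeomorph.addLeft y₀)).toOpenPartialHomeomorph
  have hT : ∀ y, T y = τ y := fun y => rfl
  have hTs : ∀ z, T.symm z = L.symm (-y₀ + z) := fun y => rfl
  let ψ := e₁.trans (T.trans c.symm)
  have hψ : ∀ y, ψ y = c.symm (τ (e₁ y)) := fun y => rfl
  have hψs : ∀ y ∈ ψ.source, y ∈ e₁.source := fun y hy => hy.1
  have hψτ : ∀ y ∈ e₁.source, τ (e₁ y) ∈ c.target := fun y hy => hball (heR y hy)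
  have hψ0 : ψ 0 = x := by
    rw [hψ, he0]; simp only [τ, map_zero, add_zero]; exact c.left_inv hxc
  have h0ψ : (0 : R2 d) ∈ ψ.source := by
    refine ⟨h0s, ?_, ?_⟩
    · trivial
    · exact hψτ 0 h0s
  refine ⟨ψ.symm, ⟨?_, ?_, ?_⟩, ?_, ?_⟩
  · intro z hz
    have hzt : z ∈ ψ.target := hz
    have h1 : z ∈ c.source := by
      have := ψ.map_target hzt
      rw [← ψ.right_inv hzt, hψ]
      exact c.map_target (hψτ _ this.1)
    have h2 : -y₀ + c z = L (e₁ (ψ.symm z)) := by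
      have h := ψ.right_inv hzt
      rw [hψ] at h
      have h' : c z = τ (e₁ (ψ.symm z)) := by
        conv_lhs => rw [← h, c.right_inv (hψτ _ (ψ.map_target hzt).1)]
      rw [h']
      simp [τ]
    have h3 : L.symm (-y₀ + c z) ∈ e₁.target := by
      rw [h2, L.symm_apply_apply]
      exact e₁.map_source (ψ.map_target hzt).1
    have h4 : ContMDiffAt 𝓘(ℝ, E) 𝓘(ℝ, R2 d) 1 (fun z => e₁.symm (L.symm (-y₀ + c z))) z := by
      have h5 : ContDiffAt ℝ 1 (fun w : E => e₁.symm (L.symm (-y₀ + w))) (c z) :=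
        ContDiffAt.comp (c z) (g := e₁.symm) (hed' _ h3) (by fun_prop)
      exact h5.contMDiffAt.comp z ((contMDiffOn_chart (I := 𝓘(ℝ, E)) (n := 1)
        (x := x)).contMDiffAt (c.open_source.mem_nhds h1))
    exact h4.contMDiffWithinAt
  · intro y hy
    have hy' : y ∈ e₁.source := hψs y hy
    have h4 : ContMDiffAt 𝓘(ℝ, R2 d) 𝓘(ℝ, E) 1 (fun y => c.symm (τ (e₁ y))) y := by
      have h5 : ContDiffAt ℝ 1 (fun y => τ (e₁ y)) y :=
        ContDiffAt.comp (g := τ) y hτs.contDiffAt (hed y hy')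
      exact ((contMDiffOn_chart_symm (I := 𝓘(ℝ, E)) (n := 1) (x := x)).contMDiffAt
          (c.open_target.mem_nhds (hψτ y hy'))).comp y h5.contMDiffAt
    exact h4.contMDiffWithinAt
  · intro y hy u v
    have hy' : y ∈ e₁.source := hψs y hy
    have h1 : HasMFDerivAt 𝓘(ℝ, R2 d) 𝓘(ℝ, E) (fun y => τ (e₁ y)) y
        ((L : R2 d →L[ℝ] E) ∘L fderiv ℝ e₁ y) :=
      ((hτd _).comp y ((hed y hy').differentiableAt one_ne_zero).hasFDerivAt).hasMFDerivAt
    have h2 := (hcd.symm.mdifferentiableAt (x := τ (e₁ y)) (hψτ y hy')).hasMFDerivAt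
    have h3 := h2.comp y h1
    have h4 : mfderiv 𝓘(ℝ, R2 d) 𝓘(ℝ, E) ψ.symm.symm y =
        (mfderiv 𝓘(ℝ, E) 𝓘(ℝ, E) c.symm (τ (e₁ y))).comp
        ((L : R2 d →L[ℝ] E) ∘L fderiv ℝ e₁ y) := h3.mfderiv
    rw [← hb0, ← hform y hy' u v, compCLM_pair, haΩ, h4]
    rfl
  · rw [OpenPartialHomeomorph.symm_source, ← hψ0]; exact ψ.map_source h0ψ
  · rw [← hψ0]; exact ψ.left_inv h0ψ

end DarbouxChart

/-! ### Extension of germs of symplectic maps -/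

section GermExtension

variable {V : Type*} [NormedAddCommGroup V] [NormedSpace ℝ V]

theorem exists_equiv_of_norm_sub_id_lt [CompleteSpace V] {T : V →L[ℝ] V}
    (hT : ‖T - ContinuousLinearMap.id ℝ V‖ < 1) : ∃ A : V ≃L[ℝ] V, (A : V →L[ℝ] V) = T := by
  let u := Units.oneSub (ContinuousLinearMap.id ℝ V - T) (by rwa [norm_sub_rev])
  refine ⟨ContinuousLinearEquiv.ofUnit u, ?_⟩
  ext v
  change (1 - (ContinuousLinearMap.id ℝ V - T)) v = T v
  simp

/-- A `C¹` perturbation of the identity with small derivative is a diffeomorphism. -/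
theorem exists_homeomorph_id_add [CompleteSpace V] {g : V → V} (hg : ContDiff ℝ 1 g)
    (hg' : ∀ x, ‖fderiv ℝ g x‖ ≤ 1 / 2) :
    ∃ F : V ≃ₜ V, (∀ x, F x = x + g x) ∧ ContDiff ℝ 1 F ∧ ContDiff ℝ 1 F.symm := by
  have hgd : Differentiable ℝ g := hg.differentiable one_ne_zero
  have happ : ApproximatesLinearOn (fun x => x + g x)
      ((ContinuousLinearEquiv.refl ℝ V : V ≃L[ℝ] V) : V →L[ℝ] V) Set.univ (1 / 2) := by
    intro x _ y _
    have h1 := Convex.norm_image_sub_le_of_norm_fderiv_le (fun z _ => hgd z) (fun z _ => hg' z)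
      convex_univ (Set.mem_univ y) (Set.mem_univ x)
    have h2 : x + g x - (y + g y) - ((ContinuousLinearEquiv.refl ℝ V : V ≃L[ℝ] V) : V →L[ℝ] V)
        (x - y) = g x - g y := by
      simp only [ContinuousLinearEquiv.coe_refl, ContinuousLinearMap.id_apply]
      abel
    rw [h2]
    simpa using h1
  have hc : Subsingleton V ∨ (1 / 2 : NNReal) <
      ‖((ContinuousLinearEquiv.refl ℝ V).symm : V →L[ℝ] V)‖₊⁻¹ := by
    rcases subsingleton_or_nontrivial V with h | h
    · exact Or.inl h
    · right
      have h1 : ‖((ContinuousLinearEquiv.refl ℝ V).symm : V →L[ℝ] V)‖₊ = 1 := by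
        ext
        simp
      rw [h1, inv_one, ← NNReal.coe_lt_coe]
      norm_num
  have hder : ∀ x, ∃ A : V ≃L[ℝ] V, HasFDerivAt (fun x => x + g x) (A : V →L[ℝ] V) x := by
    intro x
    obtain ⟨A, hA⟩ := exists_equiv_of_norm_sub_id_lt
      (T := ContinuousLinearMap.id ℝ V + fderiv ℝ g x) (by
        rw [add_sub_cancel_left]; linarith [hg' x])
    exact ⟨A, by rw [hA]; exact (hasFDerivAt_id x).add (hgd x).hasFDerivAt⟩
  choose A hA using hder
  have hs : ContDiff ℝ 1 (fun x => x + g x) := contDiff_id.add hg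
  exact ⟨happ.toHomeomorph _ hc, fun x => rfl, hs,
    (happ.toHomeomorph _ hc).contDiff_symm (f₀' := A) hA hs⟩

/-- The Cayley transform of a vector field whose differential is infinitesimally symplectic: it is
a symplectic diffeomorphism. -/
theorem exists_cayley_transform [CompleteSpace V] {b : V →L[ℝ] V →L[ℝ] ℝ}
    (hb : ∀ u v, b v u = - b u v) {Y : V → V} (hY : ContDiff ℝ 1 Y) {κ : ℝ} (hκ : κ ≤ 1)
    (hY' : ∀ x, ‖fderiv ℝ Y x‖ ≤ κ)
    (hsym : ∀ x u v, b (fderiv ℝ Y x u) v = b (fderiv ℝ Y x v) u) :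
    ∃ h : V ≃ₜ V, ContDiff ℝ 1 h ∧ ContDiff ℝ 1 h.symm ∧
      (∀ x u v, b (fderiv ℝ h x u) (fderiv ℝ h x v) = b u v) ∧
      (∀ z, h (z - (1 / 2 : ℝ) • Y z) = z + (1 / 2 : ℝ) • Y z) ∧
      ∀ x, ‖fderiv ℝ h x - ContinuousLinearMap.id ℝ V‖ ≤ 2 * κ := by
  have hYd : Differentiable ℝ Y := hY.differentiable one_ne_zero
  have hfd : ∀ (c : ℝ) x, fderiv ℝ (fun z => c • Y z) x = c • fderiv ℝ Y x := fun c x =>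
    ((hYd x).hasFDerivAt.const_smul c).fderiv
  obtain ⟨F, hF, hFs, hFs'⟩ := exists_homeomorph_id_add (g := fun z => (-(1 / 2) : ℝ) • Y z)
    (hY.const_smul _) (fun x => by
      rw [hfd, norm_smul]; have := hY' x; norm_num; linarith)
  obtain ⟨G, hG, hGs, hGs'⟩ := exists_homeomorph_id_add (g := fun z => (1 / 2 : ℝ) • Y z)
    (hY.const_smul _) (fun x => by
      rw [hfd, norm_smul]; have := hY' x; norm_num; linarith)
  have hFd : ∀ x, HasFDerivAt F (ContinuousLinearMap.id ℝ V + (-(1 / 2) : ℝ) • fderiv ℝ Y x) x := by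
    intro x
    rw [show (F : V → V) = fun x => x + (-(1 / 2) : ℝ) • Y x from funext hF]
    exact (hasFDerivAt_id x).add ((hYd x).hasFDerivAt.const_smul _)
  have hGd : ∀ x, HasFDerivAt G (ContinuousLinearMap.id ℝ V + (1 / 2 : ℝ) • fderiv ℝ Y x) x := by
    intro x
    rw [show (G : V → V) = fun x => x + (1 / 2 : ℝ) • Y x from funext hG]
    exact (hasFDerivAt_id x).add ((hYd x).hasFDerivAt.const_smul _)
  have key : ∀ z, ∃ T : V →L[ℝ] V, ‖T‖ ≤ κ / 2 ∧ (∀ u v, b (T u) v = b (T v) u) ∧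
      (∀ a, fderiv ℝ (F.symm.trans G) (F z) (a - T a) = a + T a) ∧ ∀ w, ∃ a, w = a - T a := by
    intro z
    obtain ⟨T, hT⟩ : ∃ T, T = (1 / 2 : ℝ) • fderiv ℝ Y z := ⟨_, rfl⟩
    have hP : HasFDerivAt F.symm (fderiv ℝ F.symm (F z)) (F z) :=
      ((hFs'.differentiable one_ne_zero) (F z)).hasFDerivAt
    have hQ : HasFDerivAt F (ContinuousLinearMap.id ℝ V - T) z := by
      convert hFd z using 1
      rw [hT, neg_smul, sub_eq_add_neg]
    have hQ' : HasFDerivAt F (ContinuousLinearMap.id ℝ V - T) (F.symm (F z)) := by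
      rwa [F.symm_apply_apply]
    have hG' : HasFDerivAt G (ContinuousLinearMap.id ℝ V + T) (F.symm (F z)) := by
      rw [F.symm_apply_apply, hT]; exact hGd z
    have h1 : HasFDerivAt (F.symm ∘ F) _ z := hP.comp z hQ
    have h2 : HasFDerivAt (F ∘ F.symm) _ (F z) := hQ'.comp (F z) hP
    have h3 : HasFDerivAt (F.symm.trans G) _ (F z) := hG'.comp (F z) hP
    rw [show F.symm ∘ F = id from funext F.symm_apply_apply] at h1
    rw [show F ∘ F.symm = id from funext F.apply_symm_apply] at h2
    have h1' := h1.unique (hasFDerivAt_id z)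
    have h2' := h2.unique (hasFDerivAt_id (F z))
    refine ⟨T, ?_, ?_, ?_, ?_⟩
    · rw [hT, norm_smul]; have := hY' z; norm_num; linarith
    · intro u v; simp [hT, hsym z u v]
    · intro a
      have h4 := DFunLike.congr_fun h1' a
      simp only [ContinuousLinearMap.comp_apply, sub_apply, ContinuousLinearMap.id_apply] at h4
      rw [h3.fderiv, ContinuousLinearMap.comp_apply, h4]
      simp
    · intro w
      refine ⟨fderiv ℝ F.symm (F z) w, ?_⟩
      have h4 := DFunLike.congr_fun h2' w
      simp only [ContinuousLinearMap.comp_apply, sub_apply, ContinuousLinearMap.id_apply] at h4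
      exact h4.symm
  have hFz : ∀ z, F z = z - (1 / 2 : ℝ) • Y z := fun z => by rw [hF, neg_smul, sub_eq_add_neg]
  refine ⟨F.symm.trans G, hGs.comp hFs', hFs.comp hGs', ?_, ?_, ?_⟩
  · intro x
    obtain ⟨z, rfl⟩ := F.surjective x
    obtain ⟨T, -, hTs, hTd, hTw⟩ := key z
    intro u v
    obtain ⟨a, rfl⟩ := hTw u
    obtain ⟨c, rfl⟩ := hTw v
    rw [hTd, hTd]
    simp only [map_add, map_sub, add_apply, sub_apply]
    have h1 := hTs a c
    have h2 := hb (T c) a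
    linarith
  · intro z
    rw [← hFz, Homeomorph.trans_apply, F.symm_apply_apply, hG]
  · intro x
    obtain ⟨z, rfl⟩ := F.surjective x
    obtain ⟨T, hTn, hTs, hTd, hTw⟩ := key z
    have hκ0 : 0 ≤ κ := (norm_nonneg _).trans (hY' z)
    refine ContinuousLinearMap.opNorm_le_bound _ (by linarith) fun w => ?_
    obtain ⟨a, rfl⟩ := hTw w
    rw [sub_apply, hTd, ContinuousLinearMap.id_apply]
    have h1 : ‖T a‖ ≤ κ / 2 * ‖a‖ := (T.le_opNorm a).trans (by gcongr)
    have h2 : ‖a‖ ≤ ‖a - T a‖ + ‖T a‖ := by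
      simpa using norm_add_le (a - T a) (T a)
    have h3 : a + T a - (a - T a) = (2 : ℝ) • T a := by rw [two_smul]; abel
    rw [h3, norm_smul, Real.norm_of_nonneg zero_le_two]
    have h4 : κ / 2 * ‖a‖ ≤ 1 / 2 * ‖a‖ := by gcongr
    have h5 : κ * ‖a‖ ≤ κ * (2 * ‖a - T a‖) := mul_le_mul_of_nonneg_left (by linarith) hκ0
    linarith

/-- Cut-off of a closed 1-form that vanishes at the origin, among closed 1-forms. The size of the
differential grows at most by a constant factor, whatever the size of the support. -/
theorem exists_closed_cutoff (V : Type*) [NormedAddCommGroup V] [NormedSpace ℝ V]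
    [FiniteDimensional ℝ V] :
    ∃ C : ℝ, 0 < C ∧ ∀ (η : V → V →L[ℝ] ℝ) (r κ : ℝ), 0 < r → ContDiffOn ℝ 1 η (Metric.ball 0 r) →
      η 0 = 0 → (∀ z ∈ Metric.ball (0 : V) r, ∀ u v, fderiv ℝ η z u v = fderiv ℝ η z v u) →
      (∀ z ∈ Metric.ball (0 : V) r, ‖fderiv ℝ η z‖ ≤ κ) →
      ∃ θ : V → V →L[ℝ] ℝ, ContDiff ℝ 1 θ ∧ (∀ z u v, fderiv ℝ θ z u v = fderiv ℝ θ z v u) ∧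
        (∀ z ∉ Metric.ball (0 : V) r, θ z = 0) ∧ (∀ᶠ z in 𝓝 0, θ z = η z) ∧
        ∀ z, ‖fderiv ℝ θ z‖ ≤ C * κ := by
  let χ : ContDiffBump (0 : V) := ⟨1 / 2, 1, by norm_num, by norm_num⟩
  have hχs : ContDiff ℝ ∞ χ := χ.contDiff
  have hχ1s : ContDiff ℝ ∞ (fderiv ℝ χ) := hχs.fderiv_right (by simp)
  have hχc : HasCompactSupport χ := χ.hasCompactSupport
  obtain ⟨C₁, hC₁⟩ := (hχc.fderiv ℝ).exists_bound_of_continuous hχ1s.continuous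
  obtain ⟨C₂, hC₂⟩ := ((hχc.fderiv ℝ).fderiv ℝ).exists_bound_of_continuous
    (hχ1s.fderiv_right (m := 0) (by simp)).continuous
  have hC₁0 : 0 ≤ C₁ := (norm_nonneg _).trans (hC₁ 0)
  have hC₂0 : 0 ≤ C₂ := (norm_nonneg _).trans (hC₂ 0)
  refine ⟨1 + 2 * C₁ + C₂, by positivity, ?_⟩
  intro η r κ hr hη hη0 hsym hκ
  set B := Metric.ball (0 : V) r with hB
  have hηd : ∀ z ∈ B, DifferentiableAt ℝ η z := fun z hz =>
    (hη.contDiffAt (Metric.isOpen_ball.mem_nhds hz)).differentiableAt one_ne_zero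
  have hκ0 : 0 ≤ κ := (norm_nonneg _).trans (hκ 0 (Metric.mem_ball_self hr))
  obtain ⟨s₀, hs₀⟩ := (convex_ball (0 : V) r).exists_forall_hasFDerivAt_of_fderiv_symmetric
    Metric.isOpen_ball (hη.differentiableOn one_ne_zero) hsym
  obtain ⟨s, hs, hs00⟩ : ∃ s : V → ℝ, (∀ z ∈ B, HasFDerivAt s (η z) z) ∧ s 0 = 0 :=
    ⟨fun z => s₀ z - s₀ 0, fun z hz => (hs₀ z hz).sub_const _, sub_self _⟩
  have hηn : ∀ z ∈ B, ‖η z‖ ≤ κ * ‖z‖ := fun z hz => by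
    simpa [hη0] using (convex_ball (0 : V) r).norm_image_sub_le_of_norm_fderiv_le hηd hκ
      (Metric.mem_ball_self hr) hz
  have hsn : ∀ z ∈ B, |s z| ≤ κ * ‖z‖ * ‖z‖ := fun z hz => by
    have hz' : ‖z‖ < r := by simpa [hB] using hz
    have hsub : Metric.closedBall (0 : V) ‖z‖ ⊆ B := Metric.closedBall_subset_ball hz'
    have := (convex_closedBall (0 : V) ‖z‖).norm_image_sub_le_of_norm_hasFDerivWithin_le
      (f := s) (f' := η) (C := κ * ‖z‖) (fun y hy => (hs y (hsub hy)).hasFDerivWithinAt)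
      (fun y hy => (hηn y (hsub hy)).trans (by
        have : ‖y‖ ≤ ‖z‖ := by simpa using hy
        gcongr))
      (x := 0) (y := z) (by simp) (by simp)
    simpa [hs00] using this
  -- the cut-off function `ρ z = χ (ε⁻¹ z)` and its derivatives
  set ε := r / 2 with hε
  have hε0 : 0 < ε := by positivity
  let ρ : V → ℝ := fun z => χ (ε⁻¹ • z)
  let ρ₁ : V → V →L[ℝ] ℝ := fun z => ε⁻¹ • fderiv ℝ χ (ε⁻¹ • z)
  let ρ₂ : V → V →L[ℝ] V →L[ℝ] ℝ := fun z =>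
    ε⁻¹ • ε⁻¹ • fderiv ℝ (fderiv ℝ χ) (ε⁻¹ • z)
  have hscale : ∀ z : V, HasFDerivAt (fun z : V => ε⁻¹ • z) (ε⁻¹ • ContinuousLinearMap.id ℝ V) z :=
    fun z => (hasFDerivAt_id z).const_smul ε⁻¹
  have hρ : ∀ z, HasFDerivAt ρ (ρ₁ z) z := fun z => by
    have := ((hχs.differentiable (by simp)) (ε⁻¹ • z)).hasFDerivAt.comp z (hscale z)
    refine this.congr_fderiv ?_
    ext v; simp [ρ₁]
  have hρ₁ : ∀ z, HasFDerivAt ρ₁ (ρ₂ z) z := fun z => by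
    have := (((hχ1s.differentiable (by simp)) (ε⁻¹ • z)).hasFDerivAt.comp z
      (hscale z)).const_smul ε⁻¹
    refine this.congr_fderiv ?_
    ext v w; simp [ρ₂]
  have hρs : ContDiff ℝ 1 ρ := (hχs.of_le (by simp)).comp (contDiff_const_smul ε⁻¹)
  have hρ₁s : ContDiff ℝ 1 ρ₁ :=
    ((hχ1s.of_le (by simp)).comp (contDiff_const_smul ε⁻¹)).const_smul ε⁻¹
  have hρ₂s : ∀ z u v, ρ₂ z u v = ρ₂ z v u := fun z u v => by
    have := (hχs.contDiffAt (x := ε⁻¹ • z)).isSymmSndFDerivAt (by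
      rw [minSmoothness_of_isRCLikeNormedField]
      exact WithTop.coe_le_coe.2 (le_top : (2 : ℕ∞) ≤ ⊤))
    simp only [ρ₂, smul_apply, this.eq u v]
  have hρout : ∀ z ∉ Metric.closedBall (0 : V) ε, ρ =ᶠ[𝓝 z] fun _ => 0 := by
    intro z hz
    filter_upwards [Metric.isClosed_closedBall.isOpen_compl.mem_nhds hz] with y hy
    have : ε⁻¹ • y ∉ Function.support χ := by
      rw [χ.support_eq]
      intro h
      apply hy
      have h' : ε⁻¹ * ‖y‖ < 1 := by
        simpa [norm_smul, abs_of_pos hε0] using h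
      rw [inv_mul_lt_iff₀ hε0, mul_one] at h'
      simpa using h'.le
    simpa [ρ] using this
  have hρ1out : ∀ z ∉ Metric.closedBall (0 : V) ε, ρ₁ =ᶠ[𝓝 z] fun _ => 0 := by
    intro z hz
    filter_upwards [(hρout z hz).eventuallyEq_nhds] with y hy
    rw [← (hρ y).fderiv, hy.fderiv_eq]; simp
  have hin : ∀ z ∈ Metric.closedBall (0 : V) ε, z ∈ B := fun z hz =>
    Metric.closedBall_subset_ball (by linarith) hz
  let θ : V → V →L[ℝ] ℝ := fun z => ρ z • η z + s z • ρ₁ z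
  have hθ0 : ∀ z ∉ Metric.closedBall (0 : V) ε, θ =ᶠ[𝓝 z] fun _ => 0 := by
    intro z hz
    filter_upwards [hρout z hz, hρ1out z hz] with y hy hy'
    simp only [θ, hy, hy', zero_smul, smul_zero, add_zero]
  have hθd : ∀ z ∈ B, HasFDerivAt θ (ρ z • fderiv ℝ η z + (ρ₁ z).smulRight (η z) +
      (s z • ρ₂ z + (η z).smulRight (ρ₁ z))) z := fun z hz =>
    ((hρ z).smul (hηd z hz).hasFDerivAt).add ((hs z hz).smul (hρ₁ z))
  refine ⟨θ, ?_, ?_, ?_, ?_, ?_⟩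
  · rw [contDiff_iff_contDiffAt]
    intro z
    by_cases hz : z ∈ Metric.closedBall (0 : V) ε
    · have hB' : B ∈ 𝓝 z := Metric.isOpen_ball.mem_nhds (hin z hz)
      have h1 : ContDiffAt ℝ 1 η z := hη.contDiffAt hB'
      have h2 : ContDiffAt ℝ 1 s z :=
        contDiffAt_one_iff.mpr ⟨η, B, hB', hη.continuousOn, hs⟩
      exact (hρs.contDiffAt.smul h1).add (h2.smul hρ₁s.contDiffAt)
    · exact contDiffAt_const.congr_of_eventuallyEq (hθ0 z hz)
  · intro z u v
    by_cases hz : z ∈ Metric.closedBall (0 : V) ε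
    · rw [(hθd z (hin z hz)).fderiv]
      simp only [add_apply, smul_apply, ContinuousLinearMap.smulRight_apply, smul_eq_mul]
      rw [hsym z (hin z hz) u v, hρ₂s z u v]
      ring
    · rw [(hθ0 z hz).fderiv_eq]; simp
  · intro z hz
    exact (hθ0 z fun h => hz (hin z h)).eq_of_nhds
  · have h1 : ρ =ᶠ[𝓝 0] fun _ => 1 := by
      filter_upwards [Metric.closedBall_mem_nhds (0 : V) (half_pos hε0)] with z hz
      apply χ.one_of_mem_closedBall
      have hz' : ‖z‖ ≤ ε / 2 := by simpa using hz
      rw [mem_closedBall_zero_iff, norm_smul, norm_inv, Real.norm_of_nonneg hε0.le,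
        inv_mul_le_iff₀ hε0]
      change _ ≤ ε * (1 / 2)
      linarith
    filter_upwards [h1.eventuallyEq_nhds] with z hz
    have h2 : ρ₁ z = 0 := by rw [← (hρ z).fderiv, hz.fderiv_eq]; simp
    simp only [θ, h2, hz.eq_of_nhds, one_smul, smul_zero, add_zero]
  · intro z
    by_cases hz : z ∈ Metric.closedBall (0 : V) ε
    · have hzε : ‖z‖ ≤ ε := by simpa using hz
      have hρn : ‖ρ z‖ ≤ 1 := by
        rw [Real.norm_of_nonneg χ.nonneg]; exact χ.le_one
      have hρ₁n : ‖ρ₁ z‖ ≤ ε⁻¹ * C₁ := by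
        rw [norm_smul, norm_inv, Real.norm_of_nonneg hε0.le]
        gcongr
        exact hC₁ _
      have hρ₂n : ‖ρ₂ z‖ ≤ ε⁻¹ * (ε⁻¹ * C₂) := by
        rw [norm_smul, norm_smul, norm_inv, Real.norm_of_nonneg hε0.le]
        gcongr
        exact hC₂ _
      have hηε : ‖η z‖ ≤ κ * ε := (hηn z (hin z hz)).trans (by gcongr)
      have hsε : ‖s z‖ ≤ κ * ε * ε := (hsn z (hin z hz)).trans (by gcongr)
      rw [(hθd z (hin z hz)).fderiv]
      have n1 : ‖ρ z • fderiv ℝ η z‖ ≤ 1 * κ := by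
        rw [norm_smul]; exact mul_le_mul hρn (hκ z (hin z hz)) (norm_nonneg _) zero_le_one
      have n2 : ‖(ρ₁ z).smulRight (η z)‖ ≤ ε⁻¹ * C₁ * (κ * ε) := by
        rw [ContinuousLinearMap.norm_smulRight_apply]
        exact mul_le_mul hρ₁n hηε (norm_nonneg _) (by positivity)
      have n3 : ‖s z • ρ₂ z‖ ≤ κ * ε * ε * (ε⁻¹ * (ε⁻¹ * C₂)) := by
        rw [norm_smul]; exact mul_le_mul hsε hρ₂n (norm_nonneg _) (by positivity)
      have n4 : ‖(η z).smulRight (ρ₁ z)‖ ≤ κ * ε * (ε⁻¹ * C₁) := by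
        rw [ContinuousLinearMap.norm_smulRight_apply]
        exact mul_le_mul hηε hρ₁n (norm_nonneg _) (by positivity)
      have e2 : ε⁻¹ * C₁ * (κ * ε) = C₁ * κ := by field_simp
      have e3 : κ * ε * ε * (ε⁻¹ * (ε⁻¹ * C₂)) = C₂ * κ := by field_simp
      have e4 : κ * ε * (ε⁻¹ * C₁) = C₁ * κ := by field_simp
      rw [e2] at n2
      rw [e3] at n3
      rw [e4] at n4
      calc _ ≤ _ := norm_add_le _ _
        _ ≤ 1 * κ + C₁ * κ + (C₂ * κ + C₁ * κ) :=
          add_le_add ((norm_add_le _ _).trans (add_le_add n1 n2))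
            ((norm_add_le _ _).trans (add_le_add n3 n4))
        _ = _ := by ring
    · rw [(hθ0 z hz).fderiv_eq]
      simp only [fderiv_fun_const, Pi.zero_apply, norm_zero]
      positivity

/-- A germ of symplectic map fixing the origin, with differential close to the identity, is the
germ of a symplectic diffeomorphism supported in an arbitrarily small ball and `C¹`-close to the
identity. The displacement `H x - x`, read at the midpoint `(x + H x) / 2`, is dual to a closed
1-form, to which the cut-off applies. -/
theorem exists_symplectic_extension [FiniteDimensional ℝ V] {b : V →L[ℝ] V →L[ℝ] ℝ}
    (hb : ∀ u v, b v u = - b u v) (A : V ≃L[ℝ] (V →L[ℝ] ℝ)) (hA : ∀ u, A u = b u) {η : ℝ}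
    (hη : 0 < η) : ∃ δ > 0, ∀ H : V → V, ContDiffAt ℝ 1 H 0 → H 0 = 0 →
      (∀ᶠ x in 𝓝 0, ∀ u v, b (fderiv ℝ H x u) (fderiv ℝ H x v) = b u v) →
      ‖fderiv ℝ H 0 - ContinuousLinearMap.id ℝ V‖ < δ → ∀ r > 0, ∃ h : V ≃ₜ V,
        ContDiff ℝ 1 h ∧ ContDiff ℝ 1 h.symm ∧
        (∀ x u v, b (fderiv ℝ h x u) (fderiv ℝ h x v) = b u v) ∧
        (∀ x ∉ Metric.ball 0 r, h x = x) ∧ (∀ᶠ x in 𝓝 0, h x = H x) ∧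
        ∀ x, ‖fderiv ℝ h x - ContinuousLinearMap.id ℝ V‖ < η := by
  obtain ⟨C, hC, hcut⟩ := exists_closed_cutoff V
  set K := ‖(A.symm : (V →L[ℝ] ℝ) →L[ℝ] V)‖ + 1 with hK
  have hK0 : 0 < K := by positivity
  set κ := min 1 (η / 4) / (K * C) with hκ
  have hκ0 : 0 < κ := div_pos (lt_min one_pos (by positivity)) (by positivity)
  refine ⟨min (1 / 2) (κ / (4 * (‖b‖ + 1))), lt_min (by norm_num) (by positivity), ?_⟩
  intro H hH hH0 hHb hHδ r hr
  obtain ⟨m, hm⟩ : ∃ m : V → V, m = fun x => (1 / 2 : ℝ) • (x + H x) := ⟨_, rfl⟩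
  have hmd : ∀ x, DifferentiableAt ℝ H x → HasFDerivAt m
      ((1 / 2 : ℝ) • (ContinuousLinearMap.id ℝ V + fderiv ℝ H x)) x := fun x hx => by
    rw [hm]; exact ((hasFDerivAt_id x).add hx.hasFDerivAt).const_smul (1 / 2 : ℝ)
  have hms : ContDiffAt ℝ 1 m 0 := by rw [hm]; exact (contDiffAt_id.add hH).const_smul (1 / 2 : ℝ)
  have hm0 : m 0 = 0 := by simp [hm, hH0]
  have hHδ2 : ‖fderiv ℝ H 0 - ContinuousLinearMap.id ℝ V‖ < 1 / 2 :=
    hHδ.trans_le (min_le_left _ _)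
  obtain ⟨φ', hφ'⟩ := exists_equiv_of_norm_sub_id_lt (T := fderiv ℝ m 0) (by
    rw [(hmd 0 (hH.differentiableAt one_ne_zero)).fderiv]
    have : (1 / 2 : ℝ) • (ContinuousLinearMap.id ℝ V + fderiv ℝ H 0) - ContinuousLinearMap.id ℝ V
        = (1 / 2 : ℝ) • (fderiv ℝ H 0 - ContinuousLinearMap.id ℝ V) := by
      ext v; simp; module
    rw [this, norm_smul]; norm_num; linarith)
  obtain ⟨e, he, h0e, heP, hes, hes'⟩ := exists_local_diffeo hms hφ'.symm
    ((hH.eventually (by simp)).and hHb)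
  have he0 : e 0 = 0 := by rw [he, hm0]
  have h0t : (0 : V) ∈ e.target := by simpa [he0] using e.map_source h0e
  have hes0 : e.symm 0 = 0 := by simpa [he0] using e.left_inv h0e
  obtain ⟨Y, hY⟩ : ∃ Y : V → V, Y = fun z => H (e.symm z) - e.symm z := ⟨_, rfl⟩
  have hYs : ∀ z ∈ e.target, ContDiffAt ℝ 1 Y z := fun z hz => by
    rw [hY]
    exact (ContDiffAt.comp z (heP _ (e.map_target hz)).1 (hes' z hz)).sub (hes' z hz)
  -- the differential of `Y`, described through the differential of `m`
  have key : ∀ z ∈ e.target,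
      (∀ a, fderiv ℝ Y z ((1 / 2 : ℝ) • (a + fderiv ℝ H (e.symm z) a)) =
        fderiv ℝ H (e.symm z) a - a) ∧
      ∀ w, ∃ a, w = (1 / 2 : ℝ) • (a + fderiv ℝ H (e.symm z) a) := by
    intro z hz
    have hx := e.map_target hz
    set x := e.symm z with hxz
    have hHd := (heP x hx).1.differentiableAt one_ne_zero
    have h1 := hmd x hHd
    have hmx : m x = z := by rw [← he, hxz, e.right_inv hz]
    have h2 : HasFDerivAt Y (fderiv ℝ Y z) (m x) := by
      rw [hmx]; exact ((hYs z hz).differentiableAt one_ne_zero).hasFDerivAt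
    have h3 := h2.comp x h1
    have h4 : Y ∘ m =ᶠ[𝓝 x] fun y => H y - y := by
      filter_upwards [e.open_source.mem_nhds hx] with y hy
      simp only [Function.comp_apply, hY]
      rw [← he, e.left_inv hy]
    have h5 := h3.unique ((hHd.hasFDerivAt.sub (hasFDerivAt_id x)).congr_of_eventuallyEq h4)
    have h6 : HasFDerivAt e.symm (fderiv ℝ e.symm z) z :=
      ((hes' z hz).differentiableAt one_ne_zero).hasFDerivAt
    have h7 := h1.comp z h6
    have h8 : m ∘ e.symm =ᶠ[𝓝 z] id := by
      filter_upwards [e.open_target.mem_nhds hz] with y hy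
      rw [Function.comp_apply, ← he, e.right_inv hy, id]
    have h9 := h7.unique ((hasFDerivAt_id z).congr_of_eventuallyEq h8)
    refine ⟨fun a => by simpa using DFunLike.congr_fun h5 a,
      fun w => ⟨fderiv ℝ e.symm z w, by simpa using (DFunLike.congr_fun h9 w).symm⟩⟩
  have hYb : ∀ z ∈ e.target, ∀ u v, b (fderiv ℝ Y z u) v = b (fderiv ℝ Y z v) u := by
    intro z hz u v
    obtain ⟨k1, k2⟩ := key z hz
    obtain ⟨a, rfl⟩ := k2 u
    obtain ⟨c, rfl⟩ := k2 v
    rw [k1, k1]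
    have h1 := (heP _ (e.map_target hz)).2 a c
    have h2 := (heP _ (e.map_target hz)).2 c a
    have h3 := hb a c
    have h4 := hb (fderiv ℝ H (e.symm z) a) c
    have h5 := hb (fderiv ℝ H (e.symm z) c) a
    simp only [map_sub, map_smul, map_add, sub_apply, smul_eq_mul]
    linarith
  -- the closed form dual to `Y`
  obtain ⟨α, hα⟩ : ∃ α : V → V →L[ℝ] ℝ, α = fun z => b (Y z) := ⟨_, rfl⟩
  have hαs : ∀ z ∈ e.target, ContDiffAt ℝ 1 α z := fun z hz => by
    rw [hα]; exact b.contDiff.contDiffAt.comp z (hYs z hz)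
  have hαd : ∀ z ∈ e.target, fderiv ℝ α z = b ∘L fderiv ℝ Y z := fun z hz => by
    rw [hα]
    exact (b.hasFDerivAt.comp z ((hYs z hz).differentiableAt one_ne_zero).hasFDerivAt).fderiv
  have hα0 : ‖fderiv ℝ α 0‖ < κ := by
    obtain ⟨k1, k2⟩ := key 0 h0t
    rw [hes0] at k1 k2
    obtain ⟨δ', hδ'⟩ : ∃ δ', δ' = ‖fderiv ℝ H 0 - ContinuousLinearMap.id ℝ V‖ := ⟨_, rfl⟩
    have hD : ∀ a, ‖fderiv ℝ H 0 a - a‖ ≤ δ' * ‖a‖ := fun a => by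
      rw [hδ']; exact (fderiv ℝ H 0 - ContinuousLinearMap.id ℝ V).le_opNorm a
    have hδ'0 : 0 ≤ δ' := by rw [hδ']; exact norm_nonneg _
    have hYn : ‖fderiv ℝ Y 0‖ ≤ 2 * δ' := by
      refine ContinuousLinearMap.opNorm_le_bound _ (by positivity) fun w => ?_
      obtain ⟨a, rfl⟩ := k2 w
      rw [k1]
      set D := fderiv ℝ H 0 a with hDa
      have h1 : a = (1 / 2 : ℝ) • (a + D) - (1 / 2 : ℝ) • (D - a) := by module
      have h2 : ‖a‖ ≤ ‖(1 / 2 : ℝ) • (a + D)‖ + 1 / 2 * ‖D - a‖ := by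
        conv_lhs => rw [h1]
        refine (norm_sub_le _ _).trans (le_of_eq ?_)
        rw [norm_smul (1 / 2 : ℝ) (D - a)]; norm_num
      have h3 : ‖D - a‖ ≤ δ' * ‖a‖ := hD a
      have h4 : δ' * ‖a‖ ≤ 1 / 2 * ‖a‖ := by
        gcongr; rw [hδ']; exact hHδ2.le
      have h5 : δ' * ‖a‖ ≤ δ' * (2 * ‖(1 / 2 : ℝ) • (a + D)‖) :=
        mul_le_mul_of_nonneg_left
          (by linarith [norm_nonneg ((1 / 2 : ℝ) • (a + D))]) hδ'0
      linarith
    rw [hαd 0 h0t]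
    have hδκ : δ' < κ / (4 * (‖b‖ + 1)) := by rw [hδ']; exact hHδ.trans_le (min_le_right _ _)
    rw [lt_div_iff₀ (by positivity)] at hδκ
    have h1 := (ContinuousLinearMap.opNorm_comp_le b (fderiv ℝ Y 0))
    have h2 : ‖b‖ * ‖fderiv ℝ Y 0‖ ≤ ‖b‖ * (2 * δ') := by gcongr
    have h3 : 0 ≤ ‖b‖ * δ' := by positivity
    linarith
  have hev : ∀ᶠ z in 𝓝 (0 : V), z ∈ e.target ∧ ‖fderiv ℝ α z‖ < κ :=
    (e.open_target.eventually_mem h0t).and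
      (((hαs 0 h0t).fderiv_right (m := 0) le_rfl).continuousAt.norm.eventually_lt_const hα0)
  obtain ⟨r₁, hr₁, hball⟩ := Metric.mem_nhds_iff.mp hev
  set ρ := min r₁ r with hρ
  have hρ0 : 0 < ρ := lt_min hr₁ hr
  have hρt : ∀ z ∈ Metric.ball (0 : V) ρ, z ∈ e.target ∧ ‖fderiv ℝ α z‖ < κ := fun z hz =>
    hball (Metric.ball_subset_ball (min_le_left _ _) hz)
  obtain ⟨θ, hθ, hθsym, hθ0, hθeq, hθn⟩ := hcut α ρ κ hρ0
    (fun z hz => (hαs z (hρt z hz).1).contDiffWithinAt) (by simp [hα, hY, hes0, hH0])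
    (fun z hz u v => by
      rw [hαd z (hρt z hz).1]; exact hYb z (hρt z hz).1 u v)
    (fun z hz => (hρt z hz).2.le)
  have hZd : ∀ z, fderiv ℝ (fun z => A.symm (θ z)) z =
      (A.symm : (V →L[ℝ] ℝ) →L[ℝ] V) ∘L fderiv ℝ θ z := fun z =>
    (A.symm.hasFDerivAt.comp z ((hθ.differentiable one_ne_zero) z).hasFDerivAt).fderiv
  have hZn : ∀ z, ‖fderiv ℝ (fun z => A.symm (θ z)) z‖ ≤ min 1 (η / 4) := fun z => by
    rw [hZd]
    refine (ContinuousLinearMap.opNorm_comp_le _ _).trans ?_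
    have h1 : min 1 (η / 4) = K * (C * κ) := by rw [hκ]; field_simp
    rw [h1]
    exact mul_le_mul (by linarith) (hθn z) (norm_nonneg _) hK0.le
  obtain ⟨h, hh, hh', hhb, hhY, hhn⟩ := exists_cayley_transform hb
    (A.symm.contDiff.comp hθ) (min_le_left 1 (η / 4)) hZn (fun z u v => by
      have h1 : ∀ w, b (fderiv ℝ (fun z => A.symm (θ z)) z w) = fderiv ℝ θ z w := fun w => by
        rw [hZd, ← hA]; exact A.apply_symm_apply _
      exact (DFunLike.congr_fun (h1 u) v).trans
        ((hθsym z u v).trans (DFunLike.congr_fun (h1 v) u).symm))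
  refine ⟨h, hh, hh', hhb, fun x hx => ?_, ?_, fun x => ?_⟩
  · have h1 := hhY x
    have h2 : θ x = 0 := hθ0 x fun h => hx (Metric.ball_subset_ball (min_le_right _ _) h)
    simpa [h2] using h1
  · have hmc : Filter.Tendsto m (𝓝 0) (𝓝 0) := by simpa [hm0] using hms.continuousAt.tendsto
    filter_upwards [hmc.eventually hθeq, e.open_source.mem_nhds h0e] with x hx hxe
    have h1 := hhY (m x)
    have h2 : A.symm (θ (m x)) = H x - x := by
      rw [hx, A.symm_apply_eq, hA, hα]
      simp only [hY]
      rw [← he, e.left_inv hxe]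
    simp only [Function.comp_apply, h2] at h1
    have h3 : m x - (1 / 2 : ℝ) • (H x - x) = x := by simp only [hm]; module
    have h4 : m x + (1 / 2 : ℝ) • (H x - x) = H x := by simp only [hm]; module
    rwa [h3, h4] at h1
  · have := hhn x
    have h2 := min_le_right 1 (η / 4)
    linarith

end GermExtension

/-! ### Symplectic maps in Darboux charts -/

section InChart

variable {E : Type*} [NormedAddCommGroup E] [NormedSpace ℝ E]
variable {M : Type*} [TopologicalSpace M] [ChartedSpace E M]
variable {d : ℕ} {Ω : TwoForm E M} {e : OpenPartialHomeomorph M (R2 d)}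

/-- The differential of a self-map of `M`, as an endomorphism of the model space. -/
noncomputable def endoDeriv (f : M → M) (x : M) : E →L[ℝ] E := mfderiv 𝓘(ℝ, E) 𝓘(ℝ, E) f x

/-- The differential of a chart with values in `ℝ^{2d}`. -/
noncomputable def chartDeriv (e : OpenPartialHomeomorph M (R2 d)) (x : M) : E →L[ℝ] R2 d :=
  mfderiv 𝓘(ℝ, E) 𝓘(ℝ, R2 d) e x

/-- The differential of the inverse of a chart with values in `ℝ^{2d}`. -/
noncomputable def chartSymmDeriv (e : OpenPartialHomeomorph M (R2 d)) (y : R2 d) : R2 d →L[ℝ] E :=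
  mfderiv 𝓘(ℝ, R2 d) 𝓘(ℝ, E) e.symm y

/-- The value of a form at a point, as a form on the model space. -/
noncomputable def formAt (Ω : TwoForm E M) (x : M) : E [⋀^Fin 2]→L[ℝ] ℝ := Ω x

theorem endoDeriv_comp {f g : M → M} {x : M} (hf : MDifferentiable 𝓘(ℝ, E) 𝓘(ℝ, E) f)
    (hg : MDifferentiable 𝓘(ℝ, E) 𝓘(ℝ, E) g) :
    endoDeriv (E := E) (f ∘ g) x = endoDeriv (E := E) f (g x) ∘L endoDeriv (E := E) g x :=
  mfderiv_comp x (hf (g x)) (hg x)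

theorem endoDeriv_id (x : M) : endoDeriv (E := E) (id : M → M) x = ContinuousLinearMap.id ℝ E :=
  mfderiv_id

namespace IsDarbouxChart

theorem contMDiffAt (he : IsDarbouxChart Ω e) {x : M} (hx : x ∈ e.source) :
    ContMDiffAt 𝓘(ℝ, E) 𝓘(ℝ, R2 d) 1 e x :=
  he.contMDiffOn.contMDiffAt (e.open_source.mem_nhds hx)

theorem contMDiffAt_symm (he : IsDarbouxChart Ω e) {y : R2 d} (hy : y ∈ e.target) :
    ContMDiffAt 𝓘(ℝ, R2 d) 𝓘(ℝ, E) 1 e.symm y :=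
  he.contMDiffOn_symm.contMDiffAt (e.open_target.mem_nhds hy)

theorem hasMFDerivAt (he : IsDarbouxChart Ω e) {x : M} (hx : x ∈ e.source) :
    HasMFDerivAt 𝓘(ℝ, E) 𝓘(ℝ, R2 d) e x (chartDeriv (E := E) e x) :=
  ((he.contMDiffAt hx).mdifferentiableAt one_ne_zero).hasMFDerivAt

theorem hasMFDerivAt_symm (he : IsDarbouxChart Ω e) {y : R2 d} (hy : y ∈ e.target) :
    HasMFDerivAt 𝓘(ℝ, R2 d) 𝓘(ℝ, E) e.symm y (chartSymmDeriv (E := E) e y) :=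
  ((he.contMDiffAt_symm hy).mdifferentiableAt one_ne_zero).hasMFDerivAt

theorem chartSymmDeriv_chartDeriv (he : IsDarbouxChart Ω e) {x : M} (hx : x ∈ e.source) (v : E) :
    chartSymmDeriv (E := E) e (e x) (chartDeriv (E := E) e x v) = v := by
  have h1 := (he.hasMFDerivAt_symm (e.map_source hx)).comp x (he.hasMFDerivAt hx)
  have h2 : e.symm ∘ e =ᶠ[𝓝 x] id := by
    filter_upwards [e.open_source.mem_nhds hx] with z hz using e.left_inv hz
  have h3 := h1.mfderiv.symm.trans (h2.mfderiv_eq.trans mfderiv_id)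
  exact DFunLike.congr_fun h3 v

theorem chartDeriv_chartSymmDeriv (he : IsDarbouxChart Ω e) {y : R2 d} (hy : y ∈ e.target)
    (v : R2 d) : chartDeriv (E := E) e (e.symm y) (chartSymmDeriv (E := E) e y v) = v := by
  have h1 := (he.hasMFDerivAt (e.map_target hy)).comp y (he.hasMFDerivAt_symm hy)
  have h2 : e ∘ e.symm =ᶠ[𝓝 y] id := by
    filter_upwards [e.open_target.mem_nhds hy] with z hz using e.right_inv hz
  have h3 := h1.mfderiv.symm.trans (h2.mfderiv_eq.trans mfderiv_id)
  exact DFunLike.congr_fun h3 v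

theorem formAt_symm (he : IsDarbouxChart Ω e) {y : R2 d} (hy : y ∈ e.target) (u v : R2 d) :
    formAt Ω (e.symm y) ![chartSymmDeriv (E := E) e y u, chartSymmDeriv (E := E) e y v] = stdAlt d ![u, v] :=
  he.form y hy u v

theorem stdAlt_chartDeriv (he : IsDarbouxChart Ω e) {x : M} (hx : x ∈ e.source) (u v : E) :
    stdAlt d ![chartDeriv (E := E) e x u, chartDeriv (E := E) e x v] = formAt Ω x ![u, v] := by
  rw [← he.formAt_symm (e.map_source hx), he.chartSymmDeriv_chartDeriv hx,
    he.chartSymmDeriv_chartDeriv hx, e.left_inv hx]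

theorem mono (he : IsDarbouxChart Ω e) {s : Set M} (hs : IsOpen s) :
    IsDarbouxChart Ω (e.restrOpen s hs) where
  contMDiffOn := he.contMDiffOn.mono fun _ hx => hx.1
  contMDiffOn_symm := he.contMDiffOn_symm.mono fun _ hx => hx.1
  form y hy := he.form y hy.1

end IsDarbouxChart

theorem mem_symp_iff {f : Equiv.Perm M} : f ∈ Symp Ω ↔
    ContMDiff 𝓘(ℝ, E) 𝓘(ℝ, E) 1 f ∧ ContMDiff 𝓘(ℝ, E) 𝓘(ℝ, E) 1 f.symm ∧
      ∀ x u v, formAt Ω (f x) ![endoDeriv (E := E) f x u, endoDeriv (E := E) f x v] = formAt Ω x ![u, v] := by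
  have h : Ω.pullback f = Ω ↔
      ∀ x u v, formAt Ω (f x) ![endoDeriv (E := E) f x u, endoDeriv (E := E) f x v] = formAt Ω x ![u, v] := by
    have h1 : ∀ x (u v : E), (Ω.pullback f x : E [⋀^Fin 2]→L[ℝ] ℝ) ![u, v] =
        formAt Ω (f x) ![endoDeriv (E := E) f x u, endoDeriv (E := E) f x v] := fun x u v =>
      compCLM_pair (V := E) (W := E) (formAt Ω (f x)) (endoDeriv (E := E) f x) u v
    constructor
    · intro hf x u v
      rw [← h1, hf]; rfl
    · intro hf
      funext x
      exact alt_ext (V := E) fun u v => (h1 x u v).trans (hf x u v)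
  rw [← h]
  rfl

theorem mem_symp_stdForm_iff {f : Equiv.Perm (R2 d)} : f ∈ Symp (stdForm d) ↔
    ContDiff ℝ 1 f ∧ ContDiff ℝ 1 f.symm ∧
      ∀ x u v, stdAlt d ![fderiv ℝ f x u, fderiv ℝ f x v] = stdAlt d ![u, v] := by
  rw [mem_symp_iff, contMDiff_iff_contDiff, contMDiff_iff_contDiff]
  simp only [endoDeriv, mfderiv_eq_fderiv]
  rfl

namespace Symp

theorem contMDiff (f : Symp Ω) : ContMDiff 𝓘(ℝ, E) 𝓘(ℝ, E) 1 (f : Equiv.Perm M) := f.2.1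

theorem mdifferentiable (f : Symp Ω) : MDifferentiable 𝓘(ℝ, E) 𝓘(ℝ, E) (f : Equiv.Perm M) :=
  (Symp.contMDiff f).mdifferentiable one_ne_zero

theorem continuous_coe (f : Symp Ω) : Continuous (f : Equiv.Perm M) := (Symp.contMDiff f).continuous

theorem form (f : Symp Ω) (x : M) (u v : E) :
    formAt Ω ((f : Equiv.Perm M) x) ![endoDeriv (f : Equiv.Perm M) x u,
      endoDeriv (f : Equiv.Perm M) x v] = formAt Ω x ![u, v] :=
  (mem_symp_iff.mp f.2).2.2 x u v

end Symp

/-- A self-map of `M` read in a chart with values in `ℝ^{2d}`. -/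
noncomputable def inChart (e : OpenPartialHomeomorph M (R2 d)) (f : M → M) : R2 d → R2 d :=
  fun y => e (f (e.symm y))

/-- The differential of `inChart e f`, as a product of three differentials. -/
noncomputable def inChartDeriv (e : OpenPartialHomeomorph M (R2 d)) (f : M → M) (y : R2 d) :
    R2 d →L[ℝ] R2 d :=
  (chartDeriv (E := E) e (f (e.symm y)) ∘L endoDeriv (E := E) f (e.symm y)) ∘L chartSymmDeriv (E := E) e y

theorem IsDarbouxChart.hasFDerivAt_inChart (he : IsDarbouxChart Ω e) (f : Symp Ω) {y : R2 d}
    (hy : y ∈ e.target) (hfy : (f : Equiv.Perm M) (e.symm y) ∈ e.source) :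
    HasFDerivAt (inChart e (f : Equiv.Perm M)) (inChartDeriv (E := E) e (f : Equiv.Perm M) y) y := by
  have h1 := (Symp.mdifferentiable f (e.symm y)).hasMFDerivAt
  exact (((he.hasMFDerivAt hfy).comp _ h1).comp y (he.hasMFDerivAt_symm hy)).hasFDerivAt

theorem IsDarbouxChart.contDiffAt_inChart (he : IsDarbouxChart Ω e) (f : Symp Ω) {y : R2 d}
    (hy : y ∈ e.target) (hfy : (f : Equiv.Perm M) (e.symm y) ∈ e.source) :
    ContDiffAt ℝ 1 (inChart e (f : Equiv.Perm M)) y :=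
  (((he.contMDiffAt hfy).comp _ (Symp.contMDiff f _)).comp y (he.contMDiffAt_symm hy)).contDiffAt

theorem IsDarbouxChart.stdAlt_inChartDeriv (he : IsDarbouxChart Ω e) (f : Symp Ω) {y : R2 d}
    (hy : y ∈ e.target) (hfy : (f : Equiv.Perm M) (e.symm y) ∈ e.source) (u v : R2 d) :
    stdAlt d ![inChartDeriv (E := E) e (f : Equiv.Perm M) y u,
      inChartDeriv (E := E) e (f : Equiv.Perm M) y v] = stdAlt d ![u, v] := by
  simp only [inChartDeriv, ContinuousLinearMap.comp_apply]
  rw [he.stdAlt_chartDeriv hfy, Symp.form f, he.formAt_symm hy]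

end InChart

/-! ### The topology of the group of symplectomorphisms -/

section Topology

variable {E : Type*} [NormedAddCommGroup E] [NormedSpace ℝ E]
variable {M : Type*} [TopologicalSpace M] [ChartedSpace E M] [IsManifold 𝓘(ℝ, E) ∞ M]
variable {Ω : TwoForm E M}

namespace Symp

theorem tangent_one : Symp.tangent (1 : Symp Ω) = ContinuousMap.id _ := by
  ext1 p
  exact congrFun tangentMap_id p

theorem tangent_mul (f g : Symp Ω) : Symp.tangent (f * g) = (Symp.tangent f).comp (Symp.tangent g) := by
  ext1 p
  exact congrFun (tangentMap_comp (I := 𝓘(ℝ, E)) (I' := 𝓘(ℝ, E)) (I'' := 𝓘(ℝ, E))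
    (mdifferentiable f) (mdifferentiable g)) p

theorem continuous_tangent : Continuous (Symp.tangent : Symp Ω → _) := continuous_induced_dom

theorem continuous_mul_left (f : Symp Ω) : Continuous fun g : Symp Ω => f * g := by
  rw [continuous_induced_rng]
  have h : Symp.tangent ∘ (fun g : Symp Ω => f * g) = fun g => (Symp.tangent f).comp (Symp.tangent g) :=
    funext fun g => tangent_mul f g
  rw [h]
  exact (ContinuousMap.continuous_postcomp _).comp continuous_tangent

variable [FiniteDimensional ℝ E]

theorem continuous_tangent_apply : Continuous fun p : Symp Ω × TangentBundle 𝓘(ℝ, E) M =>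
    Symp.tangent p.1 p.2 := by
  have : LocallyCompactSpace (ModelProd E E) := inferInstanceAs (LocallyCompactSpace (E × E))
  have : LocallyCompactSpace (TangentBundle 𝓘(ℝ, E) M) :=
    ChartedSpace.locallyCompactSpace (ModelProd E E) _
  exact (continuous_eval (F := C(TangentBundle 𝓘(ℝ, E) M, TangentBundle 𝓘(ℝ, E) M))).comp
    (continuous_tangent.prodMap continuous_id)

theorem continuous_apply : Continuous fun p : Symp Ω × M => (p.1 : Equiv.Perm M) p.2 := by
  have h1 : Continuous fun p : Symp Ω × M =>
      Symp.tangent p.1 (Bundle.zeroSection E (TangentSpace 𝓘(ℝ, E)) p.2) := by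
    have h2 : Continuous (Bundle.zeroSection E (TangentSpace 𝓘(ℝ, E) : M → Type _)) :=
      (Bundle.contMDiff_zeroSection (n := 0) ℝ (IB := 𝓘(ℝ, E)) (TangentSpace 𝓘(ℝ, E) : M → Type _)).continuous
    exact continuous_tangent_apply.comp (continuous_fst.prodMk (h2.comp continuous_snd))
  exact (FiberBundle.continuous_proj E (TangentSpace 𝓘(ℝ, E) : M → Type _)).comp h1

end Symp

end Topology

/-! ### Transport of compactly supported symplectic maps through a Darboux chart -/

section Transport

variable {E : Type*} [NormedAddCommGroup E] [NormedSpace ℝ E]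
variable {M : Type*} [TopologicalSpace M] [ChartedSpace E M]
variable {d : ℕ} {Ω : TwoForm E M} {e : OpenPartialHomeomorph M (R2 d)}

open Classical in
/-- The self-map of `M` that is `φ` in the chart `e` and the identity outside its source. -/
noncomputable def chartExtend (e : OpenPartialHomeomorph M (R2 d)) (φ : R2 d → R2 d) (x : M) : M :=
  if x ∈ e.source then e.symm (φ (e x)) else x

theorem chartExtend_of_mem (φ : R2 d → R2 d) {x : M} (hx : x ∈ e.source) :
    chartExtend e φ x = e.symm (φ (e x)) := if_pos hx

theorem chartExtend_symm (φ : R2 d → R2 d) {y : R2 d} (hy : y ∈ e.target) :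
    chartExtend e φ (e.symm y) = e.symm (φ y) := by
  rw [chartExtend_of_mem φ (e.map_target hy), e.right_inv hy]

theorem mem_of_perm_apply_ne {X : Type*} {s : Set X} {φ : Equiv.Perm X} (h : ∀ y ∉ s, φ y = y)
    {y : X} (hy : y ∈ s) : φ y ∈ s := by
  by_contra h'
  have := φ.injective (h _ h')
  rw [this] at h'
  exact h' hy

section

variable {K : Set (R2 d)}

theorem chartExtend_eq_self {φ : R2 d → R2 d} (hφ : ∀ y ∉ K, φ y = y) {x : M}
    (hx : x ∉ e.symm '' K) : chartExtend e φ x = x := by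
  by_cases hxs : x ∈ e.source
  · rw [chartExtend_of_mem φ hxs, hφ, e.left_inv hxs]
    exact fun h => hx ⟨e x, h, e.left_inv hxs⟩
  · exact if_neg hxs

theorem chartExtend_comp {φ ψ : Equiv.Perm (R2 d)} (hK : K ⊆ e.target) (hψ : ∀ y ∉ K, ψ y = y)
    (x : M) : chartExtend e φ (chartExtend e ψ x) = chartExtend e (φ * ψ : Equiv.Perm (R2 d)) x := by
  by_cases hxs : x ∈ e.source
  · have h1 : ψ (e x) ∈ e.target :=
      mem_of_perm_apply_ne (fun y hy => hψ y fun h => hy (hK h)) (e.map_source hxs)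
    rw [chartExtend_of_mem ψ hxs, chartExtend_symm _ h1, chartExtend_of_mem _ hxs]
    rfl
  · have h : ∀ φ : R2 d → R2 d, chartExtend e φ x = x := fun φ => if_neg hxs
    rw [h, h, h]

theorem chartExtend_one (x : M) : chartExtend e (1 : Equiv.Perm (R2 d)) x = x := by
  by_cases hxs : x ∈ e.source
  · rw [chartExtend_of_mem _ hxs]; exact e.left_inv hxs
  · exact if_neg hxs

/-- The permutation of `M` that is `φ` in the chart `e` and the identity outside its source. -/
noncomputable def chartPerm (hK : K ⊆ e.target) (φ : Equiv.Perm (R2 d)) (hφ : ∀ y ∉ K, φ y = y) :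
    Equiv.Perm M where
  toFun := chartExtend e φ
  invFun := chartExtend e φ.symm
  left_inv x := by
    have := chartExtend_comp (φ := φ⁻¹) hK hφ x
    rw [inv_mul_cancel, chartExtend_one] at this
    exact this
  right_inv x := by
    have := chartExtend_comp (φ := φ) (ψ := φ⁻¹) hK
      (fun y hy => by rw [Equiv.Perm.inv_eq_iff_eq, hφ y hy]) x
    rw [mul_inv_cancel, chartExtend_one] at this
    exact this

theorem endoDeriv_chartExtend (he : IsDarbouxChart Ω e) (hKt : K ⊆ e.target)
    {φ : Equiv.Perm (R2 d)} (hφ : ∀ y ∉ K, φ y = y) (hφs : ContDiff ℝ 1 φ) {x : M}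
    (hx : x ∈ e.source) (v : E) : endoDeriv (E := E) (chartExtend e φ) x v =
      chartSymmDeriv (E := E) e (φ (e x)) (fderiv ℝ φ (e x) (chartDeriv (E := E) e x v)) := by
  have h1 : φ (e x) ∈ e.target :=
    mem_of_perm_apply_ne (fun y hy => hφ y fun h => hy (hKt h)) (e.map_source hx)
  have h2 := (he.hasMFDerivAt_symm h1).comp x
    (((hφs.differentiable one_ne_zero) (e x)).hasFDerivAt.hasMFDerivAt.comp x (he.hasMFDerivAt hx))
  have h3 : chartExtend e φ =ᶠ[𝓝 x] e.symm ∘ φ ∘ e := by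
    filter_upwards [e.open_source.mem_nhds hx] with z hz using chartExtend_of_mem φ hz
  exact DFunLike.congr_fun (h3.mfderiv_eq.trans h2.mfderiv) v

variable [T2Space M]

theorem chartExtend_eventuallyEq (hK : IsCompact K) (hKt : K ⊆ e.target) {φ : R2 d → R2 d}
    (hφ : ∀ y ∉ K, φ y = y) {x : M} (hx : x ∉ e.symm '' K) : chartExtend e φ =ᶠ[𝓝 x] id := by
  have hcl : IsClosed (e.symm '' K) := (hK.image_of_continuousOn
    (e.symm.continuousOn.mono hKt)).isClosed
  filter_upwards [hcl.isOpen_compl.mem_nhds hx] with z hz using chartExtend_eq_self hφ hz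

theorem contMDiff_chartExtend (he : IsDarbouxChart Ω e) (hK : IsCompact K) (hKt : K ⊆ e.target)
    {φ : Equiv.Perm (R2 d)} (hφ : ∀ y ∉ K, φ y = y) (hφs : ContDiff ℝ 1 φ) :
    ContMDiff 𝓘(ℝ, E) 𝓘(ℝ, E) 1 (chartExtend e φ) := by
  intro x
  by_cases hx : x ∈ e.source
  · have h1 : φ (e x) ∈ e.target :=
      mem_of_perm_apply_ne (fun y hy => hφ y fun h => hy (hKt h)) (e.map_source hx)
    have h2 := (he.contMDiffAt_symm h1).comp x
      (hφs.contMDiff.contMDiffAt.comp x (he.contMDiffAt hx))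
    refine h2.congr_of_eventuallyEq ?_
    filter_upwards [e.open_source.mem_nhds hx] with z hz using chartExtend_of_mem _ hz
  · have hx' : x ∉ e.symm '' K := by
      rintro ⟨y, hy, rfl⟩
      exact hx (e.map_target (hKt hy))
    exact contMDiffAt_id.congr_of_eventuallyEq (chartExtend_eventuallyEq hK hKt hφ hx')

theorem endoDeriv_chartExtend_of_notMem (hK : IsCompact K) (hKt : K ⊆ e.target)
    {φ : Equiv.Perm (R2 d)} (hφ : ∀ y ∉ K, φ y = y) {x : M} (hx : x ∉ e.symm '' K) :
    endoDeriv (E := E) (chartExtend e φ) x = ContinuousLinearMap.id ℝ E :=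
  (chartExtend_eventuallyEq hK hKt hφ hx).mfderiv_eq.trans mfderiv_id

theorem chartPerm_mem_symp (he : IsDarbouxChart Ω e) (hK : IsCompact K) (hKt : K ⊆ e.target)
    {φ : Equiv.Perm (R2 d)} (hφ : φ ∈ SympRel (stdForm d) Kᶜ) :
    chartPerm hKt φ hφ.2 ∈ Symp Ω := by
  have hφ' := (inv_mem hφ : φ⁻¹ ∈ SympRel (stdForm d) Kᶜ)
  obtain ⟨h1, h2, h3⟩ := mem_symp_stdForm_iff.mp hφ.1
  rw [mem_symp_iff]
  refine ⟨contMDiff_chartExtend he hK hKt hφ.2 h1,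
    contMDiff_chartExtend he hK hKt hφ'.2 h2, fun x u v => ?_⟩
  change formAt Ω (chartExtend e φ x) ![endoDeriv (E := E) (chartExtend e φ) x u,
    endoDeriv (E := E) (chartExtend e φ) x v] = _
  by_cases hx : x ∈ e.source
  · have h4 : φ (e x) ∈ e.target :=
      mem_of_perm_apply_ne (fun y hy => hφ.2 y fun h => hy (hKt h)) (e.map_source hx)
    rw [endoDeriv_chartExtend he hKt hφ.2 h1 hx, endoDeriv_chartExtend he hKt hφ.2 h1 hx,
      chartExtend_of_mem _ hx, he.formAt_symm h4, h3, he.stdAlt_chartDeriv hx]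
  · have hx' : x ∉ e.symm '' K := by
      rintro ⟨y, hy, rfl⟩
      exact hx (e.map_target (hKt hy))
    rw [endoDeriv_chartExtend_of_notMem hK hKt hφ.2 hx', chartExtend_eq_self hφ.2 hx']
    rfl

/-- The transport to `M`, through a Darboux chart, of the symplectic maps of `ℝ^{2d}` supported in
a compact subset of the target of the chart. -/
noncomputable def transport (he : IsDarbouxChart Ω e) (hK : IsCompact K) (hKt : K ⊆ e.target) :
    SympRel (stdForm d) Kᶜ →* Symp Ω where
  toFun φ := ⟨chartPerm hKt φ φ.2.2, chartPerm_mem_symp he hK hKt φ.2⟩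
  map_one' := Subtype.ext (Equiv.ext fun x => chartExtend_one x)
  map_mul' _ ψ := Subtype.ext (Equiv.ext fun x => (chartExtend_comp hKt ψ.2.2 x).symm)

theorem transport_apply (he : IsDarbouxChart Ω e) (hK : IsCompact K) (hKt : K ⊆ e.target)
    (φ : SympRel (stdForm d) Kᶜ) (x : M) :
    (transport he hK hKt φ : Equiv.Perm M) x = chartExtend e φ x := rfl

end

end Transport

/-! ### Continuity of the differential with respect to the symplectomorphism -/

section TangentCharts

variable {E : Type*} [NormedAddCommGroup E] [NormedSpace ℝ E]
variable {M : Type*} [TopologicalSpace M] [ChartedSpace E M] [IsManifold 𝓘(ℝ, E) ∞ M]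
variable {d : ℕ} {Ω : TwoForm E M} {e : OpenPartialHomeomorph M (R2 d)}

/-- The inverse of the chart of `TM` defined by a chart of `M`. -/
noncomputable def tangentChartSymm (e : OpenPartialHomeomorph M (R2 d)) (q : R2 d × R2 d) :
    TangentBundle 𝓘(ℝ, E) M :=
  ⟨e.symm q.1, chartSymmDeriv (E := E) e q.1 q.2⟩

/-- The chart of `TM` defined by a chart of `M`. -/
noncomputable def tangentChart (e : OpenPartialHomeomorph M (R2 d))
    (p : TangentBundle 𝓘(ℝ, E) M) : R2 d × R2 d :=
  (e p.1, chartDeriv (E := E) e p.1 p.2)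

theorem IsDarbouxChart.continuousOn_tangentChartSymm (he : IsDarbouxChart Ω e) :
    ContinuousOn (tangentChartSymm (E := E) e) (Prod.fst ⁻¹' e.target) := by
  have h1 := he.contMDiffOn_symm.continuousOn_tangentMapWithin le_rfl
    e.open_target.uniqueMDiffOn
  have h2 := h1.comp (t := Bundle.TotalSpace.proj ⁻¹' e.target) (s := Prod.fst ⁻¹' e.target)
    (tangentBundleModelSpaceHomeomorph 𝓘(ℝ, R2 d)).symm.continuous.continuousOn
    (fun q hq => hq)
  refine h2.congr fun q hq => ?_
  have h3 : mfderivWithin 𝓘(ℝ, R2 d) 𝓘(ℝ, E) e.symm e.target q.1 =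
      mfderiv 𝓘(ℝ, R2 d) 𝓘(ℝ, E) e.symm q.1 := mfderivWithin_of_isOpen e.open_target hq
  simp only [tangentChartSymm, chartSymmDeriv]
  rw [← h3]
  rfl

theorem IsDarbouxChart.continuousOn_tangentChart (he : IsDarbouxChart Ω e) :
    ContinuousOn (tangentChart (E := E) e) (Bundle.TotalSpace.proj ⁻¹' e.source) := by
  have h1 := he.contMDiffOn.continuousOn_tangentMapWithin le_rfl e.open_source.uniqueMDiffOn
  have h2 := (tangentBundleModelSpaceHomeomorph 𝓘(ℝ, R2 d)).continuous.comp_continuousOn h1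
  refine ContinuousOn.congr h2 fun p hp => ?_
  have h3 : mfderivWithin 𝓘(ℝ, E) 𝓘(ℝ, R2 d) e e.source p.1 =
      mfderiv 𝓘(ℝ, E) 𝓘(ℝ, R2 d) e p.1 := mfderivWithin_of_isOpen e.open_source hp
  simp only [tangentChart, chartDeriv]
  rw [← h3]
  rfl

/-- The expression in a chart of a symplectomorphism and of its differential depends continuously
on the symplectomorphism. -/
theorem IsDarbouxChart.continuousOn_inChart_inChartDeriv [FiniteDimensional ℝ E]
    (he : IsDarbouxChart Ω e) :
    ContinuousOn (fun p : Symp Ω × R2 d × R2 d => (inChart e (p.1 : Equiv.Perm M) p.2.1,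
      inChartDeriv (E := E) e (p.1 : Equiv.Perm M) p.2.1 p.2.2))
      {p | p.2.1 ∈ e.target ∧ (p.1 : Equiv.Perm M) (e.symm p.2.1) ∈ e.source} := by
  have h1 : ContinuousOn (fun p : Symp Ω × R2 d × R2 d =>
      Symp.tangent p.1 (tangentChartSymm (E := E) e p.2))
      {p | p.2.1 ∈ e.target ∧ (p.1 : Equiv.Perm M) (e.symm p.2.1) ∈ e.source} :=
    Symp.continuous_tangent_apply.comp_continuousOn (continuousOn_fst.prodMk
      (he.continuousOn_tangentChartSymm.comp continuousOn_snd fun p hp => hp.1))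
  exact he.continuousOn_tangentChart.comp h1 fun p hp => hp.2

/-- A compactly supported symplectic map of `ℝ^{2d}` that is `C¹`-close to the identity is
transported to a symplectomorphism close to the identity. -/
theorem exists_transport_mem_nhds [T2Space M] (hd : 0 < d) (he : IsDarbouxChart Ω e)
    {K : Set (R2 d)} (hK : IsCompact K) (hKt : K ⊆ e.target) {U : Set (Symp Ω)}
    (hU : U ∈ 𝓝 (1 : Symp Ω)) : ∃ η > 0, ∀ φ : SympRel (stdForm d) Kᶜ,
      (∀ y, ‖fderiv ℝ (φ : Equiv.Perm (R2 d)) y - ContinuousLinearMap.id ℝ (R2 d)‖ < η) →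
      transport he hK hKt φ ∈ U := by
  set l : Filter (SympRel (stdForm d) Kᶜ) := ⨅ (η : ℝ) (_ : 0 < η), Filter.principal
    {φ | ∀ y, ‖fderiv ℝ (φ : Equiv.Perm (R2 d)) y - ContinuousLinearMap.id ℝ (R2 d)‖ < η}
  have hl : l.HasBasis (fun η : ℝ => 0 < η) _ := Filter.hasBasis_biInf_principal'
    (fun i hi j hj => ⟨min i j, lt_min hi hj, fun φ h y => (h y).trans_le (min_le_left _ _),
      fun φ h y => (h y).trans_le (min_le_right _ _)⟩) ⟨1, one_pos⟩
  suffices h : Filter.Tendsto (transport he hK hKt) l (𝓝 1) by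
    obtain ⟨η, hη, h'⟩ := hl.mem_iff.mp (h hU)
    exact ⟨η, hη, fun φ hφ => h' hφ⟩
  rw [nhds_induced, Filter.tendsto_comap_iff, Symp.tangent_one,
    ContinuousMap.tendsto_nhds_compactOpen]
  intro C hC W hW hCW
  rw [hl.eventually_iff]
  -- the part of `C` that the transported maps move, read in the chart
  have hcl : IsClosed (e.symm '' K) := (hK.image_of_continuousOn
    (e.symm.continuousOn.mono hKt)).isClosed
  have hKs : e.symm '' K ⊆ e.source := by
    rintro _ ⟨y, hy, rfl⟩
    exact e.map_target (hKt hy)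
  have hC' : IsCompact (C ∩ Bundle.TotalSpace.proj ⁻¹' (e.symm '' K)) :=
    hC.inter_right (hcl.preimage (FiberBundle.continuous_proj E (TangentSpace 𝓘(ℝ, E) : M → Type _)))
  set Q := tangentChart (E := E) e '' (C ∩ Bundle.TotalSpace.proj ⁻¹' (e.symm '' K)) with hQ
  have hQc : IsCompact Q := hC'.image_of_continuousOn
    (he.continuousOn_tangentChart.mono fun p hp => hKs hp.2)
  have hO : IsOpen (Prod.fst ⁻¹' e.target ∩ tangentChartSymm (E := E) e ⁻¹' W) :=
    he.continuousOn_tangentChartSymm.isOpen_inter_preimage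
      (e.open_target.preimage continuous_fst) hW
  have hinv : ∀ p : TangentBundle 𝓘(ℝ, E) M, p.1 ∈ e.source →
      tangentChartSymm (E := E) e (tangentChart (E := E) e p) = p := by
    rintro ⟨x, v⟩ hx
    exact Bundle.TotalSpace.ext (e.left_inv hx) (heq_of_eq (he.chartSymmDeriv_chartDeriv hx v))
  have hQO : Q ⊆ Prod.fst ⁻¹' e.target ∩ tangentChartSymm (E := E) e ⁻¹' W := by
    rintro _ ⟨p, hp, rfl⟩
    refine ⟨e.map_source (hKs hp.2), ?_⟩
    rw [Set.mem_preimage, hinv p (hKs hp.2)]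
    exact hCW hp.1
  obtain ⟨δ, hδ, hδO⟩ := hQc.exists_cthickening_subset_open hO hQO
  obtain ⟨B, hB⟩ := hQc.isBounded.exists_norm_le
  obtain ⟨R, hR⟩ := hK.isBounded.exists_norm_le
  have : Nonempty (Fin d) := ⟨⟨0, hd⟩⟩
  obtain ⟨p₀, hp₀⟩ := NormedSpace.exists_lt_norm ℝ (R2 d) R
  have hp₀K : p₀ ∉ K := fun h => absurd (hR p₀ h) (not_le.mpr hp₀)
  set L := |B| + ‖p₀‖ + 1 with hL
  have hL0 : 0 < L := by positivity
  refine ⟨δ / L, by positivity, fun φ hφ p hp => ?_⟩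
  obtain ⟨hφs, -, -⟩ := mem_symp_stdForm_iff.mp φ.2.1
  obtain ⟨x, v⟩ := p
  change (⟨chartExtend e φ x, endoDeriv (E := E) (chartExtend e φ) x v⟩ :
    TangentBundle 𝓘(ℝ, E) M) ∈ W
  by_cases hx : x ∈ e.symm '' K
  · have h1 : (⟨chartExtend e φ x, endoDeriv (E := E) (chartExtend e φ) x v⟩ :
        TangentBundle 𝓘(ℝ, E) M) = tangentChartSymm (E := E) e ((φ : Equiv.Perm (R2 d)) (e x),
          fderiv ℝ (φ : Equiv.Perm (R2 d)) (e x) (chartDeriv (E := E) e x v)) :=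
      Bundle.TotalSpace.ext (chartExtend_of_mem _ (hKs hx))
        (heq_of_eq (endoDeriv_chartExtend he hKt φ.2.2 hφs (hKs hx) v))
    have hq : tangentChart (E := E) e ⟨x, v⟩ ∈ Q := ⟨_, ⟨hp, hx⟩, rfl⟩
    have hqB := (hB _ hq).trans (le_abs_self B)
    have hy : ‖e x‖ ≤ |B| := (norm_fst_le _).trans hqB
    have hw : ‖chartDeriv (E := E) e x v‖ ≤ |B| := (norm_snd_le _).trans hqB
    rw [h1]
    refine (hδO (Metric.mem_cthickening_of_dist_le _ _ δ _ hq ?_)).2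
    rw [Prod.dist_eq, max_le_iff]
    have hφd := hφs.differentiable one_ne_zero
    have h2 : (φ : Equiv.Perm (R2 d)) p₀ = p₀ := φ.2.2 p₀ hp₀K
    constructor
    · have h3 := Convex.norm_image_sub_le_of_norm_fderiv_le (𝕜 := ℝ) (C := δ / L)
        (f := fun y => (φ : Equiv.Perm (R2 d)) y - y) (s := Set.univ) (x := p₀) (y := e x)
        (fun y _ => (hφd y).sub differentiableAt_id) (fun y _ => by
          rw [fderiv_fun_sub (hφd y) differentiableAt_fun_id, fderiv_fun_id]
          exact (hφ y).le) convex_univ (Set.mem_univ _) (Set.mem_univ _)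
      rw [h2, sub_self, sub_zero] at h3
      change dist ((φ : Equiv.Perm (R2 d)) (e x)) (e x) ≤ δ
      rw [dist_eq_norm]
      refine h3.trans ?_
      have h4 : ‖e x - p₀‖ ≤ L := (norm_sub_le _ _).trans (by linarith)
      calc δ / L * ‖e x - p₀‖ ≤ δ / L * L := by gcongr
        _ = δ := by field_simp
    · change dist (fderiv ℝ (φ : Equiv.Perm (R2 d)) (e x) (chartDeriv (E := E) e x v))
        (chartDeriv (E := E) e x v) ≤ δ
      rw [dist_eq_norm]
      have h3 := (fderiv ℝ (φ : Equiv.Perm (R2 d)) (e x) -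
        ContinuousLinearMap.id ℝ (R2 d)).le_opNorm (chartDeriv (E := E) e x v)
      rw [sub_apply, ContinuousLinearMap.id_apply] at h3
      refine h3.trans ?_
      have h4 : ‖chartDeriv (E := E) e x v‖ ≤ L := hw.trans (by linarith [norm_nonneg p₀])
      calc _ ≤ δ / L * L := mul_le_mul (hφ _).le h4 (norm_nonneg _) (by positivity)
        _ = δ := by field_simp
  · have h1 : (⟨chartExtend e φ x, endoDeriv (E := E) (chartExtend e φ) x v⟩ :
        TangentBundle 𝓘(ℝ, E) M) = ⟨x, v⟩ :=
      Bundle.TotalSpace.ext (chartExtend_eq_self φ.2.2 hx) (heq_of_eq (by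
        rw [endoDeriv_chartExtend_of_notMem hK hKt φ.2.2 hx]; rfl))
    rw [h1]
    exact hCW hp

end TangentCharts

/-! ### Linear symplectic maps that rotate every vector in the positive direction -/

section PositiveRotation

open LinearMap (BilinForm)

/-- The eigenvalues of a linear symplectic map `A` with `σ(x, A x) > 0` for all `x ≠ 0` have modulus
one: an eigenvector `x + i y` with eigenvalue `a + i b` satisfies
`σ(x, y) = σ(A x, A y) = (a² + b²) σ(x, y)`, and `σ(x, A x) = - b σ(x, y) = σ(y, A y)`. -/
theorem norm_eq_one_of_charpoly_root {V : Type*} [AddCommGroup V] [Module ℝ V]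
    [FiniteDimensional ℝ V] {σ : BilinForm ℝ V} (hσ : ∀ x, σ x x = 0) {A : Module.End ℝ V}
    (hA : ∀ x y, σ (A x) (A y) = σ x y) (hpos : ∀ x, x ≠ 0 → 0 < σ x (A x)) {μ : ℂ}
    (hμ : Polynomial.aeval μ (LinearMap.charpoly A) = 0) : ‖μ‖ = 1 := by
  have hneg : ∀ x y, σ y x = - σ x y := fun x y => by
    have h := hσ (x + y)
    simp only [map_add, LinearMap.add_apply, hσ, zero_add, add_zero] at h
    linarith
  -- an eigenvector of the complexified matrix
  let b := Module.finBasis ℝ V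
  set T := LinearMap.toMatrix b b A with hT
  have h1 : (T.map (algebraMap ℝ ℂ)).charpoly.eval μ = 0 := by
    rw [Matrix.charpoly_map, Polynomial.eval_map_algebraMap, hT, LinearMap.charpoly_toMatrix, hμ]
  rw [Matrix.eval_charpoly] at h1
  obtain ⟨v, hv0, hv⟩ := Matrix.exists_mulVec_eq_zero_iff.mpr h1
  have hv' : (T.map (algebraMap ℝ ℂ)).mulVec v = μ • v := by
    rw [Matrix.sub_mulVec, sub_eq_zero, Matrix.scalar_apply] at hv
    rw [← hv]
    ext i
    simp [Matrix.mulVec_diagonal]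
  have hre : T.mulVec (fun i => (v i).re) = fun i => (μ * v i).re := by
    ext i
    have h := congrArg Complex.re (congrFun hv' i)
    simpa [Matrix.mulVec, dotProduct, Complex.re_sum] using h
  have him : T.mulVec (fun i => (v i).im) = fun i => (μ * v i).im := by
    ext i
    have h := congrArg Complex.im (congrFun hv' i)
    simpa [Matrix.mulVec, dotProduct, Complex.im_sum] using h
  obtain ⟨x, hx⟩ : ∃ x, b.equivFun x = fun i => (v i).re := b.equivFun.surjective _
  obtain ⟨y, hy⟩ : ∃ y, b.equivFun y = fun i => (v i).im := b.equivFun.surjective _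
  have hAb : ∀ z, b.equivFun (A z) = T.mulVec (b.equivFun z) := fun z =>
    (LinearMap.toMatrix_mulVec_repr b b A z).symm
  have hAx : A x = μ.re • x - μ.im • y := by
    apply b.equivFun.injective
    rw [hAb, hx, hre, map_sub, map_smul, map_smul, hx, hy]
    ext i
    simp
  have hAy : A y = μ.im • x + μ.re • y := by
    apply b.equivFun.injective
    rw [hAb, hy, him, map_add, map_smul, map_smul, hx, hy]
    ext i
    simp
    ring
  have h2 := hA x y
  have e1 : σ x (A x) = - (μ.im * σ x y) := by rw [hAx]; simp [hσ]
  have e2 : σ y (A y) = - (μ.im * σ x y) := by rw [hAy]; simp [hσ, hneg x y]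
  have h3 : (μ.re * μ.re + μ.im * μ.im) * σ x y = σ x y := by
    rw [hAx, hAy] at h2
    simp [hσ, hneg x y] at h2
    linarith
  by_cases hxy : σ x y = 0
  · exfalso
    rw [hxy, mul_zero, neg_zero] at e1 e2
    have hx0 : x = 0 := by
      by_contra h; exact absurd e1 (hpos x h).ne'
    have hy0 : y = 0 := by
      by_contra h; exact absurd e2 (hpos y h).ne'
    rw [hx0, map_zero] at hx
    rw [hy0, map_zero] at hy
    exact hv0 (funext fun i => Complex.ext (congrFun hx i).symm (congrFun hy i).symm)
  · have h4 : μ.re * μ.re + μ.im * μ.im = 1 := mul_right_cancel₀ hxy (by rw [h3, one_mul])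
    rw [Complex.norm_def, Complex.normSq_apply, h4, Real.sqrt_one]

/-- The rotation `cos t + sin t J` of `ℝ^{2d}`. -/
noncomputable def stdRot (d : ℕ) (t : ℝ) : R2 d →L[ℝ] R2 d :=
  Real.cos t • ContinuousLinearMap.id ℝ (R2 d) + Real.sin t • stdJ d

theorem stdRot_apply {d : ℕ} (t : ℝ) (x : R2 d) :
    stdRot d t x = Real.cos t • x + Real.sin t • stdJ d x := rfl

theorem stdAlt_stdRot {d : ℕ} (t : ℝ) (x y : R2 d) :
    stdAlt d ![stdRot d t x, stdRot d t y] = stdAlt d ![x, y] := by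
  simp only [← altBilin_apply, stdRot_apply, map_add, map_smul, add_apply, smul_apply, smul_eq_mul]
  have h1 : altBilin (stdAlt d) (stdJ d x) (stdJ d y) = altBilin (stdAlt d) x y := by
    rw [altBilin_apply, stdAlt_stdJ_left, stdJ_stdJ, ← altBilin_apply, map_neg, neg_neg]
  have h2 : altBilin (stdAlt d) (stdJ d x) y = - altBilin (stdAlt d) x (stdJ d y) := by
    rw [altBilin_apply, stdAlt_stdJ_left, altBilin_apply]
  rw [h1, h2]
  linear_combination altBilin (stdAlt d) x y * Real.sin_sq_add_cos_sq t

theorem stdAlt_stdRot_self {d : ℕ} (t : ℝ) (x : R2 d) :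
    stdAlt d ![x, stdRot d t x] = Real.sin t * ‖x‖ ^ 2 := by
  rw [← stdAlt_stdJ_self, ← altBilin_apply, ← altBilin_apply, stdRot_apply, map_add, map_smul,
    map_smul, altBilin_apply, alt_self]
  simp

end PositiveRotation

/-! ### Extension of germs in the standard symplectic space -/

section StandardExtension

/-- Symplectic germs close to the identity extend to symplectic maps of `ℝ^{2d}` that are supported
in small balls and `C¹`-close to the identity. -/
theorem exists_sympRel_extension (d : ℕ) {η : ℝ} (hη : 0 < η) : ∃ δ > 0, ∀ H : R2 d → R2 d,
    ContDiffAt ℝ 1 H 0 → H 0 = 0 →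
    (∀ᶠ x in 𝓝 0, ∀ u v, stdAlt d ![fderiv ℝ H x u, fderiv ℝ H x v] = stdAlt d ![u, v]) →
    ‖fderiv ℝ H 0 - ContinuousLinearMap.id ℝ (R2 d)‖ < δ → ∀ r > 0,
    ∃ φ : SympRel (stdForm d) (Metric.closedBall (0 : R2 d) r)ᶜ,
      (∀ᶠ x in 𝓝 0, (φ : Equiv.Perm (R2 d)) x = H x) ∧
      ∀ x, ‖fderiv ℝ (φ : Equiv.Perm (R2 d)) x - ContinuousLinearMap.id ℝ (R2 d)‖ < η := by
  obtain ⟨A, hA⟩ := exists_musical_equiv (a := stdAlt d) stdAlt_nondeg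
  obtain ⟨δ, hδ, hH⟩ := exists_symplectic_extension (b := altBilin (stdAlt d)) (fun u v => by
    rw [altBilin_apply, altBilin_apply, alt_neg]) A (fun u => by rw [← hA]; rfl) hη
  refine ⟨δ, hδ, fun H h1 h2 h3 h4 r hr => ?_⟩
  obtain ⟨h, hh, hh', hhb, hhr, hhH, hhη⟩ := hH H h1 h2 (by simpa using h3) h4 r hr
  refine ⟨⟨h.toEquiv, mem_symp_stdForm_iff.mpr ⟨hh, hh', by simpa using hhb⟩, fun x hx => ?_⟩,
    hhH, hhη⟩
  exact hhr x fun hx' => hx (Metric.ball_subset_closedBall hx')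

/-- There are symplectic maps of `ℝ^{2d}`, with arbitrarily small support, that rotate around the
origin. -/
theorem exists_sympRel_rotation (d : ℕ) {r : ℝ} (hr : 0 < r) :
    ∃ φ : SympRel (stdForm d) (Metric.closedBall (0 : R2 d) r)ᶜ,
      (φ : Equiv.Perm (R2 d)) 0 = 0 ∧ ∃ s : ℝ, 0 < s ∧ ∀ v,
        stdAlt d ![v, fderiv ℝ (φ : Equiv.Perm (R2 d)) 0 v] = s * ‖v‖ ^ 2 := by
  obtain ⟨δ, hδ, hH⟩ := exists_sympRel_extension d one_pos
  have hc : Filter.Tendsto (fun t => ‖stdRot d t - ContinuousLinearMap.id ℝ (R2 d)‖) (𝓝 0)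
      (𝓝 0) := by
    have h1 : Continuous fun t => ‖stdRot d t - ContinuousLinearMap.id ℝ (R2 d)‖ := by
      unfold stdRot; fun_prop
    have h2 := h1.tendsto 0
    simpa [stdRot] using h2
  obtain ⟨t, ht, ht0, htπ⟩ : ∃ t, ‖stdRot d t - ContinuousLinearMap.id ℝ (R2 d)‖ < δ ∧ 0 < t ∧
      t < Real.pi := by
    have h1 := (hc.eventually (gt_mem_nhds hδ)).filter_mono (nhdsWithin_le_nhds (s := Set.Ioi 0))
    have h2 : ∀ᶠ t in 𝓝[>] (0 : ℝ), t ∈ Set.Ioo 0 Real.pi := Ioo_mem_nhdsGT Real.pi_pos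
    obtain ⟨t, h3, h4⟩ := (h1.and h2).exists
    exact ⟨t, h3, h4⟩
  obtain ⟨φ, hφ, -⟩ := hH (stdRot d t) (stdRot d t).contDiff.contDiffAt (map_zero _)
    (.of_forall fun x u v => by rw [ContinuousLinearMap.fderiv, stdAlt_stdRot])
    (by rwa [ContinuousLinearMap.fderiv]) r hr
  refine ⟨φ, by rw [hφ.self_of_nhds, map_zero], Real.sin t, Real.sin_pos_of_pos_of_lt_pi ht0 htπ,
    fun v => ?_⟩
  rw [Filter.EventuallyEq.fderiv_eq hφ, ContinuousLinearMap.fderiv, stdAlt_stdRot_self]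

end StandardExtension

/-! ### Robust totally elliptic fixed points -/

section Robust

variable {E : Type*} [NormedAddCommGroup E] [NormedSpace ℝ E] [FiniteDimensional ℝ E]
variable {M : Type*} [TopologicalSpace M] [ChartedSpace E M]
variable {d : ℕ} {Ω : TwoForm E M} {e : OpenPartialHomeomorph M (R2 d)}

/-- A fixed point of a symplectomorphism whose differential `A` satisfies `Ω(v, A v) > 0` for all
`v ≠ 0` is totally elliptic. -/
theorem isTotallyElliptic_one_of_pos {f : Symp Ω} {x : M} (hx : (f : Equiv.Perm M) x = x)
    (hpos : ∀ v : E, v ≠ 0 → 0 < formAt Ω x ![v, endoDeriv (E := E) (f : Equiv.Perm M) x v]) :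
    IsTotallyElliptic f 1 x := by
  refine ⟨one_pos, Function.minimalPeriod_eq_one_iff_isFixedPt.mpr hx, ?_⟩
  intro A μ hμ
  have hA : A = endoDeriv (E := E) (f : Equiv.Perm M) x := by
    simp only [A]; rfl
  refine norm_eq_one_of_charpoly_root (σ := altForm (formAt Ω x)) (fun v => ?_) (fun u v => ?_)
    (fun v hv => ?_) hμ
  · rw [altForm_apply, alt_self]
  · have h := Symp.form f x u v
    rw [hx] at h
    rw [altForm_apply, altForm_apply, ← h, hA]
    rfl
  · rw [altForm_apply, hA]
    exact hpos v hv

variable [IsManifold 𝓘(ℝ, E) ∞ M]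

/-- The set where `inChart e f y` is meaningful is open, jointly in `f` and `y`. -/
theorem isOpen_inChart_domain (Ω : TwoForm E M) (e : OpenPartialHomeomorph M (R2 d)) :
    IsOpen {p : Symp Ω × R2 d | p.2 ∈ e.target ∧ (p.1 : Equiv.Perm M) (e.symm p.2) ∈ e.source} := by
  have h1 : ContinuousOn (fun p : Symp Ω × R2 d => (p.1 : Equiv.Perm M) (e.symm p.2))
      (Prod.snd ⁻¹' e.target) :=
    Symp.continuous_apply.comp_continuousOn (continuousOn_fst.prodMk
      (e.continuousOn_symm.comp continuousOn_snd fun p hp => hp))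
  exact h1.isOpen_inter_preimage (e.open_target.preimage continuous_snd) e.open_source

theorem continuousAt_inChart {f : Symp Ω} {y : R2 d} (hfy : (f : Equiv.Perm M) (e.symm y) ∈ e.source) :
    ContinuousAt (fun g : Symp Ω => inChart e (g : Equiv.Perm M) y) f := by
  refine ContinuousAt.comp (f := fun g : Symp Ω => (g : Equiv.Perm M) (e.symm y))
    (e.continuousAt hfy) ?_
  exact (Symp.continuous_apply.comp (continuous_id.prodMk continuous_const)).continuousAt

theorem IsDarbouxChart.continuousAt_inChartDeriv (he : IsDarbouxChart Ω e) {f : Symp Ω} {y : R2 d}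
    (hy : y ∈ e.target) (hfy : (f : Equiv.Perm M) (e.symm y) ∈ e.source) (w : R2 d) :
    ContinuousAt (fun q : (Symp Ω × R2 d) × R2 d =>
      inChartDeriv (E := E) e (q.1.1 : Equiv.Perm M) q.1.2 q.2) ((f, y), w) := by
  have h1 : IsOpen {p : Symp Ω × R2 d × R2 d | p.2.1 ∈ e.target ∧
      (p.1 : Equiv.Perm M) (e.symm p.2.1) ∈ e.source} :=
    (isOpen_inChart_domain Ω e).preimage (f := fun p : Symp Ω × R2 d × R2 d => (p.1, p.2.1))
      (by fun_prop)
  have h2 := he.continuousOn_inChart_inChartDeriv.continuousAt (x := (f, y, w))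
    (h1.mem_nhds ⟨hy, hfy⟩)
  exact ContinuousAt.comp (f := fun q : (Symp Ω × R2 d) × R2 d => (q.1.1, q.1.2, q.2))
    (x := ((f, y), w)) h2.snd (by fun_prop)

/-- A fixed point whose differential `A` satisfies `Ω(v, A v) > 0` for all `v ≠ 0` is robust. It
persists as the fixed point of a contraction, and the condition on the differential is open. -/
theorem isRobustTotallyElliptic_one_of_pos (he : IsDarbouxChart Ω e) {f : Symp Ω} {x : M}
    (hxe : x ∈ e.source) (hex : e x = 0) (hx : (f : Equiv.Perm M) x = x)
    (hpos : ∀ v : E, v ≠ 0 → 0 < formAt Ω x ![v, endoDeriv (E := E) (f : Equiv.Perm M) x v]) :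
    IsRobustTotallyElliptic f 1 x := by
  have h0t : (0 : R2 d) ∈ e.target := by rw [← hex]; exact e.map_source hxe
  have hx0 : e.symm 0 = x := by rw [← hex, e.left_inv hxe]
  have hf0 : (f : Equiv.Perm M) (e.symm 0) ∈ e.source := by rwa [hx0, hx]
  obtain ⟨R, hR⟩ : ∃ R, R = inChartDeriv (E := E) e (f : Equiv.Perm M) 0 := ⟨_, rfl⟩
  have hRpos : ∀ w, w ≠ 0 → 0 < stdAlt d ![w, R w] := by
    intro w hw
    have h1 := he.chartDeriv_chartSymmDeriv h0t w
    have h2 : chartSymmDeriv (E := E) e 0 w ≠ 0 := fun h => hw (by rw [← h1, h, map_zero])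
    have h3 := hpos _ h2
    rw [← he.stdAlt_chartDeriv hxe, ← hx0, h1] at h3
    rw [hR, inChartDeriv, ContinuousLinearMap.comp_apply, ContinuousLinearMap.comp_apply]
    rwa [hx0, hx, ← hx0]
  -- `R - 1` is invertible
  have hinj : Function.Injective (R - ContinuousLinearMap.id ℝ (R2 d)) := by
    rw [injective_iff_map_eq_zero]
    intro w hw
    by_contra hw0
    have h1 := hRpos w hw0
    rw [sub_apply, ContinuousLinearMap.id_apply, sub_eq_zero] at hw
    rw [hw, alt_self] at h1
    exact lt_irrefl _ h1
  obtain ⟨Q, hQ⟩ : ∃ Q : R2 d ≃L[ℝ] R2 d, ∀ w, Q w = R w - w :=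
    ⟨(LinearEquiv.ofInjectiveEndo _ hinj).toContinuousLinearEquiv, fun w => rfl⟩
  -- the open conditions on `g` near `f` and on a point near the fixed point
  have hdom : ∀ᶠ p : Symp Ω × R2 d in 𝓝 (f, 0),
      p.2 ∈ e.target ∧ (p.1 : Equiv.Perm M) (e.symm p.2) ∈ e.source :=
    (isOpen_inChart_domain Ω e).mem_nhds ⟨h0t, hf0⟩
  have hcontr : ∀ᶠ p : Symp Ω × R2 d in 𝓝 (f, 0), ∀ w ∈ Metric.closedBall (0 : R2 d) 1,
      ‖Q.symm (inChartDeriv (E := E) e (p.1 : Equiv.Perm M) p.2 w - R w)‖ < 1 / 2 := by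
    refine (isCompact_closedBall _ _).eventually_forall_of_forall_eventually fun w _ => ?_
    have h1 : ContinuousAt (fun q : (Symp Ω × R2 d) × R2 d =>
        ‖Q.symm (inChartDeriv (E := E) e (q.1.1 : Equiv.Perm M) q.1.2 q.2 - R q.2)‖)
        ((f, 0), w) :=
      (Q.symm.continuous.continuousAt.comp ((he.continuousAt_inChartDeriv h0t hf0 w).sub
        (R.continuous.continuousAt.comp continuousAt_snd))).norm
    have h2 : ‖Q.symm (inChartDeriv (E := E) e (f : Equiv.Perm M) 0 w - R w)‖ < 1 / 2 := by
      rw [← hR, sub_self, map_zero, norm_zero]; norm_num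
    exact h1.eventually_lt_const h2
  have hposev : ∀ᶠ p : Symp Ω × R2 d in 𝓝 (f, 0), ∀ w ∈ Metric.sphere (0 : R2 d) 1,
      0 < stdAlt d ![w, inChartDeriv (E := E) e (p.1 : Equiv.Perm M) p.2 w] := by
    refine (isCompact_sphere _ _).eventually_forall_of_forall_eventually fun w hw => ?_
    have h1 : ContinuousAt (fun q : (Symp Ω × R2 d) × R2 d => altBilin (stdAlt d) q.2
        (inChartDeriv (E := E) e (q.1.1 : Equiv.Perm M) q.1.2 q.2)) ((f, 0), w) :=
      ((altBilin (stdAlt d)).continuous.continuousAt.comp continuousAt_snd).clm_apply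
        (he.continuousAt_inChartDeriv h0t hf0 w)
    have h2 : 0 < altBilin (stdAlt d) w (inChartDeriv (E := E) e (f : Equiv.Perm M) 0 w) := by
      rw [altBilin_apply, ← hR]
      exact hRpos w (Metric.ne_of_mem_sphere hw one_ne_zero)
    simpa using h1.eventually_const_lt h2
  obtain ⟨U₁, hU₁, B₁, hB₁, hU₁B₁⟩ :=
    Filter.mem_prod_iff.mp ((nhds_prod_eq (x := f) (y := (0 : R2 d))) ▸
      (hdom.and (hcontr.and hposev)))
  obtain ⟨r₀, hr₀, hball⟩ := Metric.mem_nhds_iff.mp hB₁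
  set r := r₀ / 2 with hr
  have hr0 : 0 < r := by positivity
  have hall : ∀ g ∈ U₁, ∀ y ∈ Metric.closedBall (0 : R2 d) r, _ := fun g hg y hy =>
    hU₁B₁ (Set.mk_mem_prod hg (hball (Metric.closedBall_subset_ball (by linarith) hy)))
  have hG0 : ∀ᶠ g : Symp Ω in 𝓝 f, ‖Q.symm (inChart e (g : Equiv.Perm M) 0)‖ < r / 2 := by
    have h1 : ContinuousAt (fun g : Symp Ω => ‖Q.symm (inChart e (g : Equiv.Perm M) 0)‖) f :=
      (Q.symm.continuous.continuousAt.comp (continuousAt_inChart hf0)).norm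
    refine h1.eventually_lt_const ?_
    have h2 : inChart e (f : Equiv.Perm M) 0 = 0 := by
      simp only [inChart]; rw [hx0, hx, hex]
    change ‖Q.symm (inChart e (f : Equiv.Perm M) 0)‖ < r / 2
    rw [h2, map_zero, norm_zero]
    positivity
  set U := {g ∈ U₁ | ‖Q.symm (inChart e (g : Equiv.Perm M) 0)‖ < r / 2} with hU
  have hUf : U ∈ 𝓝 f := Filter.inter_mem hU₁ hG0
  set B := Metric.closedBall (0 : R2 d) r with hB
  have h0B : (0 : R2 d) ∈ B := Metric.mem_closedBall_self hr0.le
  -- the contraction whose fixed points are those of `g`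
  let S : Symp Ω → R2 d → R2 d := fun g y => y - Q.symm (inChart e (g : Equiv.Perm M) y - y)
  have hSlip : ∀ g ∈ U₁, ∀ y ∈ B, ∀ z ∈ B, ‖S g y - S g z‖ ≤ 1 / 2 * ‖y - z‖ := by
    intro g hg y hy z hz
    have hd : ∀ w ∈ B, HasFDerivWithinAt (S g) (ContinuousLinearMap.id ℝ (R2 d) -
        (Q.symm : R2 d →L[ℝ] R2 d) ∘L (inChartDeriv (E := E) e (g : Equiv.Perm M) w -
          ContinuousLinearMap.id ℝ (R2 d))) B w := fun w hw => by
      have h1 := he.hasFDerivAt_inChart g (hall g hg w hw).1.1 (hall g hg w hw).1.2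
      exact ((hasFDerivAt_id w).sub
        (Q.symm.hasFDerivAt.comp w (h1.sub (hasFDerivAt_id w)))).hasFDerivWithinAt
    refine (convex_closedBall (0 : R2 d) r).norm_image_sub_le_of_norm_hasFDerivWithin_le hd
      (fun w hw => ?_) hz hy
    refine ContinuousLinearMap.opNorm_le_of_unit_norm (by norm_num) fun v hv => ?_
    have h1 := (hall g hg w hw).2.1 v (by simp [hv])
    have h2 : (ContinuousLinearMap.id ℝ (R2 d) - (Q.symm : R2 d →L[ℝ] R2 d) ∘L
        (inChartDeriv (E := E) e (g : Equiv.Perm M) w - ContinuousLinearMap.id ℝ (R2 d))) v =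
        - Q.symm (inChartDeriv (E := E) e (g : Equiv.Perm M) w v - R v) := by
      have h3 : v = Q.symm (R v - v) := by rw [← hQ, Q.symm_apply_apply]
      simp only [sub_apply, ContinuousLinearMap.id_apply, ContinuousLinearMap.comp_apply,
        ContinuousLinearEquiv.coe_coe, map_sub]
      conv_lhs => enter [1]; rw [h3]
      rw [map_sub]
      abel
    rw [h2, norm_neg]
    exact h1.le
  have hfix : ∀ g ∈ U, ∃ y ∈ B, S g y = y := by
    intro g hg
    have hmaps : Set.MapsTo (S g) B B := by
      intro y hy
      have h1 := hSlip g hg.1 y hy 0 h0B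
      have h2 : ‖S g 0‖ < r / 2 := by
        simpa [S] using hg.2
      have h3 : ‖y‖ ≤ r := by simpa [hB] using hy
      have h4 : ‖S g y‖ ≤ ‖S g y - S g 0‖ + ‖S g 0‖ := by
        simpa using norm_add_le (S g y - S g 0) (S g 0)
      rw [sub_zero] at h1
      rw [hB, mem_closedBall_zero_iff]
      linarith
    have hK : ContractingWith (1 / 2) (hmaps.restrict (S g) B B) := by
      refine ⟨by rw [← NNReal.coe_lt_coe]; norm_num, LipschitzWith.of_dist_le_mul fun y z => ?_⟩
      rw [Subtype.dist_eq, Subtype.dist_eq, dist_eq_norm, dist_eq_norm]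
      simpa using hSlip g hg.1 y y.2 z z.2
    obtain ⟨y, hy, hy', -⟩ := hK.exists_fixedPoint' Metric.isClosed_closedBall.isComplete hmaps h0B
      (edist_ne_top _ _)
    exact ⟨y, hy, hy'⟩
  classical
  choose! q hqB hqS using hfix
  have hqfix : ∀ g ∈ U, inChart e (g : Equiv.Perm M) (q g) = q g := by
    intro g hg
    have h1 := hqS g hg
    simpa [S, sub_eq_zero] using h1
  refine ⟨U, hUf, fun g => e.symm (q g), ?_, ?_, ?_⟩
  · have hfU : f ∈ U := mem_of_mem_nhds hUf
    have h1 := hSlip f hfU.1 (q f) (hqB f hfU) 0 h0B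
    have h2 : S f 0 = 0 := by
      simp only [S, inChart]
      rw [hx0, hx, hex]
      simp
    rw [hqS f hfU, h2, sub_zero] at h1
    have h3 : ‖q f‖ = 0 := le_antisymm (by linarith [norm_nonneg (q f)]) (norm_nonneg _)
    change e.symm (q f) = x
    rw [norm_eq_zero.mp h3, hx0]
  · intro g₀ hg₀
    have h1 := hall g₀ hg₀.1 (q g₀) (hqB g₀ hg₀)
    have hq : ContinuousWithinAt q U g₀ := by
      have h2 : Filter.Tendsto (fun g : Symp Ω => 2 * ‖Q.symm (inChart e (g : Equiv.Perm M) (q g₀) -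
          inChart e (g₀ : Equiv.Perm M) (q g₀))‖) (𝓝[U] g₀) (𝓝 0) := by
        have h3 : ContinuousAt (fun g : Symp Ω => 2 * ‖Q.symm (inChart e (g : Equiv.Perm M) (q g₀) -
            inChart e (g₀ : Equiv.Perm M) (q g₀))‖) g₀ :=
          continuousAt_const.mul (Q.symm.continuous.continuousAt.comp
            ((continuousAt_inChart h1.1.2).sub continuousAt_const)).norm
        have h4 := h3.tendsto
        rw [sub_self, map_zero, norm_zero, mul_zero] at h4
        exact h4.mono_left nhdsWithin_le_nhds
      rw [ContinuousWithinAt, tendsto_iff_norm_sub_tendsto_zero]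
      refine squeeze_zero' (.of_forall fun _ => norm_nonneg _) ?_ h2
      filter_upwards [self_mem_nhdsWithin] with g hg
      have h5 := hSlip g hg.1 (q g) (hqB g hg) (q g₀) (hqB g₀ hg₀)
      have h6 : q g - q g₀ = (S g (q g) - S g (q g₀)) - Q.symm (inChart e (g : Equiv.Perm M) (q g₀) -
          inChart e (g₀ : Equiv.Perm M) (q g₀)) := by
        conv_lhs => rw [← hqS g hg, ← hqS g₀ hg₀]
        have h7 : S g₀ (q g₀) = S g (q g₀) + Q.symm (inChart e (g : Equiv.Perm M) (q g₀) -
            inChart e (g₀ : Equiv.Perm M) (q g₀)) := by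
          simp only [S, map_sub]; abel
        rw [hqS g hg, h7]
        abel
      have h8 : ‖q g - q g₀‖ ≤ ‖S g (q g) - S g (q g₀)‖ +
          ‖Q.symm (inChart e (g : Equiv.Perm M) (q g₀) - inChart e (g₀ : Equiv.Perm M) (q g₀))‖ := by
        conv_lhs => rw [h6]
        exact norm_sub_le _ _
      linarith
    have h9 : ContinuousAt e.symm (q g₀) := e.continuousAt_symm h1.1.1
    exact h9.comp_continuousWithinAt hq
  · intro g hg
    have h1 := hall g hg.1 (q g) (hqB g hg)
    have hgx : (g : Equiv.Perm M) (e.symm (q g)) = e.symm (q g) := by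
      have h2 := congrArg e.symm (hqfix g hg)
      rwa [inChart, e.left_inv h1.1.2] at h2
    refine isTotallyElliptic_one_of_pos hgx fun v hv => ?_
    have hs : e.symm (q g) ∈ e.source := e.map_target h1.1.1
    have hw : chartDeriv (E := E) e (e.symm (q g)) v ≠ 0 := fun h => hv (by
      rw [← he.chartSymmDeriv_chartDeriv hs v, h, map_zero])
    set w := chartDeriv (E := E) e (e.symm (q g)) v with hwv
    have h2 : inChartDeriv (E := E) e (g : Equiv.Perm M) (q g) w =
        chartDeriv (E := E) e (e.symm (q g))
          (endoDeriv (E := E) (g : Equiv.Perm M) (e.symm (q g)) v) := by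
      have h3 := he.chartSymmDeriv_chartDeriv hs v
      rw [e.right_inv h1.1.1] at h3
      rw [inChartDeriv, ContinuousLinearMap.comp_apply, ContinuousLinearMap.comp_apply, hwv, h3, hgx]
    rw [← he.stdAlt_chartDeriv hs, ← h2, ← hwv]
    have hwn : 0 < ‖w‖ := norm_pos_iff.mpr hw
    have h3 := h1.2.2 (‖w‖⁻¹ • w) (by
      rw [mem_sphere_zero_iff_norm, norm_smul, norm_inv, norm_norm, inv_mul_cancel₀ hwn.ne'])
    rw [← altBilin_apply, map_smul, map_smul, map_smul, smul_apply, smul_eq_mul, smul_eq_mul,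
      altBilin_apply] at h3
    have h4 : 0 < ‖w‖⁻¹ := inv_pos.mpr hwn
    exact pos_of_mul_pos_right (pos_of_mul_pos_right h3 h4.le) h4.le

/-- There are symplectomorphisms with a robust totally elliptic fixed point. -/
theorem robustEllipticSet_nonempty [T2Space M] [Nonempty M] (hE : Module.finrank ℝ E = 2 * d)
    (hΩ : IsSymplecticForm Ω) : (robustEllipticSet Ω).Nonempty := by
  obtain ⟨x⟩ := ‹Nonempty M›
  obtain ⟨e, he, hxe, hex⟩ := exists_isDarbouxChart hE hΩ x
  have h0t : (0 : R2 d) ∈ e.target := by rw [← hex]; exact e.map_source hxe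
  obtain ⟨r, hr, hrt⟩ := Metric.nhds_basis_closedBall.mem_iff.mp (e.open_target.mem_nhds h0t)
  obtain ⟨φ, hφ0, s, hs, hφ⟩ := exists_sympRel_rotation d hr
  have hφs := (mem_symp_stdForm_iff.mp φ.2.1).1
  refine ⟨transport he (isCompact_closedBall _ _) hrt φ, 1, x, ?_⟩
  have hfx : (transport he (isCompact_closedBall _ _) hrt φ : Equiv.Perm M) x = x := by
    rw [transport_apply, chartExtend_of_mem _ hxe, hex, hφ0, ← hex, e.left_inv hxe]
  refine isRobustTotallyElliptic_one_of_pos he hxe hex hfx fun v hv => ?_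
  have h1 : endoDeriv (E := E) (transport he (isCompact_closedBall _ _) hrt φ : Equiv.Perm M) x v =
      chartSymmDeriv (E := E) e ((φ : Equiv.Perm (R2 d)) (e x))
        (fderiv ℝ (φ : Equiv.Perm (R2 d)) (e x) (chartDeriv (E := E) e x v)) :=
    endoDeriv_chartExtend he hrt φ.2.2 hφs hxe v
  have h2 := he.chartDeriv_chartSymmDeriv h0t
    (fderiv ℝ (φ : Equiv.Perm (R2 d)) 0 (chartDeriv (E := E) e x v))
  have hx0 : e.symm 0 = x := by rw [← hex, e.left_inv hxe]
  rw [hex, hφ0] at h1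
  rw [hx0] at h2
  rw [h1, ← he.stdAlt_chartDeriv hxe, h2, hφ]
  have hw : chartDeriv (E := E) e x v ≠ 0 := fun h => hv (by
    rw [← he.chartSymmDeriv_chartDeriv hxe v, h, map_zero])
  positivity

/-- Robustness is an open condition. -/
theorem isOpen_robustEllipticSet (Ω : TwoForm E M) : IsOpen (robustEllipticSet Ω) := by
  rw [isOpen_iff_mem_nhds]
  rintro f ⟨n, x, U, hU, p, -, hp, hell⟩
  filter_upwards [eventually_mem_nhds_iff.mpr hU] with g hg
  exact ⟨n, p g, U, hg, p, rfl, hp, hell⟩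

end Robust

/-! ### Density of the maps of finite order on an open set -/

section Iterates

theorem iterate_comp_eq_of_disjoint {X : Type*} {f T : X → X} {O : Set X} {n : ℕ} (hn : 0 < n)
    (hT : ∀ z ∉ O, T z = z) (hTO : ∀ z ∈ O, T z ∈ O)
    (hO : ∀ k, 0 < k → k < n → ∀ z ∈ O, f^[k] z ∉ O) {z : X} (hz : z ∈ O) :
    (f ∘ T)^[n] z = f^[n] (T z) := by
  have h : ∀ k, k < n → (f ∘ T)^[k + 1] z = f^[k + 1] (T z) := by
    intro k
    induction k with
    | zero => intro _; rfl
    | succ k ih =>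
      intro hk
      rw [Function.iterate_succ_apply', ih (by omega), Function.comp_apply,
        hT _ (hO (k + 1) (by omega) hk _ (hTO z hz)), ← Function.iterate_succ_apply' f]
  obtain ⟨k, rfl⟩ : ∃ k, n = k + 1 := ⟨n - 1, by omega⟩
  exact h k (by omega)

/-- A point that does not return before time `n` has a neighbourhood disjoint from its first
`n - 1` images. -/
theorem exists_open_disjoint_iterates {X : Type*} [TopologicalSpace X] [T2Space X] {f : X → X}
    (hf : Continuous f) {x : X} {n : ℕ} (hx : ∀ k, 0 < k → k < n → f^[k] x ≠ x) :
    ∃ O : Set X, IsOpen O ∧ x ∈ O ∧ ∀ k, 0 < k → k < n → ∀ z ∈ O, f^[k] z ∉ O := by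
  have h : ∀ k, ∃ O ∈ 𝓝 x, 0 < k → k < n → ∀ z ∈ O, f^[k] z ∉ O := by
    intro k
    by_cases hk : 0 < k ∧ k < n
    · obtain ⟨A, B, hA, hB, hxA, hxB, hAB⟩ := t2_separation (hx k hk.1 hk.2)
      refine ⟨B ∩ f^[k] ⁻¹' A, Filter.inter_mem (hB.mem_nhds hxB)
        ((hf.iterate k).continuousAt.preimage_mem_nhds (hA.mem_nhds hxA)), fun _ _ z hz hz' => ?_⟩
      exact Set.disjoint_left.mp hAB hz.2 hz'.1
    · exact ⟨Set.univ, Filter.univ_mem, fun h1 h2 => absurd ⟨h1, h2⟩ hk⟩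
  choose O hO hOk using h
  obtain ⟨U, hU, hUo, hxU⟩ := mem_nhds_iff.mp ((Filter.biInter_finset_mem (Finset.range n)).mpr
    fun k _ => hO k)
  refine ⟨U, hUo, hxU, fun k h0 hk z hz hz' => ?_⟩
  have h1 := Set.mem_iInter₂.mp (hU hz) k (Finset.mem_range.mpr hk)
  have h2 := Set.mem_iInter₂.mp (hU hz') k (Finset.mem_range.mpr hk)
  exact hOk k h0 hk z h1 h2

end Iterates

section Density

variable {E : Type*} [NormedAddCommGroup E] [NormedSpace ℝ E]
variable {M : Type*} [TopologicalSpace M] [ChartedSpace E M]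
variable {d : ℕ} {Ω : TwoForm E M}

theorem coe_pow_eq_iterate (f : Symp Ω) (n : ℕ) :
    (((f ^ n : Symp Ω) : Equiv.Perm M) : M → M) = (f : Equiv.Perm M)^[n] := by
  rw [SubgroupClass.coe_pow, Equiv.Perm.iterate_eq_pow]

variable [FiniteDimensional ℝ E] [IsManifold 𝓘(ℝ, E) ∞ M]

/-- The symplectomorphisms with a robust totally elliptic periodic point that have finite order on
some non-empty open set. -/
def finiteOrderOnOpenSet (Ω : TwoForm E M) : Set (Symp Ω) :=
  {g | g ∈ robustEllipticSet Ω ∧ ∃ m, 0 < m ∧ ∃ W : Set M, IsOpen W ∧ W.Nonempty ∧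
    ∀ y ∈ W, (g : Equiv.Perm M)^[m] y = y}

/-- Near a totally elliptic periodic point, a small perturbation makes the return map conjugate to a
linear map of finite order. -/
theorem exists_finite_order_near_point [T2Space M] (hd : 0 < d) (hE : Module.finrank ℝ E = 2 * d)
    (hΩ : IsSymplecticForm Ω) {f : Symp Ω} {n : ℕ} {x : M} (hf : IsTotallyElliptic f n x)
    {U : Set (Symp Ω)} (hU : U ∈ 𝓝 f) : ∃ g ∈ U, ∃ m, 0 < m ∧ ∃ W : Set M, IsOpen W ∧ W.Nonempty ∧
    ∀ y ∈ W, (g : Equiv.Perm M)^[m] y = y := by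
  obtain ⟨hn, hper, hell⟩ := hf
  have hU' : (fun g : Symp Ω => f * g) ⁻¹' U ∈ 𝓝 (1 : Symp Ω) :=
    (Symp.continuous_mul_left f).continuousAt.preimage_mem_nhds (by rwa [mul_one])
  -- a Darboux chart whose source is disjoint from its first images
  obtain ⟨O, hO, hxO, hOdisj⟩ := exists_open_disjoint_iterates (Symp.continuous_coe f) (x := x)
    (n := n) fun k h0 hk h => by
      have := Function.IsPeriodicPt.minimalPeriod_le h0 (h : Function.IsPeriodicPt _ k x)
      omega
  obtain ⟨e₀, he₀, hxe₀, hex₀⟩ := exists_isDarbouxChart hE hΩ x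
  obtain ⟨e, he, hxe, hex, heO⟩ : ∃ e : OpenPartialHomeomorph M (R2 d), IsDarbouxChart Ω e ∧
      x ∈ e.source ∧ e x = 0 ∧ e.source ⊆ O :=
    ⟨e₀.restrOpen O hO, he₀.mono hO, ⟨hxe₀, hxO⟩, hex₀, fun z hz => hz.2⟩
  have h0t : (0 : R2 d) ∈ e.target := by rw [← hex]; exact e.map_source hxe
  have hx0 : e.symm 0 = x := by rw [← hex, e.left_inv hxe]
  obtain ⟨r, hr, hrt⟩ := Metric.nhds_basis_closedBall.mem_iff.mp (e.open_target.mem_nhds h0t)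
  obtain ⟨η, hη, hηU⟩ := exists_transport_mem_nhds hd he (isCompact_closedBall _ _) hrt hU'
  obtain ⟨δ, hδ, hext⟩ := exists_sympRel_extension d hη
  -- the linear return map and its approximation by a map of finite order
  obtain ⟨F, hF⟩ : ∃ F : Symp Ω, F = f ^ n := ⟨_, rfl⟩
  have hFi : ((F : Equiv.Perm M) : M → M) = (f : Equiv.Perm M)^[n] := by
    rw [hF, coe_pow_eq_iterate]
  have hFx : (F : Equiv.Perm M) x = x := by
    rw [hFi, ← hper]; exact Function.iterate_minimalPeriod
  have hFx' : ((F⁻¹ : Symp Ω) : Equiv.Perm M) x = x := by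
    rw [InvMemClass.coe_inv, Equiv.Perm.inv_eq_iff_eq, hFx]
  set A := endoDeriv (E := E) (F : Equiv.Perm M) x with hA
  set A' := endoDeriv (E := E) ((F⁻¹ : Symp Ω) : Equiv.Perm M) x with hA'
  have hA'A : ∀ v, A' (A v) = v := fun v => by
    have h1 := endoDeriv_comp (E := E) (x := x) (Symp.mdifferentiable F⁻¹) (Symp.mdifferentiable F)
    have h2 : (((F⁻¹ : Symp Ω) : Equiv.Perm M) : M → M) ∘ (F : Equiv.Perm M) = id := by
      rw [InvMemClass.coe_inv]
      funext z
      exact (F : Equiv.Perm M).symm_apply_apply z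
    rw [h2, endoDeriv_id, hFx] at h1
    exact (DFunLike.congr_fun h1 v).symm
  have hσ : IsLinearSymplectic (altForm (formAt Ω x)) :=
    isLinearSymplectic_altForm fun v hv => hΩ.nondegenerate x v hv
  have hAσ : ∀ u v, altForm (formAt Ω x) (A u) (A v) = altForm (formAt Ω x) u v := fun u v => by
    have h := Symp.form F x u v
    rw [hFx] at h
    rw [altForm_apply, altForm_apply, ← h]
  have hAu : IsUnitModulus (A : E →ₗ[ℝ] E) := isUnitModulus_of_charpoly (by
    have h1 : A = mfderiv 𝓘(ℝ, E) 𝓘(ℝ, E) ((f : Equiv.Perm M) : M → M)^[n] x := by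
      rw [hA, hFi]; rfl
    rw [h1]
    exact hell)
  obtain ⟨ε, hε, hεδ⟩ : ∃ ε > 0, ∀ B : E →L[ℝ] E, ‖B - A‖ < ε →
      ‖(chartDeriv (E := E) e x ∘L A' ∘L B ∘L chartSymmDeriv (E := E) e 0) -
        ContinuousLinearMap.id ℝ (R2 d)‖ < δ := by
    have h1 : Continuous fun B : E →L[ℝ] E =>
        ‖(chartDeriv (E := E) e x ∘L A' ∘L B ∘L chartSymmDeriv (E := E) e 0) -
        ContinuousLinearMap.id ℝ (R2 d)‖ := by fun_prop
    have h2 : chartDeriv (E := E) e x ∘L A' ∘L A ∘L chartSymmDeriv (E := E) e 0 =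
        ContinuousLinearMap.id ℝ (R2 d) := by
      ext1 v
      simp only [ContinuousLinearMap.comp_apply, ContinuousLinearMap.id_apply]
      rw [hA'A]
      have := he.chartDeriv_chartSymmDeriv h0t v
      rwa [hx0] at this
    have hlt : ‖(chartDeriv (E := E) e x ∘L A' ∘L A ∘L chartSymmDeriv (E := E) e 0) -
        ContinuousLinearMap.id ℝ (R2 d)‖ < δ := by
      rw [h2, sub_self, norm_zero]; exact hδ
    have h3 := (h1.tendsto A).eventually_lt_const hlt
    obtain ⟨ε, hε, h4⟩ := Metric.mem_nhds_iff.mp h3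
    exact ⟨ε, hε, fun B hB => h4 (by rwa [Metric.mem_ball, dist_eq_norm])⟩
  obtain ⟨B₀, hB₀, hB₀σ, N, hN, hB₀N⟩ := exists_finite_order_near hσ hAσ hAu hε
  obtain ⟨B, hB⟩ : ∃ B : R2 d →L[ℝ] R2 d,
      B = chartDeriv (E := E) e x ∘L B₀ ∘L chartSymmDeriv (E := E) e 0 := ⟨_, rfl⟩
  have hBapp : ∀ v, B v = chartDeriv (E := E) e x (B₀ (chartSymmDeriv (E := E) e 0 v)) := fun v => by
    rw [hB]; rfl
  have hDS : ∀ v, chartSymmDeriv (E := E) e 0 (chartDeriv (E := E) e x v) = v := fun v => by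
    rw [← hex]; exact he.chartSymmDeriv_chartDeriv hxe v
  have hBN : ∀ v, B^[N] v = v := fun v => by
    have h1 : ∀ k v, B^[k] v =
        chartDeriv (E := E) e x (B₀^[k] (chartSymmDeriv (E := E) e 0 v)) := by
      intro k
      induction k with
      | zero =>
        intro v
        have := he.chartDeriv_chartSymmDeriv h0t v
        rw [hx0] at this
        exact this.symm
      | succ k ih =>
        intro v
        rw [Function.iterate_succ_apply', ih, hBapp, hDS, Function.iterate_succ_apply']
    rw [h1, hB₀N]
    have := he.chartDeriv_chartSymmDeriv h0t v
    rwa [hx0] at this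
  have hBs : ∀ u v, stdAlt d ![B u, B v] = stdAlt d ![u, v] := fun u v => by
    rw [hBapp, hBapp, he.stdAlt_chartDeriv hxe]
    have h1 := hB₀σ (chartSymmDeriv (E := E) e 0 u) (chartSymmDeriv (E := E) e 0 v)
    rw [altForm_apply, altForm_apply] at h1
    have h2 := he.formAt_symm h0t u v
    rw [hx0] at h2
    rw [h1, h2]
  -- the germ `F⁻¹ ∘ B`, in the chart
  have hF't : ((F⁻¹ : Symp Ω) : Equiv.Perm M) (e.symm 0) ∈ e.source := by rwa [hx0, hFx']
  have hdom : ∀ᶠ y in 𝓝 (0 : R2 d), B y ∈ e.target ∧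
      ((F⁻¹ : Symp Ω) : Equiv.Perm M) (e.symm (B y)) ∈ e.source := by
    have h1 : Filter.Tendsto (fun y => (F⁻¹, B y)) (𝓝 (0 : R2 d)) (𝓝 (F⁻¹, (0 : R2 d))) := by
      have : Continuous fun y => (F⁻¹, B y) := by fun_prop
      simpa using this.tendsto 0
    exact h1.eventually ((isOpen_inChart_domain Ω e).mem_nhds ⟨h0t, hF't⟩)
  obtain ⟨H, hH⟩ : ∃ H : R2 d → R2 d,
      H = fun y => inChart e ((F⁻¹ : Symp Ω) : Equiv.Perm M) (B y) := ⟨_, rfl⟩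
  have hHd : ∀ y, B y ∈ e.target → ((F⁻¹ : Symp Ω) : Equiv.Perm M) (e.symm (B y)) ∈ e.source →
      fderiv ℝ H y = inChartDeriv (E := E) e ((F⁻¹ : Symp Ω) : Equiv.Perm M) (B y) ∘L B :=
    fun y h1 h2 => by
      rw [hH]; exact ((he.hasFDerivAt_inChart F⁻¹ h1 h2).comp y B.hasFDerivAt).fderiv
  obtain ⟨φ, hφH, hφη⟩ := hext H (by
      rw [hH]
      refine ContDiffAt.comp 0 (g := inChart e ((F⁻¹ : Symp Ω) : Equiv.Perm M)) ?_
        B.contDiff.contDiffAt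
      rw [map_zero]
      exact he.contDiffAt_inChart F⁻¹ h0t hF't)
    (by simp only [hH, inChart]; rw [map_zero, hx0, hFx', hex])
    (by
      filter_upwards [hdom] with y hy u v
      rw [hHd y hy.1 hy.2, ContinuousLinearMap.comp_apply, ContinuousLinearMap.comp_apply,
        he.stdAlt_inChartDeriv F⁻¹ hy.1 hy.2, hBs])
    (by
      rw [hHd 0 (by rwa [map_zero]) (by rwa [map_zero]), map_zero]
      refine lt_of_eq_of_lt ?_ (hεδ B₀ hB₀)
      congr 2
      ext1 v
      simp only [inChartDeriv, ContinuousLinearMap.comp_apply, hBapp, hx0, hFx', hDS]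
      rfl) r hr
  -- the perturbation
  set T := transport he (isCompact_closedBall _ _) hrt φ with hT
  have hTO : ∀ z ∈ e.source, (T : Equiv.Perm M) z ∈ e.source := fun z hz => by
    rw [hT, transport_apply, chartExtend_of_mem _ hz]
    exact e.map_target (mem_of_perm_apply_ne (fun y hy => φ.2.2 y fun h => hy (hrt h))
      (e.map_source hz))
  have hTid : ∀ z ∉ e.source, (T : Equiv.Perm M) z = z := fun z hz => if_neg hz
  have hgn : ∀ z ∈ e.source, ((f * T : Symp Ω) : Equiv.Perm M)^[n] z =
      (F : Equiv.Perm M) ((T : Equiv.Perm M) z) := fun z hz => by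
    rw [hFi]
    exact iterate_comp_eq_of_disjoint (f := (f : Equiv.Perm M)) (T := (T : Equiv.Perm M)) hn hTid
      hTO (fun k h0 hk z hz h => hOdisj k h0 hk z (heO hz) (heO h)) hz
  have hret : ∀ᶠ y in 𝓝 (0 : R2 d),
      ((f * T : Symp Ω) : Equiv.Perm M)^[n] (e.symm y) = e.symm (B y) := by
    filter_upwards [hdom, hφH, e.open_target.mem_nhds h0t] with y h1 h2 h3
    rw [hgn _ (e.map_target h3), hT, transport_apply, chartExtend_symm _ h3, h2, hH]
    simp only [inChart]
    rw [e.left_inv h1.2, InvMemClass.coe_inv]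
    exact (F : Equiv.Perm M).apply_symm_apply _
  have hret' : ∀ᶠ y in 𝓝 (0 : R2 d), ∀ k ≤ N,
      ((f * T : Symp Ω) : Equiv.Perm M)^[n * k] (e.symm y) = e.symm (B^[k] y) := by
    have h1 : ∀ k, ∀ᶠ y in 𝓝 (0 : R2 d), ((f * T : Symp Ω) : Equiv.Perm M)^[n] (e.symm (B^[k] y)) =
        e.symm (B (B^[k] y)) := fun k => by
      have h2 : Filter.Tendsto B^[k] (𝓝 (0 : R2 d)) (𝓝 0) := by
        have := (B.continuous.iterate k).tendsto 0
        rwa [Function.iterate_fixed (map_zero B)] at this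
      exact h2.eventually hret
    have h3 := (Filter.eventually_all_finset (Finset.range N)).mpr fun k _ => h1 k
    filter_upwards [h3] with y hy k
    induction k with
    | zero => intro _; rfl
    | succ k ih =>
      intro hk
      rw [Nat.mul_succ, Nat.add_comm, Function.iterate_add_apply, ih (by omega),
        hy k (Finset.mem_range.mpr hk), ← Function.iterate_succ_apply' B]
  have hfin : ∀ᶠ z in 𝓝 x, ((f * T : Symp Ω) : Equiv.Perm M)^[n * N] z = z := by
    have h1 : Filter.Tendsto e (𝓝 x) (𝓝 0) := by rw [← hex]; exact e.continuousAt hxe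
    filter_upwards [h1.eventually hret', e.open_source.mem_nhds hxe] with z hz hzs
    have h2 := hz N le_rfl
    rwa [e.left_inv hzs, hBN, e.left_inv hzs] at h2
  obtain ⟨W, hW, hWo, hxW⟩ := mem_nhds_iff.mp hfin
  exact ⟨f * T, hηU φ hφη, n * N, Nat.mul_pos hn hN, W, hWo, ⟨x, hxW⟩, fun y hy => hW hy⟩

theorem robustEllipticSet_subset_closure [T2Space M] (hd : 0 < d)
    (hE : Module.finrank ℝ E = 2 * d) (hΩ : IsSymplecticForm Ω) :
    robustEllipticSet Ω ⊆ closure (finiteOrderOnOpenSet Ω) := by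
  intro f hf
  rw [mem_closure_iff_nhds]
  intro U hU
  obtain ⟨n, x, V, hV, p, hpf, -, hell⟩ := id hf
  have hfx : IsTotallyElliptic f n x := by
    rw [← hpf]; exact hell f (mem_of_mem_nhds hV)
  obtain ⟨g, hg, hgW⟩ := exists_finite_order_near_point hd hE hΩ hfx
    (Filter.inter_mem hU ((isOpen_robustEllipticSet Ω).mem_nhds hf))
  exact ⟨g, hg.1, hg.2, hgW⟩

end Density

/-! ### Symplectic maps supported in balls of `ℝ^{2d}` -/

section Balls

variable {d : ℕ}

/-- The similarity `x ↦ a + c x`. -/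
noncomputable def similarity (a : R2 d) {c : ℝ} (hc : c ≠ 0) : Equiv.Perm (R2 d) where
  toFun x := a + c • x
  invFun x := c⁻¹ • (x - a)
  left_inv x := by simp [smul_smul, inv_mul_cancel₀ hc]
  right_inv x := by simp [smul_smul, mul_inv_cancel₀ hc]

theorem conj_similarity_apply (a : R2 d) {c : ℝ} (hc : c ≠ 0) (φ : Equiv.Perm (R2 d)) (x : R2 d) :
    MulAut.conj (similarity a hc) φ x = a + c • φ (c⁻¹ • (x - a)) := rfl

theorem contDiff_conj_similarity (a : R2 d) {c : ℝ} (hc : c ≠ 0) {φ : Equiv.Perm (R2 d)}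
    (hφ : ContDiff ℝ 1 φ) : ContDiff ℝ 1 (MulAut.conj (similarity a hc) φ) := by
  have h : (MulAut.conj (similarity a hc) φ : R2 d → R2 d) =
      fun x => a + c • φ (c⁻¹ • (x - a)) := rfl
  rw [h]
  fun_prop

theorem fderiv_conj_similarity (a : R2 d) {c : ℝ} (hc : c ≠ 0) {φ : Equiv.Perm (R2 d)}
    (hφ : ContDiff ℝ 1 φ) (x : R2 d) :
    fderiv ℝ (MulAut.conj (similarity a hc) φ) x = fderiv ℝ φ (c⁻¹ • (x - a)) := by
  have h1 : HasFDerivAt (fun x : R2 d => c⁻¹ • (x - a))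
      (c⁻¹ • ContinuousLinearMap.id ℝ (R2 d)) x :=
    ((hasFDerivAt_id x).sub_const a).const_smul c⁻¹
  have h2 := (((hφ.differentiable one_ne_zero) (c⁻¹ • (x - a))).hasFDerivAt.comp x
    h1).const_smul c |>.const_add a
  refine HasFDerivAt.fderiv (h2.congr_fderiv ?_)
  ext1 v
  simp only [smul_apply, ContinuousLinearMap.comp_apply, ContinuousLinearMap.id_apply, map_smul,
    smul_smul, mul_inv_cancel₀ hc, one_smul]

theorem conj_similarity_mem (a : R2 d) {c : ℝ} (hc : 0 < c) {r : ℝ} {φ : Equiv.Perm (R2 d)}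
    (hφ : φ ∈ SympRel (stdForm d) (Metric.closedBall 0 r)ᶜ) :
    MulAut.conj (similarity a hc.ne') φ ∈ SympRel (stdForm d) (Metric.closedBall a (c * r))ᶜ := by
  obtain ⟨h1, h2, h3⟩ := mem_symp_stdForm_iff.mp hφ.1
  refine ⟨mem_symp_stdForm_iff.mpr ⟨contDiff_conj_similarity a hc.ne' h1, ?_, fun x u v => ?_⟩,
    fun x hx => ?_⟩
  · have h4 : (MulAut.conj (similarity a hc.ne') φ).symm = MulAut.conj (similarity a hc.ne') φ⁻¹ := by
      rw [map_inv]; rfl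
    rw [h4]
    exact contDiff_conj_similarity a hc.ne' h2
  · rw [fderiv_conj_similarity a hc.ne' h1, h3]
  · have h4 : c⁻¹ • (x - a) ∈ (Metric.closedBall (0 : R2 d) r)ᶜ := fun h => hx (by
      rw [mem_closedBall_zero_iff, norm_smul, norm_inv, Real.norm_of_nonneg hc.le,
        inv_mul_le_iff₀ hc] at h
      rwa [Metric.mem_closedBall, dist_eq_norm])
    rw [conj_similarity_apply, hφ.2 _ h4, smul_smul, mul_inv_cancel₀ hc.ne', one_smul]
    abel

theorem sympRel_mono {s t : Set (R2 d)} (h : s ⊆ t) {φ : Equiv.Perm (R2 d)}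
    (hφ : φ ∈ SympRel (stdForm d) t) : φ ∈ SympRel (stdForm d) s :=
  ⟨hφ.1, fun x hx => hφ.2 x (h hx)⟩

/-- The symplectic maps of the unit disc, contracted to the disc of radius `r`. -/
noncomputable def contractDisc (d : ℕ) {r : ℝ} (hr : 0 < r) :
    SympDisc d →* SympRel (stdForm d) (Metric.closedBall (0 : R2 d) r)ᶜ where
  toFun φ := ⟨MulAut.conj (similarity 0 hr.ne') φ, by
    have := conj_similarity_mem 0 hr φ.2; rwa [mul_one] at this⟩
  map_one' := Subtype.ext (map_one _)
  map_mul' _ _ := Subtype.ext (map_mul _ _ _)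

theorem contractDisc_injective (d : ℕ) {r : ℝ} (hr : 0 < r) :
    Function.Injective (contractDisc d hr) := fun _ _ h =>
  Subtype.ext ((MulAut.conj (similarity (0 : R2 d) hr.ne')).injective (congrArg Subtype.val h))

theorem exists_sympRel_ne (hd : 0 < d) {r : ℝ} (hr : 0 < r) :
    ∃ φ : SympRel (stdForm d) (Metric.closedBall (0 : R2 d) r)ᶜ, ∃ x,
      (φ : Equiv.Perm (R2 d)) x ≠ x := by
  obtain ⟨φ, -, s, hs, hφ⟩ := exists_sympRel_rotation d hr
  refine ⟨φ, ?_⟩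
  by_contra! h
  have h1 : ((φ : Equiv.Perm (R2 d)) : R2 d → R2 d) = id := funext h
  have : Nonempty (Fin d) := ⟨⟨0, hd⟩⟩
  obtain ⟨v, hv⟩ := exists_ne (0 : R2 d)
  have h2 := hφ v
  rw [h1, fderiv_id, ContinuousLinearMap.id_apply, alt_self] at h2
  have : 0 < s * ‖v‖ ^ 2 := by positivity
  linarith

/-- The group of the symplectic maps of the disc is not commutative: a map supported in a small disc
that is displaced by another map does not commute with it. -/
theorem exists_sympDisc_not_commute (hd : 0 < d) : ∃ φ ψ : SympDisc d, φ * ψ ≠ ψ * φ := by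
  obtain ⟨φ, a, ha⟩ := exists_sympRel_ne hd one_half_pos
  have ha' : ‖a‖ ≤ 1 / 2 := by
    by_contra h
    exact ha (φ.2.2 a fun h' => h (by simpa using h'))
  have hφc : Continuous (φ : Equiv.Perm (R2 d)) :=
    (mem_symp_stdForm_iff.mp φ.2.1).1.continuous
  obtain ⟨O, hO, haO, hOd⟩ := exists_open_disjoint_iterates hφc (x := a) (n := 2)
    fun k h0 hk => by
      obtain rfl : k = 1 := by omega
      exact ha
  obtain ⟨ρ₀, hρ₀, hρO⟩ := Metric.nhds_basis_closedBall.mem_iff.mp (hO.mem_nhds haO)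
  set ρ := min ρ₀ (1 / 2) with hρ
  have hρ0 : 0 < ρ := lt_min hρ₀ one_half_pos
  obtain ⟨ψ, c, hc⟩ := exists_sympRel_ne hd hρ0
  set ψ' := MulAut.conj (similarity a one_ne_zero) (ψ : Equiv.Perm (R2 d)) with hψ'
  have hψm : ψ' ∈ SympRel (stdForm d) (Metric.closedBall a ρ)ᶜ := by
    have := conj_similarity_mem a one_pos ψ.2; rwa [one_mul] at this
  have hψc : ∀ z, ψ' (a + z) = a + (ψ : Equiv.Perm (R2 d)) z := fun z => by
    rw [hψ', conj_similarity_apply]; simp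
  refine ⟨⟨φ, sympRel_mono (Set.compl_subset_compl.mpr
      (Metric.closedBall_subset_closedBall (by norm_num))) φ.2⟩,
    ⟨ψ', sympRel_mono (Set.compl_subset_compl.mpr fun z hz => ?_) hψm⟩, fun h => ?_⟩
  · rw [Metric.mem_closedBall, dist_eq_norm] at hz
    have h1 : ‖z‖ ≤ ‖z - a‖ + ‖a‖ := by simpa using norm_add_le (z - a) a
    have h2 := min_le_right ρ₀ (1 / 2 : ℝ)
    rw [mem_closedBall_zero_iff]
    linarith
  · have h1 := DFunLike.congr_fun (congrArg Subtype.val h) (a + c)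
    change (φ : Equiv.Perm (R2 d)) (ψ' (a + c)) = ψ' ((φ : Equiv.Perm (R2 d)) (a + c)) at h1
    have hcρ : ‖c‖ ≤ ρ := by
      by_contra h'
      exact hc (ψ.2.2 c fun h'' => h' (by simpa using h''))
    have hcO : a + c ∈ O := hρO (by
      rw [Metric.mem_closedBall, dist_eq_norm, add_sub_cancel_left]
      exact hcρ.trans (min_le_left _ _))
    have h2 : (φ : Equiv.Perm (R2 d)) (a + c) ∉ O := hOd 1 one_pos one_lt_two _ hcO
    rw [hψm.2 _ fun h' => h2 (hρO (Metric.closedBall_subset_closedBall (min_le_left _ _) h'))] at h1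
    have h3 := (φ : Equiv.Perm (R2 d)).injective h1
    rw [hψc] at h3
    exact hc (add_left_cancel h3)

end Balls

/-! ### Commuting extensions along a periodic orbit of sets -/

section PeriodicExtension

variable {G Γ X : Type*} [Group G] [Group Γ] [MulAction G X]

/-- The product of the first `n` conjugates by the powers of `g` of the image of `φ`. -/
def conjProd (T : Γ →* G) (g : G) (n : ℕ) (φ : Γ) : G :=
  ((List.range n).map fun k => g ^ k * T φ * (g ^ k)⁻¹).prod

theorem conjProd_succ (T : Γ →* G) (g : G) (n : ℕ) (φ : Γ) :
    conjProd T g (n + 1) φ = conjProd T g n φ * (g ^ n * T φ * (g ^ n)⁻¹) := by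
  simp [conjProd, List.range_succ]

variable {T : Γ →* G} {g : G} {S : Set X} {p : ℕ}

theorem smul_mem_of_fixes_compl (hT : ∀ φ, ∀ z ∉ S, T φ • z = z) (φ : Γ) {z : X} (hz : z ∈ S) :
    T φ • z ∈ S := by
  by_contra h
  have h1 := hT φ⁻¹ _ h
  rw [map_inv, inv_smul_smul] at h1
  exact h (h1 ▸ hz)

theorem pow_smul_ne_of_lt (hS : ∀ k, 0 < k → k < p → ∀ z ∈ S, g ^ k • z ∉ S) {i j : ℕ} (hij : i < j)
    (hj : j < p) {z w : X} (hz : z ∈ S) (hw : w ∈ S) : g ^ i • z ≠ g ^ j • w := by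
  intro h
  obtain ⟨k, rfl⟩ := Nat.exists_eq_add_of_lt hij
  rw [add_assoc, pow_add, mul_smul, smul_left_cancel_iff] at h
  exact hS (k + 1) (by omega) (by omega) w hw (h ▸ hz)

theorem conjProd_smul (hT : ∀ φ, ∀ z ∉ S, T φ • z = z)
    (hS : ∀ k, 0 < k → k < p → ∀ z ∈ S, g ^ k • z ∉ S) (φ : Γ) {n : ℕ} (hn : n ≤ p) :
    (∀ j < n, ∀ z ∈ S, conjProd T g n φ • g ^ j • z = g ^ j • T φ • z) ∧
      ∀ x : X, (∀ j < n, ∀ z ∈ S, x ≠ g ^ j • z) → conjProd T g n φ • x = x := by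
  induction n with
  | zero => exact ⟨fun j hj => absurd hj (by omega), fun x _ => by simp [conjProd]⟩
  | succ n ih =>
    obtain ⟨ih1, ih2⟩ := ih (by omega)
    have hfix : ∀ x : X, (∀ z ∈ S, x ≠ g ^ n • z) → (g ^ n * T φ * (g ^ n)⁻¹) • x = x := by
      intro x hx
      have h1 : (g ^ n)⁻¹ • x ∉ S := fun h => hx _ h (by rw [smul_inv_smul])
      rw [mul_smul, mul_smul, hT φ _ h1, smul_inv_smul]
    refine ⟨fun j hj z hz => ?_, fun x hx => ?_⟩
    · rw [conjProd_succ, mul_smul]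
      rcases Nat.lt_succ_iff_lt_or_eq.mp hj with hj | rfl
      · rw [hfix _ fun w hw => pow_smul_ne_of_lt hS hj (by omega) hz hw, ih1 j hj z hz]
      · have h1 := smul_mem_of_fixes_compl hT φ hz
        rw [mul_smul, mul_smul, inv_smul_smul, ih2 _ fun i hi w hw =>
          (pow_smul_ne_of_lt hS hi (by omega) hw h1).symm]
    · rw [conjProd_succ, mul_smul, hfix x fun z hz => hx n (by omega) z hz,
        ih2 x fun j hj z hz => hx j (by omega) z hz]

/-- If the sets `S`, `g S`, …, `g^{p-1} S` are disjoint and `g^p` is the identity on `S`, then an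
action supported in `S` extends to one that commutes with `g`. -/
theorem exists_commuting_extension [FaithfulSMul G X] (hp : 0 < p)
    (hT : ∀ φ, ∀ z ∉ S, T φ • z = z) (hgp : ∀ z ∈ S, g ^ p • z = z)
    (hS : ∀ k, 0 < k → k < p → ∀ z ∈ S, g ^ k • z ∉ S) :
    ∃ Φ : Γ →* G, (∀ φ, g * Φ φ = Φ φ * g) ∧ ∀ φ, ∀ z ∈ S, Φ φ • z = T φ • z := by
  have h1 : ∀ φ, ∀ j < p, ∀ z ∈ S, conjProd T g p φ • g ^ j • z = g ^ j • T φ • z :=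
    fun φ => (conjProd_smul hT hS φ le_rfl).1
  have h2 : ∀ φ, ∀ x : X, (∀ j < p, ∀ z ∈ S, x ≠ g ^ j • z) → conjProd T g p φ • x = x :=
    fun φ => (conjProd_smul hT hS φ le_rfl).2
  have h0 : ∀ φ, ∀ z ∈ S, conjProd T g p φ • z = T φ • z := fun φ z hz => by
    simpa using h1 φ 0 hp z hz
  have hmem : ∀ φ, ∀ z ∈ S, T φ • z ∈ S := fun φ z hz => smul_mem_of_fixes_compl hT φ hz
  have hcases : ∀ x : X, (∃ j < p, ∃ z ∈ S, x = g ^ j • z) ∨ ∀ j < p, ∀ z ∈ S, x ≠ g ^ j • z :=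
    fun x => by
      by_cases h : ∃ j < p, ∃ z ∈ S, x = g ^ j • z
      · exact Or.inl h
      · push Not at h
        exact Or.inr h
  have hmul : ∀ φ ψ, conjProd T g p (φ * ψ) = conjProd T g p φ * conjProd T g p ψ := by
    intro φ ψ
    refine FaithfulSMul.eq_of_smul_eq_smul (α := X) fun x => ?_
    rw [mul_smul]
    rcases hcases x with ⟨j, hj, z, hz, rfl⟩ | hx
    · rw [h1 _ j hj z hz, h1 _ j hj z hz, h1 _ j hj _ (hmem ψ z hz), map_mul, mul_smul]
    · rw [h2 _ x hx, h2 _ x hx, h2 _ x hx]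
  refine ⟨MonoidHom.mk' (conjProd T g p) hmul, fun φ => ?_, h0⟩
  refine FaithfulSMul.eq_of_smul_eq_smul (α := X) fun x => ?_
  change (g * conjProd T g p φ) • x = (conjProd T g p φ * g) • x
  rw [mul_smul, mul_smul]
  rcases hcases x with ⟨j, hj, z, hz, rfl⟩ | hx
  · have hs : ∀ w : X, g • g ^ j • w = g ^ (j + 1) • w := fun w => by rw [pow_succ', mul_smul]
    rw [h1 φ j hj z hz, hs, hs]
    rcases Nat.lt_or_ge (j + 1) p with hj' | hj'
    · rw [h1 φ (j + 1) hj' z hz]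
    · obtain rfl : p = j + 1 := by omega
      rw [hgp z hz, h0 φ z hz, hgp _ (hmem φ z hz)]
  · rw [h2 φ x hx, h2 φ (g • x)]
    rintro j hj z hz h
    rcases Nat.eq_zero_or_pos j with rfl | hj0
    · rw [pow_zero, one_smul, ← hgp z hz] at h
      obtain ⟨q, rfl⟩ : ∃ q, p = q + 1 := ⟨p - 1, by omega⟩
      rw [pow_succ', mul_smul, smul_left_cancel_iff] at h
      exact hx q (by omega) z hz h
    · obtain ⟨q, rfl⟩ : ∃ q, j = q + 1 := ⟨j - 1, by omega⟩
      rw [pow_succ', mul_smul, smul_left_cancel_iff] at h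
      exact hx q (by omega) z hz h

end PeriodicExtension

/-! ### The centralizer of a map of finite order on an open set -/

section Centralizer

variable {E : Type*} [NormedAddCommGroup E] [NormedSpace ℝ E]
variable {M : Type*} [TopologicalSpace M] [ChartedSpace E M]
variable {d : ℕ} {Ω : TwoForm E M} {e : OpenPartialHomeomorph M (R2 d)}

theorem transport_injective [T2Space M] (he : IsDarbouxChart Ω e) {K : Set (R2 d)}
    (hK : IsCompact K) (hKt : K ⊆ e.target) : Function.Injective (transport he hK hKt) := by
  intro φ ψ h
  refine Subtype.ext (Equiv.ext fun y => ?_)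
  by_cases hy : y ∈ e.target
  · have h1 : chartExtend e φ (e.symm y) = chartExtend e ψ (e.symm y) :=
      DFunLike.congr_fun (congrArg Subtype.val h) (e.symm y)
    rw [chartExtend_symm _ hy, chartExtend_symm _ hy] at h1
    have h2 : ∀ φ : SympRel (stdForm d) Kᶜ, (φ : Equiv.Perm (R2 d)) y ∈ e.target := fun φ =>
      mem_of_perm_apply_ne (fun y hy => φ.2.2 y fun h => hy (hKt h)) hy
    exact e.symm.injOn (h2 φ) (h2 ψ) h1
  · rw [φ.2.2 y fun h => hy (hKt h), ψ.2.2 y fun h => hy (hKt h)]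

/-- On a non-empty open set where `g^m = 1`, the least period is locally constant at the points where
it is largest. -/
theorem exists_open_constant_period {X : Type*} [TopologicalSpace X] [T2Space X] {g : X → X}
    (hg : Continuous g) {m : ℕ} (hm : 0 < m) {W : Set X} (hW : IsOpen W) (hWn : W.Nonempty)
    (hWm : ∀ y ∈ W, g^[m] y = y) : ∃ p, 0 < p ∧ ∃ O : Set X, IsOpen O ∧ O.Nonempty ∧
      (∀ z ∈ O, g^[p] z = z) ∧ ∀ k, 0 < k → k < p → ∀ z ∈ O, g^[k] z ∉ O := by
  have hle : ∀ y ∈ W, Function.minimalPeriod g y ≤ m := fun y hy =>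
    Function.IsPeriodicPt.minimalPeriod_le hm (hWm y hy)
  have hpos : ∀ y ∈ W, 0 < Function.minimalPeriod g y := fun y hy =>
    Function.IsPeriodicPt.minimalPeriod_pos hm (hWm y hy)
  obtain ⟨y, hy, hmax⟩ : ∃ y ∈ W, ∀ z ∈ W,
      Function.minimalPeriod g z ≤ Function.minimalPeriod g y := by
    have hfin : (Function.minimalPeriod g '' W).Finite :=
      (Set.finite_Iic m).subset (by rintro _ ⟨z, hz, rfl⟩; exact hle z hz)
    obtain ⟨y, hy, h⟩ := hfin.exists_maximalFor' (Function.minimalPeriod g) W hWn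
    exact ⟨y, hy, fun z hz => (le_total _ _).elim id fun h' => h hz h'⟩
  set p := Function.minimalPeriod g y with hp
  obtain ⟨O, hO, hyO, hOd⟩ := exists_open_disjoint_iterates hg (x := y) (n := p)
    fun k h0 hk h => by
      have := Function.IsPeriodicPt.minimalPeriod_le h0 (h : Function.IsPeriodicPt g k y)
      omega
  refine ⟨p, hpos y hy, O ∩ W, hO.inter hW, ⟨y, hyO, hy⟩, fun z hz => ?_,
    fun k h0 hk z hz hz' => hOd k h0 hk z hz.1 hz'.1⟩
  have h1 : p ≤ Function.minimalPeriod g z := by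
    by_contra! h
    have h2 := hOd _ (hpos z hz.2) h z hz.1
    rw [Function.iterate_minimalPeriod] at h2
    exact h2 hz.1
  rw [le_antisymm h1 (hmax z hz.2)]
  exact Function.iterate_minimalPeriod

variable [FiniteDimensional ℝ E] [IsManifold 𝓘(ℝ, E) ∞ M]

/-- If `g` has finite order on a non-empty open set, then the symplectic maps of a small disc extend
to maps that commute with `g`. -/
theorem exists_sympDisc_hom_centralizer [T2Space M] (hE : Module.finrank ℝ E = 2 * d)
    (hΩ : IsSymplecticForm Ω) {g : Symp Ω} {m : ℕ} (hm : 0 < m) {W : Set M}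
    (hW : IsOpen W) (hWn : W.Nonempty) (hWm : ∀ y ∈ W, (g : Equiv.Perm M)^[m] y = y) :
    ∃ Φ : SympDisc d →* Symp Ω, Function.Injective Φ ∧ ∀ φ, g * Φ φ = Φ φ * g := by
  obtain ⟨p, hp, O, hO, ⟨x, hxO⟩, hOp, hOd⟩ :=
    exists_open_constant_period (Symp.continuous_coe g) hm hW hWn hWm
  obtain ⟨e₀, he₀, hxe₀, hex₀⟩ := exists_isDarbouxChart hE hΩ x
  obtain ⟨e, he, hxe, hex, heO⟩ : ∃ e : OpenPartialHomeomorph M (R2 d), IsDarbouxChart Ω e ∧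
      x ∈ e.source ∧ e x = 0 ∧ e.source ⊆ O :=
    ⟨e₀.restrOpen O hO, he₀.mono hO, ⟨hxe₀, hxO⟩, hex₀, fun z hz => hz.2⟩
  have h0t : (0 : R2 d) ∈ e.target := by rw [← hex]; exact e.map_source hxe
  obtain ⟨r, hr, hrt⟩ := Metric.nhds_basis_closedBall.mem_iff.mp (e.open_target.mem_nhds h0t)
  set T := (transport he (isCompact_closedBall _ _) hrt).comp (contractDisc d hr) with hT
  have hTinj : Function.Injective T :=
    (transport_injective he (isCompact_closedBall _ _) hrt).comp (contractDisc_injective d hr)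
  have hpow : ∀ (k : ℕ) (z : M), g ^ k • z = (g : Equiv.Perm M)^[k] z := fun k z => by
    rw [← coe_pow_eq_iterate]; rfl
  have hTid : ∀ φ, ∀ z ∉ e.source, T φ • z = z := fun φ z hz => if_neg hz
  obtain ⟨Φ, hΦ, hΦT⟩ := exists_commuting_extension (T := T) (g := g) (S := e.source) hp hTid
    (fun z hz => by rw [hpow, hOp z (heO hz)])
    (fun k h0 hk z hz h => hOd k h0 hk z (heO hz) (by rw [← hpow]; exact heO h))
  refine ⟨Φ, ?_, hΦ⟩
  rw [injective_iff_map_eq_one]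
  intro φ hφ
  apply hTinj
  rw [map_one]
  refine FaithfulSMul.eq_of_smul_eq_smul (α := M) fun z => ?_
  rw [one_smul]
  by_cases hz : z ∈ e.source
  · rw [← hΦT φ z hz, hφ, one_smul]
  · exact hTid φ z hz

end Centralizer

end SympCentralizer

theorem theorem5 {d : ℕ} (hd : 0 < d)
    {E : Type*} [NormedAddCommGroup E] [NormedSpace ℝ E] [FiniteDimensional ℝ E]
    (hE : Module.finrank ℝ E = 2 * d)
    {M : Type*} [TopologicalSpace M] [ChartedSpace E M] [IsManifold 𝓘(ℝ, E) ∞ M]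
    [CompactSpace M] [T2Space M] [Nonempty M]
    (Ω : SympCentralizer.TwoForm E M) (hΩ : SympCentralizer.IsSymplecticForm Ω) :
    IsOpen (SympCentralizer.robustEllipticSet Ω) ∧
    (SympCentralizer.robustEllipticSet Ω).Nonempty ∧
    ∃ D : Set (SympCentralizer.Symp Ω),
      D ⊆ SympCentralizer.robustEllipticSet Ω ∧
      SympCentralizer.robustEllipticSet Ω ⊆ closure D ∧
      ∀ f ∈ D,
        Subgroup.centralizer {f} ≠ Subgroup.zpowers f ∧
        ∃ H : Subgroup (SympCentralizer.Symp Ω),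
          H ≤ Subgroup.centralizer {f} ∧ Nonempty (H ≃* SympCentralizer.SympDisc d) := by
  refine ⟨SympCentralizer.isOpen_robustEllipticSet Ω,
    SympCentralizer.robustEllipticSet_nonempty hE hΩ, SympCentralizer.finiteOrderOnOpenSet Ω,
    fun f hf => hf.1, SympCentralizer.robustEllipticSet_subset_closure hd hE hΩ, ?_⟩
  rintro f ⟨-, m, hm, W, hW, hWn, hWm⟩
  obtain ⟨Φ, hΦ, hΦf⟩ := SympCentralizer.exists_sympDisc_hom_centralizer hE hΩ hm hW hWn hWm
  have hmem : ∀ φ, Φ φ ∈ Subgroup.centralizer {f} := fun φ =>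
    Subgroup.mem_centralizer_singleton_iff.mpr (hΦf φ).symm
  refine ⟨fun h => ?_, Φ.range, ?_, ⟨(MonoidHom.ofInjective hΦ).symm⟩⟩
  · -- a cyclic centralizer would make the group of the disc commutative
    obtain ⟨φ, ψ, hφψ⟩ := SympCentralizer.exists_sympDisc_not_commute hd
    obtain ⟨i, hi⟩ := Subgroup.mem_zpowers_iff.mp (h ▸ hmem φ)
    obtain ⟨j, hj⟩ := Subgroup.mem_zpowers_iff.mp (h ▸ hmem ψ)
    apply hφψ
    apply hΦ
    rw [map_mul, map_mul, ← hi, ← hj, ← zpow_add, ← zpow_add, add_comm]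
  · rintro _ ⟨φ, rfl⟩
    exact hmem φ
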